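/- Let $a,b,c:\mathbb R\to\mathbb R$ be smooth with $|a''|,|b''|,|c''|\ge\kappa$ on $\mathbb R$ for some $\kappa>0$, and let $m:\mathbb R^2\to\mathbb C$ be smooth and compactly supported. Write $\widehat f(\xi)=(2\pi)^{-1/2}\int e^{-ix\xi}f(x)\,dx$, let $p(D)$ be the Fourier multiplier with symbol $p$, and let $T_m$ be the pseudo-product given by $\widehat{T_m(f,g)}(\xi)=\int m(\xi-\eta,\eta)\widehat f(\xi-\eta)\widehat g(\eta)\,d\eta$. Put $\|f\|_{L^{2,s}}=\|(1+x^2)^{s/2}f\|_{L^2(\mathbb R)}$ and $\phi(\xi,\eta)=-a(\xi+\eta)+b(\xi)+c(\eta)$. Assume that there are no space resonances on the support of $m$, i.e. $(\partial_\xi-\partial_\eta)\phi\neq 0$ at every point of $\operatorname{supp} m$. Let $q\in[2,\infty]$ (with $1/\infty=0$), $s\ge 0$ and $\delta>0$. For $f,g\in L^{2,s}$ let $u,v,w\in C(\mathbb R;L^2(\mathbb R))$ be a solution of $$i\partial_t u+a(D)u=T_m(v,w),\qquad i\partial_t v+b(D)v=0,\qquad i\partial_t w+c(D)w=0,$$ $$u(0)=0,\qquad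 v(0)=f,\qquad w(0)=g,$$ where the equations are understood weakly, tested against functions whose Fourier transform is smooth and compactly supported. Then, for all $t\ge 1$ (and even for all $t>0$ if $\delta\le\frac14$): - if $0\le s<\frac1q$, then $\|u(t)\|_{L^q}\le C\,t^{\frac1{2q}+\frac12-\frac32 s+\delta}\,\|f\|_{L^{2,s}}\|g\|_{L^{2,s}}$; - if $\frac1q<s<1-\frac1q$, then $\|u(t)\|_{L^q}\le C\,t^{\frac12-s+\delta}\,\|f\|_{L^{2,s}}\|g\|_{L^{2,s}}$; - if $s>1-\frac1q$, then $\|u(t)\|_{L^q}\le C\,t^{\frac1q-\frac12+\delta}\,\|f\|_{L^{2,s}}\|g\|_{L^{2,s}}$. Here $C$ depends only on $a,b,c,m,q,s,\delta$, and not on $f,g,t$. -/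

import Mathlib

open MeasureTheory FourierTransform

noncomputable section

namespace BilinearDispersive

/-- The space `L²(ℝ; ℂ)`. -/
abbrev L2 : Type := Lp ℂ 2 (volume : Measure ℝ)

/-- The unitary Fourier transform of an `L²` function in the convention
`f̂(ξ) = (2π)^{-1/2} ∫ e^{-ixξ} f(x) dx`. Mathlib's `𝓕` uses `e^{-2πixζ}` without a
prefactor, so it is evaluated at `ζ = ξ / (2π)`. -/
def hat (f : L2) (ξ : ℝ) : ℂ :=
  (((Real.sqrt (2 * Real.pi))⁻¹ : ℝ) : ℂ) * (𝓕 f : L2) (ξ / (2 * Real.pi))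

/-- The Fourier transform of the pseudo-product `T_m(f, g)`, that is
`ξ ↦ ∫ m(ξ - η, η) f̂(ξ - η) ĝ(η) dη`. -/
def pseudoProductHat (m : ℝ × ℝ → ℂ) (f g : L2) (ξ : ℝ) : ℂ :=
  ∫ η : ℝ, m (ξ - η, η) * hat f (ξ - η) * hat g η

/-- `u ∈ C(ℝ; L²)` is a weak solution of `i ∂ₜ u + p(D) u = N`, `u(0) = u₀`, where `p(D)` is the
Fourier multiplier with symbol `p` and `N` is given by its spatial Fourier transform `Nhat`. The
test functions are those whose Fourier transform `χ` is smooth and compactly supported: for each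
of them, `i d/dt ∫ û(t) χ + ∫ p û(t) χ = ∫ N̂(t) χ` holds at every time. -/
structure IsWeakSolution (p : ℝ → ℝ) (Nhat : ℝ → ℝ → ℂ) (u₀ : L2) (u : ℝ → L2) : Prop where
  continuous : Continuous u
  initial : u 0 = u₀
  equation : ∀ χ : ℝ → ℂ, ContDiff ℝ (⊤ : ℕ∞) χ → HasCompactSupport χ → ∀ t : ℝ,
    ∃ d : ℂ, HasDerivAt (fun τ : ℝ => ∫ ξ : ℝ, hat (u τ) ξ * χ ξ) d t ∧
      Complex.I * d + (∫ ξ : ℝ, (p ξ : ℂ) * hat (u t) ξ * χ ξ) = (∫ ξ : ℝ, Nhat t ξ * χ ξ)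

/-- `(u, v, w)` solves the system `i ∂ₜ u + a(D) u = T_m(v, w)`, `i ∂ₜ v + b(D) v = 0`,
`i ∂ₜ w + c(D) w = 0` with `u(0) = 0`, `v(0) = f`, `w(0) = g`. -/
structure IsSystemSolution (a b c : ℝ → ℝ) (m : ℝ × ℝ → ℂ) (f g : L2) (u v w : ℝ → L2) :
    Prop where
  eq_u : IsWeakSolution a (fun t => pseudoProductHat m (v t) (w t)) 0 u
  eq_v : IsWeakSolution b (fun _ _ => 0) f v
  eq_w : IsWeakSolution c (fun _ _ => 0) g w

/-- The second derivative of `p` is bounded away from zero. -/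
def SecondDerivBoundedAway (p : ℝ → ℝ) : Prop :=
  ∃ κ : ℝ, 0 < κ ∧ ∀ ξ : ℝ, κ ≤ |deriv (deriv p) ξ|

/-- The phase `φ(ξ, η) = -a(ξ + η) + b(ξ) + c(η)`. -/
def phase (a b c : ℝ → ℝ) (ξ η : ℝ) : ℝ := -a (ξ + η) + b ξ + c η

/-- The set of space resonances, where `(∂_ξ - ∂_η) φ` vanishes. -/
def spaceResonances (a b c : ℝ → ℝ) : Set (ℝ × ℝ) :=
  {x | deriv (fun ξ => phase a b c ξ x.2) x.1 - deriv (fun η => phase a b c x.1 η) x.2 = 0}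

/-- The weighted function `⟨x⟩^s f(x)`, where `⟨x⟩ = (1 + x²)^{1/2}`. -/
def weighted (s : ℝ) (f : L2) (x : ℝ) : ℂ :=
  ((Real.sqrt (1 + x ^ 2) ^ s : ℝ) : ℂ) * f x

/-- The times at which the decay estimates with loss `t^δ` are claimed: all `t ≥ 1`, and also the
times `0 < t < 1` when `δ` is small (for `t → 0` a large power `t^δ` would be a gain, not a loss). -/
def admissibleTimes (δ : ℝ) : Set ℝ := {t | 1 ≤ t ∨ (0 < t ∧ δ ≤ 1 / 4)}

/-- The estimate `‖u(t)‖_{L^q} ≤ C t^e ‖f‖_{L^{2,s}} ‖g‖_{L^{2,s}}` for the solution `u` of the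
system with arbitrary data `f, g ∈ L^{2,s}`, at all times `t` of `T`, with `C` independent of
`f`, `g` and `t`. -/
def DecayEstimate (a b c : ℝ → ℝ) (m : ℝ × ℝ → ℂ) (q : ENNReal) (s e : ℝ) (T : Set ℝ) : Prop :=
  ∃ C : ℝ, 0 ≤ C ∧ ∀ (f g : L2) (u v w : ℝ → L2),
    MemLp (weighted s f) 2 volume → MemLp (weighted s g) 2 volume →
    IsSystemSolution a b c m f g u v w → ∀ t ∈ T,
      eLpNorm (u t) q volume ≤ ENNReal.ofReal (C * t ^ e) *
        eLpNorm (weighted s f) 2 volume * eLpNorm (weighted s g) 2 volume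

end BilinearDispersive

end

noncomputable section

namespace BilinearDispersive

open scoped ENNReal

/-! ### The Fourier transform on `L¹ ∩ L²` -/

/-! Put r = 1/q. Duhamel's formula (`IsSystemSolution.hat_eq_duhamel`) gives û(t,ξ) = -i e^{ita(ξ)}
∫_0^t P(τ,ξ) dτ, where P(τ,ξ) = ∫ m(ξ-η,η) e^{iτφ(ξ-η,η)} f̂(ξ-η) ĝ(η) dη. At fixed ξ the
η-derivative of the phase is c'(η) - b'(ξ-η), which is -(∂_ξ-∂_η)φ. Without space resonances it does
not vanish on the support of m: there the phase is locally a coordinate on each slice, and one may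
integrate by parts in η.

Two bounds hold for the time integral of P against a weight w. In L² (`exists_nrm_profileInt_le`),
the τ-integral produces the Fourier transform of w evaluated at φ; Cauchy-Schwarz on the slice, the
change of variables η ↦ φ and Plancherel give C‖w‖_2 ‖f‖_2 ‖g‖_2. In L^∞
(`exists_norm_integral_profileInt_le`), van der Corput's test, using the curvature of a, bounds the
propagator from time τ to time t by C(t-τ)^{-1/2} from L¹ to L^∞, and the product of two L²
functions is in L¹, which gives C ∫ |w(τ)| (t-τ)^{-1/2} dτ ‖f‖_2 ‖g‖_2.

With w = 1 on (0,t) both bounds are O(√t). If f and g live in |x| ≤ R with 1 ≤ R ≤ t, the times τ <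
R are kept as they are, and for τ ≥ R one integration by parts gains 1/τ and costs at most R, since
a derivative of f̂ or ĝ costs R. This improves the bounds to √R in L² and R(log t + 1)/√t in L^∞
(`Setting.exists_duhamel_le_of_isLocalised`), and by interpolation to R^{1-r} t^{r-1/2+δ} in L^q.

Weighted data are cut into finitely many annuli with radii t^{j/J}, where J depends on δ alone. An
annulus at radius t^y has L² mass at most t^{-sy} times the weighted norm, so up to small losses its
contribution is t^{y(1-r-s)+r-1/2}. The exponent is affine in y, so its maximum over [0,1] is the
larger of r - 1/2 and 1/2 - s. The part |x| ≥ t costs √t t^{-s}, again t^{1/2-s}. Hence every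
exponent dominating r - 1/2 + δ and 1/2 - s + δ is admissible
(`Setting.exists_eLpNorm_duhamelSol_le_weighted`), and the three regimes follow by comparing
exponents. Times t < 1 need only the trivial bound O(t). -/

theorem continuous_fourier_of_integrable {f : ℝ → ℂ} (h1 : Integrable f) : Continuous (𝓕 f) :=
  VectorFourier.fourierIntegral_continuous Real.continuous_fourierChar
    (L := innerₗ ℝ) (by exact continuous_inner) h1

/-- On `L¹ ∩ L²` the `L²` Fourier transform is given by the Fourier integral. -/
theorem fourier_toLp_ae_eq {f : ℝ → ℂ} (h1 : Integrable f) (h2 : MemLp f 2) :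
    ((𝓕 (h2.toLp f) : L2) : ℝ → ℂ) =ᵐ[volume] 𝓕 f := by
  apply ae_eq_of_integral_contDiff_smul_eq
    ((Lp.memLp (𝓕 (h2.toLp f) : L2)).locallyIntegrable (by norm_num))
    (continuous_fourier_of_integrable h1).locallyIntegrable
  intro g hg hgc
  have hgc' : HasCompactSupport (fun x => (g x : ℂ)) :=
    hgc.comp_left (g := fun x : ℝ => (x : ℂ)) (by simp)
  have hg' : ContDiff ℝ (⊤ : ℕ∞) (fun x => (g x : ℂ)) :=
    Complex.ofRealCLM.contDiff.comp hg
  set G : SchwartzMap ℝ ℂ := hgc'.toSchwartzMap hg' with hG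
  -- The `L²` transform is compatible with the transform of tempered distributions, which moves `𝓕`
  -- onto the test function; self-adjointness of the Fourier integral moves it back onto `f`.
  have e1 := Lp.fourier_toTemperedDistribution_eq (h2.toLp f)
  have e2 := congrArg (fun T => T G) e1
  simp only [TemperedDistribution.fourier_apply, Lp.toTemperedDistribution_apply] at e2
  have hGx : ∀ x, G x = (g x : ℂ) := fun x => rfl
  calc ∫ x, g x • (𝓕 (h2.toLp f) : L2) x = ∫ x, G x • (𝓕 (h2.toLp f) : L2) x := by
        simp [hGx]
    _ = ∫ x, (𝓕 G) x • (h2.toLp f) x := e2.symm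
    _ = ∫ x, (𝓕 (fun y => G y)) x • f x := by
        apply integral_congr_ae
        filter_upwards [h2.coeFn_toLp] with x hx
        rw [hx, SchwartzMap.fourier_coe]
    _ = ∫ x, G x • 𝓕 f x := by
        have := VectorFourier.integral_fourierIntegral_smul_eq_flip (L := innerₗ ℝ) (μ := volume)
          (ν := volume) Real.continuous_fourierChar (by exact continuous_inner)
          G.integrable h1
        rw [flip_innerₗ] at this
        exact this
    _ = ∫ x, g x • 𝓕 f x := by simp [hGx]

/-- The same duality as for `𝓕`. Since `𝓕⁻ G` is `𝓕` of the reflected `G`, the self-adjointness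
formula for `𝓕` still suffices, at the price of one reflection of the variable. -/
theorem fourierInv_toLp_ae_eq {f : ℝ → ℂ} (h1 : Integrable f) (h2 : MemLp f 2) :
    ((𝓕⁻ (h2.toLp f) : L2) : ℝ → ℂ) =ᵐ[volume] 𝓕⁻ f := by
  have hinv : (𝓕⁻ f : ℝ → ℂ) = fun x => 𝓕 f (-x) := by
    funext x; exact Real.fourierInv_eq_fourier_neg f x
  apply ae_eq_of_integral_contDiff_smul_eq
    ((Lp.memLp (𝓕⁻ (h2.toLp f) : L2)).locallyIntegrable (by norm_num))
    (by rw [hinv]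
        exact ((continuous_fourier_of_integrable h1).comp continuous_neg).locallyIntegrable)
  intro g hg hgc
  have hgc' : HasCompactSupport (fun x => (g x : ℂ)) :=
    hgc.comp_left (g := fun x : ℝ => (x : ℂ)) (by simp)
  have hg' : ContDiff ℝ (⊤ : ℕ∞) (fun x => (g x : ℂ)) :=
    Complex.ofRealCLM.contDiff.comp hg
  set G : SchwartzMap ℝ ℂ := hgc'.toSchwartzMap hg' with hG
  have e1 := Lp.fourierInv_toTemperedDistribution_eq (h2.toLp f)
  have e2 := congrArg (fun T => T G) e1
  simp only [TemperedDistribution.fourierInv_apply, Lp.toTemperedDistribution_apply] at e2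
  have hGx : ∀ x, G x = (g x : ℂ) := fun x => rfl
  have hGr : Integrable (fun x => G (-x)) := G.integrable.comp_neg
  calc ∫ x, g x • (𝓕⁻ (h2.toLp f) : L2) x = ∫ x, G x • (𝓕⁻ (h2.toLp f) : L2) x := by
        simp [hGx]
    _ = ∫ x, (𝓕⁻ G) x • (h2.toLp f) x := e2.symm
    _ = ∫ x, (𝓕 (fun y => G (-y))) x • f x := by
        apply integral_congr_ae
        filter_upwards [h2.coeFn_toLp] with x hx
        rw [hx, SchwartzMap.fourierInv_coe, Real.fourierInv_eq_fourier_comp_neg]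
    _ = ∫ x, G (-x) • 𝓕 f x := by
        have := VectorFourier.integral_fourierIntegral_smul_eq_flip (L := innerₗ ℝ) (μ := volume)
          (ν := volume) Real.continuous_fourierChar (by exact continuous_inner)
          hGr h1
        rw [flip_innerₗ] at this
        exact this
    _ = ∫ x, G x • 𝓕 f (-x) := by
        rw [← integral_neg_eq_self]; simp
    _ = ∫ x, g x • 𝓕⁻ f x := by simp [hGx, hinv]

theorem eLpNorm_fourier {f : ℝ → ℂ} (h1 : Integrable f) (h2 : MemLp f 2) :
    eLpNorm (𝓕 f) 2 volume = eLpNorm f 2 volume := by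
  rw [← eLpNorm_congr_ae (fourier_toLp_ae_eq h1 h2), ← eLpNorm_congr_ae h2.coeFn_toLp]
  have := Lp.norm_fourier_eq (h2.toLp f)
  rw [Lp.norm_def, Lp.norm_def] at this
  exact (ENNReal.toReal_eq_toReal_iff' (Lp.eLpNorm_ne_top _) (Lp.eLpNorm_ne_top _)).1 this

/-! ### Passage to the unitary normalisation -/

theorem eLpNorm_comp_mul_left {g : ℝ → ℂ} {r : ℝ} (hr : 0 < r) :
    eLpNorm (fun x => g (r * x)) 2 volume
      = ENNReal.ofReal ((Real.sqrt r)⁻¹) * eLpNorm g 2 volume := by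
  have hm : MeasurableEmbedding (fun x : ℝ => r * x) :=
    (Homeomorph.mulLeft₀ r hr.ne').measurableEmbedding
  have h1 : eLpNorm g 2 (Measure.map (fun x : ℝ => r * x) volume)
      = eLpNorm (fun x => g (r * x)) 2 volume := hm.eLpNorm_map_measure
  rw [← h1, Real.map_volume_mul_left hr.ne', eLpNorm_smul_measure_of_ne_top (by norm_num),
    smul_eq_mul, abs_of_pos (inv_pos.2 hr)]
  congr 1
  rw [ENNReal.ofReal_rpow_of_pos (inv_pos.2 hr), Real.sqrt_eq_rpow, Real.inv_rpow hr.le]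
  simp

theorem sqrt_two_pi_pos : 0 < Real.sqrt (2 * Real.pi) := Real.sqrt_pos.2 Real.two_pi_pos

/-- The prefactor and the dilation by 2π cancel in `L²`; this is what makes `hat` and `hatI`
isometric. -/
theorem eLpNorm_rescale (g : ℝ → ℂ) :
    eLpNorm (fun ξ => (((Real.sqrt (2 * Real.pi))⁻¹ : ℝ) : ℂ) * g (ξ / (2 * Real.pi))) 2 volume
      = eLpNorm g 2 volume := by
  have h0 := sqrt_two_pi_pos
  have h1 : (fun ξ => (((Real.sqrt (2 * Real.pi))⁻¹ : ℝ) : ℂ) * g (ξ / (2 * Real.pi)))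
      = (((Real.sqrt (2 * Real.pi))⁻¹ : ℝ) : ℂ) • (fun ξ => g ((2 * Real.pi)⁻¹ * ξ)) := by
    funext ξ
    simp only [Pi.smul_apply, smul_eq_mul]
    congr 2; ring
  rw [h1, eLpNorm_const_smul, eLpNorm_comp_mul_left (inv_pos.2 Real.two_pi_pos), ← mul_assoc,
    ← ofReal_norm, ← ENNReal.ofReal_mul (norm_nonneg _), Complex.norm_real,
    Real.norm_of_nonneg (inv_nonneg.2 h0.le), Real.sqrt_inv, inv_inv, inv_mul_cancel₀ h0.ne',
    ENNReal.ofReal_one, one_mul]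

/-- `hat` as a Fourier integral, for integrable functions. -/
def hatI (f : ℝ → ℂ) (ξ : ℝ) : ℂ :=
  (((Real.sqrt (2 * Real.pi))⁻¹ : ℝ) : ℂ) * 𝓕 f (ξ / (2 * Real.pi))

theorem quasiMeasurePreserving_rescale :
    Measure.QuasiMeasurePreserving (fun ξ : ℝ => ξ / (2 * Real.pi)) volume volume := by
  refine ⟨by fun_prop, ?_⟩
  have : (fun ξ : ℝ => ξ / (2 * Real.pi)) = (fun ξ => (2 * Real.pi)⁻¹ * ξ) := by
    funext ξ; ring
  rw [this, Real.map_volume_mul_left (inv_ne_zero Real.two_pi_pos.ne')]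
  exact Measure.smul_absolutelyContinuous

theorem eLpNorm_hat (f : L2) : eLpNorm (hat f) 2 volume = eLpNorm f 2 volume := by
  unfold hat
  rw [eLpNorm_rescale]
  have := Lp.norm_fourier_eq f
  rw [Lp.norm_def, Lp.norm_def] at this
  exact (ENNReal.toReal_eq_toReal_iff' (Lp.eLpNorm_ne_top _) (Lp.eLpNorm_ne_top _)).1 this

theorem measurable_hat (f : L2) : Measurable (hat f) := by
  unfold hat
  exact measurable_const.mul ((Lp.stronglyMeasurable (𝓕 f : L2)).measurable.comp (by fun_prop))

theorem memLp_hat (f : L2) : MemLp (hat f) 2 volume :=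
  ⟨(measurable_hat f).aestronglyMeasurable, by rw [eLpNorm_hat]; exact Lp.eLpNorm_lt_top f⟩

theorem hat_sub (f g : L2) : hat (f - g) =ᵐ[volume] hat f - hat g := by
  have h : (𝓕 (f - g) : L2) = 𝓕 f - 𝓕 g := (Lp.fourierTransformₗᵢ ℝ ℂ).map_sub f g
  have h2 := quasiMeasurePreserving_rescale.ae (Lp.coeFn_sub (𝓕 f : L2) (𝓕 g))
  filter_upwards [h2] with ξ hξ
  simp only [hat, h, Pi.sub_apply, hξ]
  ring

theorem hat_zero : hat (0 : L2) =ᵐ[volume] 0 := by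
  have h := hat_sub 0 0
  simpa using h

theorem hat_toLp {f : ℝ → ℂ} (h1 : Integrable f) (h2 : MemLp f 2) :
    hat (h2.toLp f) =ᵐ[volume] hatI f := by
  filter_upwards [quasiMeasurePreserving_rescale.ae (fourier_toLp_ae_eq h1 h2)] with ξ hξ
  simp only [hat, hatI, hξ]

theorem continuous_hatI {f : ℝ → ℂ} (h1 : Integrable f) : Continuous (hatI f) :=
  continuous_const.mul ((continuous_fourier_of_integrable h1).comp (by fun_prop))

theorem eLpNorm_hatI {f : ℝ → ℂ} (h1 : Integrable f) (h2 : MemLp f 2) :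
    eLpNorm (hatI f) 2 volume = eLpNorm f 2 volume := by
  unfold hatI
  rw [eLpNorm_rescale, eLpNorm_fourier h1 h2]

theorem memLp_hatI {f : ℝ → ℂ} (h1 : Integrable f) (h2 : MemLp f 2) : MemLp (hatI f) 2 volume :=
  ⟨(continuous_hatI h1).aestronglyMeasurable, by rw [eLpNorm_hatI h1 h2]; exact h2.2⟩

theorem hatI_eq_integral (f : ℝ → ℂ) (ξ : ℝ) :
    hatI f ξ = (((Real.sqrt (2 * Real.pi))⁻¹ : ℝ) : ℂ)
      * ∫ x : ℝ, Complex.exp (Complex.I * ((-(x * ξ) : ℝ) : ℂ)) * f x := by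
  unfold hatI
  rw [Real.fourier_real_eq_integral_exp_smul]
  congr 1
  apply integral_congr_ae
  refine Filter.Eventually.of_forall fun x => ?_
  simp only [smul_eq_mul]
  congr 2
  have : (-2 * Real.pi * x * (ξ / (2 * Real.pi)) : ℝ) = -(x * ξ) := by
    field_simp
  rw [this]; ring

theorem hasDerivAt_hatI {f : ℝ → ℂ} (h1 : Integrable f) (h2 : Integrable (fun x : ℝ => x • f x))
    (ξ : ℝ) :
    HasDerivAt (hatI f) (hatI (fun x => (-Complex.I * x) * f x) ξ) ξ := by
  have h := Real.hasDerivAt_fourier h1 h2 (ξ / (2 * Real.pi))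
  have h3 := (h.scomp ξ ((hasDerivAt_id ξ).div_const (2 * Real.pi))).const_mul
    (((Real.sqrt (2 * Real.pi))⁻¹ : ℝ) : ℂ)
  refine (h3.congr_deriv ?_)
  simp only [hatI]
  congr 1
  rw [Real.fourier_real_eq_integral_exp_smul, Real.fourier_real_eq_integral_exp_smul,
    ← integral_smul]
  apply integral_congr_ae
  refine Filter.Eventually.of_forall fun x => ?_
  have hp : (Real.pi : ℂ) ≠ 0 := by exact_mod_cast Real.pi_ne_zero
  simp only [smul_eq_mul, Complex.real_smul]
  push_cast
  field_simp

/-- The inverse of `hat`, as an integral. -/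
def invHat (h : ℝ → ℂ) (x : ℝ) : ℂ := hatI h (-x)

theorem invHat_eq_integral (f : ℝ → ℂ) (x : ℝ) :
    invHat f x = (((Real.sqrt (2 * Real.pi))⁻¹ : ℝ) : ℂ)
      * ∫ ξ : ℝ, Complex.exp (Complex.I * ((x * ξ : ℝ) : ℂ)) * f ξ := by
  rw [invHat, hatI_eq_integral]
  congr 1
  apply integral_congr_ae
  refine Filter.Eventually.of_forall fun ξ => ?_
  simp only
  congr 4; ring

theorem eLpNorm_invHat {h : ℝ → ℂ} (h1 : Integrable h) (h2 : MemLp h 2) :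
    eLpNorm (invHat h) 2 volume = eLpNorm h 2 volume := by
  rw [← eLpNorm_hatI h1 h2]
  exact eLpNorm_comp_measurePreserving (f := fun x : ℝ => -x)
    (continuous_hatI h1).aestronglyMeasurable
    (Measure.measurePreserving_neg volume)

theorem continuous_invHat {h : ℝ → ℂ} (h1 : Integrable h) : Continuous (invHat h) :=
  (continuous_hatI h1).comp continuous_neg

/-- Fourier inversion for elements of `L²` whose transform is integrable. -/
theorem ae_eq_invHat {u : L2} {h : ℝ → ℂ} (h1 : Integrable h) (hu : hat u =ᵐ[volume] h) :
    u =ᵐ[volume] invHat h := by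
  have hpi := Real.two_pi_pos
  have hs := sqrt_two_pi_pos
  have hsC : ((Real.sqrt (2 * Real.pi) : ℝ) : ℂ) ≠ 0 := by exact_mod_cast hs.ne'
  -- `h'` is the transform of `u` in the normalisation of `𝓕`, where the inversion formula is
  -- available; the dilation is undone inside the integral at the end.
  set h' : ℝ → ℂ := fun ζ => (Real.sqrt (2 * Real.pi) : ℂ) * h (2 * Real.pi * ζ) with hh'
  have hq : Measure.QuasiMeasurePreserving (fun ζ : ℝ => 2 * Real.pi * ζ) volume volume := by
    refine ⟨by fun_prop, ?_⟩
    rw [Real.map_volume_mul_left hpi.ne']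
    exact Measure.smul_absolutelyContinuous
  have hF : ((𝓕 u : L2) : ℝ → ℂ) =ᵐ[volume] h' := by
    filter_upwards [hq.ae hu] with ζ hζ
    simp only [hh', ← hζ, hat]
    rw [mul_div_cancel_left₀ _ hpi.ne']
    push_cast
    field_simp
  have i1 : Integrable h' := (h1.comp_mul_left' hpi.ne').const_mul _
  have i2 : MemLp h' 2 := (Lp.memLp (𝓕 u : L2)).ae_eq hF
  have e1 : (𝓕 u : L2) = i2.toLp h' := by
    apply Lp.ext; exact hF.trans i2.coeFn_toLp.symm
  have e2 : u = 𝓕⁻ (i2.toLp h') := by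
    rw [← e1]; exact (FourierPair.fourierInv_fourier_eq u).symm
  rw [e2]
  refine (fourierInv_toLp_ae_eq i1 i2).trans (Filter.Eventually.of_forall fun x => ?_)
  rw [Real.fourierInv_eq', invHat_eq_integral]
  have e4 := Measure.integral_comp_mul_left
    (fun ξ : ℝ => Complex.exp (Complex.I * ((x * ξ : ℝ) : ℂ)) * h ξ) (2 * Real.pi)
  rw [abs_of_pos (inv_pos.2 hpi), Complex.real_smul] at e4
  have e5 : ∫ v : ℝ, Complex.exp (((2 * Real.pi * inner ℝ v x : ℝ) : ℂ) * Complex.I) • h' v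
      = (Real.sqrt (2 * Real.pi) : ℂ) * ∫ v : ℝ,
        Complex.exp (Complex.I * ((x * (2 * Real.pi * v) : ℝ) : ℂ)) * h (2 * Real.pi * v) := by
    rw [← integral_const_mul]
    apply integral_congr_ae
    refine Filter.Eventually.of_forall fun v => ?_
    simp only [hh', smul_eq_mul, RCLike.inner_apply, conj_trivial]
    rw [← mul_assoc, mul_comm (Complex.exp _) (_ : ℂ), mul_assoc]
    congr 3
    push_cast; ring
  rw [e5, e4, ← mul_assoc]
  congr 1
  have : (2 * Real.pi : ℝ) = Real.sqrt (2 * Real.pi) * Real.sqrt (2 * Real.pi) :=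
    (Real.mul_self_sqrt hpi.le).symm
  rw [← Complex.ofReal_mul]
  congr 1
  nth_rewrite 2 [this]
  field_simp

/-! ### Oscillatory integrals -/

theorem hasDerivAt_cexp_I {θ : ℝ → ℝ} {θ' x : ℝ} (h : HasDerivAt θ θ' x) :
    HasDerivAt (fun y => Complex.exp (Complex.I * (θ y : ℂ)))
      (Complex.exp (Complex.I * (θ x : ℂ)) * (Complex.I * (θ' : ℂ))) x :=
  ((h.ofReal_comp).const_mul Complex.I).cexp

theorem norm_cexp_I (r : ℝ) : ‖Complex.exp (Complex.I * (r : ℂ))‖ = 1 := by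
  rw [mul_comm]; exact Complex.norm_exp_ofReal_mul_I r

/-- First derivative test for an increasing positive derivative. -/
theorem norm_integral_cexp_le_of_le_deriv {θ θ₁ θ₂ : ℝ → ℝ} (h1 : ∀ x, HasDerivAt θ (θ₁ x) x)
    (h2 : ∀ x, HasDerivAt θ₁ (θ₂ x) x) (hc : Continuous θ₂) (h0 : ∀ x, 0 ≤ θ₂ x) {ρ p q : ℝ}
    (hρ : 0 < ρ) (hp : ρ ≤ θ₁ p) (hpq : p ≤ q) :
    ‖∫ x in p..q, Complex.exp (Complex.I * (θ x : ℂ))‖ ≤ 2 / ρ := by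
  have hmono : Monotone θ₁ := monotone_of_hasDerivAt_nonneg h2 h0
  have hpos : ∀ x ∈ Set.uIcc p q, 0 < θ₁ x := fun x hx => by
    rw [Set.uIcc_of_le hpq] at hx
    exact (hρ.trans_le hp).trans_le (hmono hx.1)
  have hne : ∀ x ∈ Set.uIcc p q, (θ₁ x : ℂ) ≠ 0 := fun x hx => by
    exact_mod_cast (hpos x hx).ne'
  have hθ₁c : Continuous θ₁ := continuous_iff_continuousAt.2 fun x => (h2 x).continuousAt
  have hθc : Continuous θ := continuous_iff_continuousAt.2 fun x => (h1 x).continuousAt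
  -- Integrate by parts in e^{iθ} = (iθ₁)⁻¹ (e^{iθ})'. The derivative of (iθ₁)⁻¹ has modulus θ₂/θ₁²,
  -- which is exactly minus the derivative of 1/θ₁, so its integral is explicit.
  have hu : ∀ x ∈ Set.uIcc p q, HasDerivAt (fun y => (Complex.I * (θ₁ y : ℂ))⁻¹)
      (Complex.I * ((θ₂ x / θ₁ x ^ 2 : ℝ) : ℂ)) x := by
    intro x hx
    have h := ((h2 x).ofReal_comp.const_mul Complex.I).fun_inv
      (mul_ne_zero Complex.I_ne_zero (hne x hx))
    refine h.congr_deriv ?_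
    have := hne x hx
    push_cast
    rw [mul_pow, Complex.I_sq]
    field_simp
  have hcontq : ContinuousOn (fun x => θ₂ x / θ₁ x ^ 2) (Set.uIcc p q) :=
    hc.continuousOn.div (hθ₁c.pow 2).continuousOn fun x hx => (pow_pos (hpos x hx) 2).ne'
  have hibp := intervalIntegral.integral_mul_deriv_eq_deriv_mul hu
    (fun x _ => hasDerivAt_cexp_I (h1 x))
    (ContinuousOn.intervalIntegrable
      (continuousOn_const.mul (Complex.continuous_ofReal.comp_continuousOn hcontq)))
    (Continuous.intervalIntegrable (by fun_prop) _ _)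
  have hlhs : (∫ x in p..q, (Complex.I * (θ₁ x : ℂ))⁻¹
      * (Complex.exp (Complex.I * (θ x : ℂ)) * (Complex.I * (θ₁ x : ℂ))))
      = ∫ x in p..q, Complex.exp (Complex.I * (θ x : ℂ)) := by
    apply intervalIntegral.integral_congr
    intro x hx
    have := hne x hx
    have := Complex.I_ne_zero
    simp only
    field_simp
  rw [hlhs] at hibp
  rw [hibp]
  have hb : ∀ x ∈ Set.uIcc p q,
      ‖(Complex.I * (θ₁ x : ℂ))⁻¹ * Complex.exp (Complex.I * (θ x : ℂ))‖ = (θ₁ x)⁻¹ := by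
    intro x hx
    rw [norm_mul, norm_cexp_I, norm_inv, norm_mul, Complex.norm_I, Complex.norm_real,
      Real.norm_of_nonneg (hpos x hx).le]
    simp
  have hint : ∫ x in p..q, θ₂ x / θ₁ x ^ 2 = (θ₁ p)⁻¹ - (θ₁ q)⁻¹ := by
    have := intervalIntegral.integral_eq_sub_of_hasDerivAt (a := p) (b := q)
      (f := fun x => -(θ₁ x)⁻¹) (f' := fun x => θ₂ x / θ₁ x ^ 2)
      (fun x hx => by
        have := ((h2 x).fun_inv (hpos x hx).ne').fun_neg
        refine this.congr_deriv (by ring)) hcontq.intervalIntegrable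
    rw [this]; ring
  have hI : ‖∫ x in p..q, Complex.I * ((θ₂ x / θ₁ x ^ 2 : ℝ) : ℂ)
      * Complex.exp (Complex.I * (θ x : ℂ))‖ ≤ (θ₁ p)⁻¹ - (θ₁ q)⁻¹ := by
    rw [← hint]
    apply intervalIntegral.norm_integral_le_of_norm_le hpq _ hcontq.intervalIntegrable
    refine Filter.Eventually.of_forall fun x hx => ?_
    rw [norm_mul, norm_cexp_I, norm_mul, Complex.norm_I, Complex.norm_real,
      Real.norm_of_nonneg (div_nonneg (h0 x) (sq_nonneg _))]
    simp
  -- Boundary terms and integral add up to 2/θ₁(p): the contributions of the endpoint `q` cancel.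
  have hpp : (θ₁ p)⁻¹ ≤ ρ⁻¹ := inv_anti₀ hρ hp
  have hA := norm_sub_le ((Complex.I * (θ₁ q : ℂ))⁻¹ * Complex.exp (Complex.I * (θ q : ℂ))
    - (Complex.I * (θ₁ p : ℂ))⁻¹ * Complex.exp (Complex.I * (θ p : ℂ)))
    (∫ x in p..q, Complex.I * ((θ₂ x / θ₁ x ^ 2 : ℝ) : ℂ)
      * Complex.exp (Complex.I * (θ x : ℂ)))
  have hB := norm_sub_le ((Complex.I * (θ₁ q : ℂ))⁻¹ * Complex.exp (Complex.I * (θ q : ℂ)))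
    ((Complex.I * (θ₁ p : ℂ))⁻¹ * Complex.exp (Complex.I * (θ p : ℂ)))
  rw [hb q Set.right_mem_uIcc, hb p Set.left_mem_uIcc] at hB
  have : 2 / ρ = ρ⁻¹ + ρ⁻¹ := by ring
  linarith

theorem norm_integral_cexp_le_length (θ : ℝ → ℝ) {p q : ℝ} (hpq : p ≤ q) :
    ‖∫ x in p..q, Complex.exp (Complex.I * (θ x : ℂ))‖ ≤ q - p := by
  have := intervalIntegral.norm_integral_le_of_norm_le_const (a := p) (b := q) (C := 1)
    (f := fun x => Complex.exp (Complex.I * (θ x : ℂ))) (fun x _ => (norm_cexp_I _).le)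
  rwa [one_mul, abs_of_nonneg (sub_nonneg.2 hpq)] at this

theorem intervalIntegrable_cexp {θ : ℝ → ℝ} (h : Continuous θ) (p q : ℝ) :
    IntervalIntegrable (fun x => Complex.exp (Complex.I * (θ x : ℂ))) volume p q :=
  Continuous.intervalIntegrable (by fun_prop) _ _

/-- Second derivative test to the right of a stationary point. -/
theorem norm_integral_cexp_le_right {θ θ₁ θ₂ : ℝ → ℝ} (h1 : ∀ x, HasDerivAt θ (θ₁ x) x)
    (h2 : ∀ x, HasDerivAt θ₁ (θ₂ x) x) (hc : Continuous θ₂) {l x₀ p q : ℝ} (hl : 0 < l)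
    (h0 : ∀ x, l ≤ θ₂ x) (hx₀ : θ₁ x₀ = 0) (hp : x₀ ≤ p) (hpq : p ≤ q) :
    ‖∫ x in p..q, Complex.exp (Complex.I * (θ x : ℂ))‖ ≤ 3 / Real.sqrt l := by
  have hs : 0 < Real.sqrt l := Real.sqrt_pos.2 hl
  have hss : Real.sqrt l * Real.sqrt l = l := Real.mul_self_sqrt hl.le
  have hθc : Continuous θ := continuous_iff_continuousAt.2 fun x => (h1 x).continuousAt
  have hmono : Monotone (fun x => θ₁ x - l * x) :=
    monotone_of_hasDerivAt_nonneg (f' := fun x => θ₂ x - l) (fun x => by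
      simpa using (h2 x).fun_sub ((hasDerivAt_id' x).const_mul l)) fun x => sub_nonneg.2 (h0 x)
  -- The distance 1/√l balances the two bounds: nearer to `x₀` the length 1/√l is used, farther away
  -- the first derivative test with ρ = √l gives 2/√l.
  have hlow : ∀ x, x₀ + 1 / Real.sqrt l ≤ x → Real.sqrt l ≤ θ₁ x := by
    intro x hx
    have h := hmono ((le_add_of_nonneg_right (by positivity)).trans hx : x₀ ≤ x)
    simp only [hx₀] at h
    have h3 : l * (1 / Real.sqrt l) = Real.sqrt l := by
      rw [mul_one_div, div_eq_iff hs.ne', hss]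
    nlinarith [mul_le_mul_of_nonneg_left hx hl.le]
  have key : ∀ p', x₀ + 1 / Real.sqrt l ≤ p' → p' ≤ q →
      ‖∫ x in p'..q, Complex.exp (Complex.I * (θ x : ℂ))‖ ≤ 2 / Real.sqrt l := fun p' hp' hq' =>
    norm_integral_cexp_le_of_le_deriv h1 h2 hc (fun x => hl.le.trans (h0 x)) hs (hlow p' hp') hq'
  have h32 : 3 / Real.sqrt l = 1 / Real.sqrt l + 2 / Real.sqrt l := by ring
  have hd1 : 0 < 1 / Real.sqrt l := by positivity
  rcases le_total (x₀ + 1 / Real.sqrt l) p with hcase | hcase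
  · exact (key p hcase hpq).trans (by linarith)
  rcases le_total q (x₀ + 1 / Real.sqrt l) with hcase2 | hcase2
  · refine (norm_integral_cexp_le_length θ hpq).trans ?_
    have : 0 < 2 / Real.sqrt l := by positivity
    linarith
  · rw [← intervalIntegral.integral_add_adjacent_intervals
      (intervalIntegrable_cexp hθc p (x₀ + 1 / Real.sqrt l)) (intervalIntegrable_cexp hθc _ q)]
    refine (norm_add_le _ _).trans ?_
    rw [h32]
    refine add_le_add ((norm_integral_cexp_le_length θ hcase).trans (by linarith))
      (key _ le_rfl hcase2)

/-- θ₁ grows at least linearly, so it has a zero. The integral is split there, and the left half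
becomes a right half under x ↦ -x; each half costs 3/√l. -/
theorem norm_integral_cexp_le_of_pos {θ θ₁ θ₂ : ℝ → ℝ} (h1 : ∀ x, HasDerivAt θ (θ₁ x) x)
    (h2 : ∀ x, HasDerivAt θ₁ (θ₂ x) x) (hc : Continuous θ₂) {l p q : ℝ} (hl : 0 < l)
    (h0 : ∀ x, l ≤ θ₂ x) (hpq : p ≤ q) :
    ‖∫ x in p..q, Complex.exp (Complex.I * (θ x : ℂ))‖ ≤ 6 / Real.sqrt l := by
  have hs : 0 < Real.sqrt l := Real.sqrt_pos.2 hl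
  have hθc : Continuous θ := continuous_iff_continuousAt.2 fun x => (h1 x).continuousAt
  have hθ₁c : Continuous θ₁ := continuous_iff_continuousAt.2 fun x => (h2 x).continuousAt
  have hmono : Monotone (fun x => θ₁ x - l * x) :=
    monotone_of_hasDerivAt_nonneg (f' := fun x => θ₂ x - l) (fun x => by
      simpa using (h2 x).fun_sub ((hasDerivAt_id' x).const_mul l)) fun x => sub_nonneg.2 (h0 x)
  obtain ⟨x₀, hx₀⟩ : ∃ x₀, θ₁ x₀ = 0 := by
    set M := |θ₁ 0| / l with hM
    have hM0 : 0 ≤ M := by positivity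
    have hlM : l * M = |θ₁ 0| := by rw [hM]; field_simp
    have ha := hmono hM0
    have hb := hmono (neg_nonpos.2 hM0)
    simp only at ha hb
    have := intermediate_value_Icc (f := θ₁) (by linarith : -M ≤ M) hθ₁c.continuousOn
    obtain ⟨x, -, hx⟩ := this (show (0 : ℝ) ∈ Set.Icc (θ₁ (-M)) (θ₁ M) from
      ⟨by nlinarith [le_abs_self (θ₁ 0)], by nlinarith [neg_abs_le (θ₁ 0)]⟩)
    exact ⟨x, hx⟩
  have hright : ∀ p q, x₀ ≤ p → p ≤ q → _ := fun p q =>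
    norm_integral_cexp_le_right (p := p) (q := q) h1 h2 hc hl h0 hx₀
  have hleft : ∀ p q, p ≤ q → q ≤ x₀ →
      ‖∫ x in p..q, Complex.exp (Complex.I * (θ x : ℂ))‖ ≤ 3 / Real.sqrt l := by
    intro p q hpq hq
    have h := norm_integral_cexp_le_right (θ := fun x => θ (-x)) (θ₁ := fun x => -θ₁ (-x))
      (θ₂ := fun x => θ₂ (-x)) (x₀ := -x₀) (p := -q) (q := -p)
      (fun x => by simpa [Function.comp_def] using (h1 (-x)).scomp x (hasDerivAt_neg x))
      (fun x => by simpa [Function.comp_def] using ((h2 (-x)).scomp x (hasDerivAt_neg x)).fun_neg)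
      (hc.comp continuous_neg) hl (fun x => h0 (-x)) (by simp [hx₀]) (by linarith) (by linarith)
    rw [intervalIntegral.integral_comp_neg (fun x => Complex.exp (Complex.I * (θ x : ℂ)))] at h
    simpa using h
  have h63 : 6 / Real.sqrt l = 3 / Real.sqrt l + 3 / Real.sqrt l := by ring
  have hd1 : 0 < 3 / Real.sqrt l := by positivity
  rcases le_total x₀ p with hcase | hcase
  · exact (hright p q hcase hpq).trans (by linarith)
  rcases le_total q x₀ with hcase2 | hcase2
  · exact (hleft p q hpq hcase2).trans (by linarith)
  · rw [← intervalIntegral.integral_add_adjacent_intervals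
      (intervalIntegrable_cexp hθc p x₀) (intervalIntegrable_cexp hθc _ q), h63]
    exact (norm_add_le _ _).trans (add_le_add (hleft p x₀ hcase le_rfl) (hright x₀ q le_rfl hcase2))

/-- Van der Corput's second derivative test. -/
theorem norm_integral_cexp_le {θ θ₁ θ₂ : ℝ → ℝ} (h1 : ∀ x, HasDerivAt θ (θ₁ x) x)
    (h2 : ∀ x, HasDerivAt θ₁ (θ₂ x) x) (hc : Continuous θ₂) {l p q : ℝ} (hl : 0 < l)
    (h0 : ∀ x, l ≤ |θ₂ x|) (hpq : p ≤ q) :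
    ‖∫ x in p..q, Complex.exp (Complex.I * (θ x : ℂ))‖ ≤ 6 / Real.sqrt l := by
  have hne : ∀ x, θ₂ x ≠ 0 := fun x hx => by
    have := h0 x; rw [hx, abs_zero] at this; linarith
  have hsign : (∀ x, 0 < θ₂ x) ∨ (∀ x, θ₂ x < 0) := by
    by_contra! hcon
    obtain ⟨⟨x, hx⟩, y, hy⟩ := hcon
    obtain ⟨z, hz⟩ := mem_range_of_exists_le_of_exists_ge hc ⟨x, hx⟩ ⟨y, hy⟩
    exact hne z hz
  rcases hsign with hs | hs
  · exact norm_integral_cexp_le_of_pos h1 h2 hc hl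
      (fun x => by have := h0 x; rwa [abs_of_pos (hs x)] at this) hpq
  -- Conjugating the integral changes the sign of the phase, which reduces to the convex case.
  · have h := norm_integral_cexp_le_of_pos (θ := fun x => -θ x) (θ₁ := fun x => -θ₁ x)
      (θ₂ := fun x => -θ₂ x) (fun x => (h1 x).neg) (fun x => (h2 x).neg) hc.neg hl
      (fun x => by have := h0 x; rwa [abs_of_neg (hs x)] at this) hpq
    rw [intervalIntegral.integral_of_le hpq] at h ⊢
    have e : ∀ x, (starRingEnd ℂ) (Complex.exp (Complex.I * ((-θ x : ℝ) : ℂ)))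
        = Complex.exp (Complex.I * (θ x : ℂ)) := fun x => by
      rw [← Complex.exp_conj]; simp
    rw [← Complex.norm_conj, ← integral_conj] at h
    simp_rw [e] at h
    exact h

/-- Second derivative test with a compactly supported amplitude. -/
theorem norm_integral_cexp_mul_le {θ θ₁ θ₂ : ℝ → ℝ} (h1 : ∀ x, HasDerivAt θ (θ₁ x) x)
    (h2 : ∀ x, HasDerivAt θ₁ (θ₂ x) x) (hc : Continuous θ₂) {l : ℝ} (hl : 0 < l)
    (h0 : ∀ x, l ≤ |θ₂ x|) {ψ : ℝ → ℂ} (hψ : ContDiff ℝ 1 ψ) {B : ℝ} (hB : 0 ≤ B)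
    (hsupp : ∀ x, B ≤ |x| → ψ x = 0) {D : ℝ} (hD : ∀ x, ‖deriv ψ x‖ ≤ D) :
    ‖∫ x, Complex.exp (Complex.I * (θ x : ℂ)) * ψ x‖ ≤ 12 * B * D / Real.sqrt l := by
  have hθc : Continuous θ := continuous_iff_continuousAt.2 fun x => (h1 x).continuousAt
  have hBB : -B ≤ B := by linarith
  have hec : Continuous (fun x => Complex.exp (Complex.I * (θ x : ℂ))) := by fun_prop
  have e1 : ∫ x, Complex.exp (Complex.I * (θ x : ℂ)) * ψ x
      = ∫ x in -B..B, Complex.exp (Complex.I * (θ x : ℂ)) * ψ x := by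
    rw [intervalIntegral.integral_of_le hBB, setIntegral_eq_integral_of_forall_compl_eq_zero]
    intro x hx
    rw [hsupp x, mul_zero]
    by_contra! h
    exact hx ⟨(abs_lt.1 h).1, (abs_lt.1 h).2.le⟩
  -- The primitive of the oscillating factor from -B is at most 6/√l by the second derivative test.
  -- Integrating by parts against it leaves no boundary term, since ψ(±B) = 0, and the interval has
  -- length 2B.
  have hE : ∀ x ∈ Set.uIcc (-B) B,
      HasDerivAt (fun s => ∫ y in -B..s, Complex.exp (Complex.I * (θ y : ℂ)))
      (Complex.exp (Complex.I * (θ x : ℂ))) x := fun x _ =>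
    intervalIntegral.integral_hasDerivAt_right (intervalIntegrable_cexp hθc _ _)
      (hec.stronglyMeasurableAtFilter _ _) hec.continuousAt
  have hibp := intervalIntegral.integral_mul_deriv_eq_deriv_mul
    (fun x _ => (hψ.differentiable (by norm_num) x).hasDerivAt) hE
    ((hψ.continuous_deriv le_rfl).intervalIntegrable _ _)
    (intervalIntegrable_cexp hθc _ _)
  rw [hsupp B (le_abs_self B), hsupp (-B) (by rw [abs_neg]; exact le_abs_self B), zero_mul,
    zero_mul, sub_zero, zero_sub] at hibp
  simp_rw [mul_comm (ψ _)] at hibp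
  rw [e1, hibp, norm_neg]
  have hb := intervalIntegral.norm_integral_le_of_norm_le_const (a := -B) (b := B)
    (C := D * (6 / Real.sqrt l))
    (f := fun x => deriv ψ x * ∫ y in -B..x, Complex.exp (Complex.I * (θ y : ℂ)))
    (fun x hx => by
      rw [Set.uIoc_of_le hBB] at hx
      rw [norm_mul]
      exact mul_le_mul (hD x) (norm_integral_cexp_le h1 h2 hc hl h0 hx.1.le) (norm_nonneg _)
        ((norm_nonneg _).trans (hD x)))
  refine hb.trans (le_of_eq ?_)
  rw [sub_neg_eq_add, abs_of_nonneg (by linarith)]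
  ring

/-! ### Bilinear forms with frequency kernels -/

/-- The `L²` norm of a function, as a real number. -/
def nrm (F : ℝ → ℂ) : ℝ := (eLpNorm F 2 volume).toReal

theorem nrm_nonneg (F : ℝ → ℂ) : 0 ≤ nrm F := ENNReal.toReal_nonneg

theorem nrm_le_of_norm_le {F G : ℝ → ℂ} (hG : MemLp G 2) {C : ℝ} (hC : 0 ≤ C)
    (h : ∀ x, ‖F x‖ ≤ C * ‖G x‖) : nrm F ≤ C * nrm G := by
  unfold nrm
  have := eLpNorm_le_mul_eLpNorm_of_ae_le_mul (μ := volume) (Filter.Eventually.of_forall h) 2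
  have h2 := ENNReal.toReal_mono (ENNReal.mul_ne_top ENNReal.ofReal_ne_top hG.2.ne) this
  rwa [ENNReal.toReal_mul, ENNReal.toReal_ofReal hC] at h2

theorem integrable_mul_and_le {F G : ℝ → ℂ} (hF : MemLp F 2) (hG : MemLp G 2) :
    Integrable (fun x => F x * G x) ∧ ∫ x, ‖F x * G x‖ ≤ nrm F * nrm G := by
  have hi : Integrable (fun x => F x * G x) := hF.integrable_mul hG
  refine ⟨hi, ?_⟩
  have h := eLpNorm_smul_le_mul_eLpNorm (p := 2) (q := 2) (r := 1) hG.1 hF.1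
  rw [integral_norm_eq_lintegral_enorm hi.1, ← eLpNorm_one_eq_lintegral_enorm]
  unfold nrm
  rw [← ENNReal.toReal_mul]
  exact ENNReal.toReal_mono (ENNReal.mul_ne_top hF.2.ne hG.2.ne) h

theorem memLp_reflect {F : ℝ → ℂ} (hF : MemLp F 2) (ξ : ℝ) : MemLp (fun η => F (ξ - η)) 2 :=
  hF.comp_measurePreserving (Measure.measurePreserving_sub_left volume ξ)

theorem nrm_reflect {F : ℝ → ℂ} (hF : MemLp F 2) (ξ : ℝ) : nrm (fun η => F (ξ - η)) = nrm F :=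
  congrArg ENNReal.toReal (eLpNorm_comp_measurePreserving (f := fun η : ℝ => ξ - η) hF.1
    (Measure.measurePreserving_sub_left volume ξ))

theorem integrable_slice {F G : ℝ → ℂ} (hF : MemLp F 2) (hG : MemLp G 2) (ξ : ℝ) :
    Integrable (fun η => F (ξ - η) * G η) :=
  (integrable_mul_and_le (memLp_reflect hF ξ) hG).1

theorem integral_norm_slice_le {F G : ℝ → ℂ} (hF : MemLp F 2) (hG : MemLp G 2) (ξ : ℝ) :
    ∫ η, ‖F (ξ - η) * G η‖ ≤ nrm F * nrm G := by
  have := (integrable_mul_and_le (memLp_reflect hF ξ) hG).2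
  rwa [nrm_reflect hF] at this

/-- A kernel depending on the output frequency only acts as a pointwise multiplication in physical
space. -/
theorem norm_integral_kernel_mul_convolution_le {k : ℝ → ℂ} (hk : ContDiff ℝ (⊤ : ℕ∞) k)
    (hkc : HasCompactSupport k) {D : ℝ} (hD : ∀ y, ‖𝓕⁻ k y‖ ≤ D) {V W : ℝ → ℂ}
    (hV1 : Integrable V) (hV2 : MemLp V 2) (hW1 : Integrable W) (hW2 : MemLp W 2) :
    ‖∫ ξ, k ξ * ∫ η, V (ξ - η) * W η‖ ≤ D * (nrm V * nrm W) := by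
  set κ : SchwartzMap ℝ ℂ := hkc.toSchwartzMap hk with hκ
  set K : SchwartzMap ℝ ℂ := 𝓕⁻ κ with hK
  have hKc : ∀ y, K y = 𝓕⁻ k y := fun y => by rw [hK, SchwartzMap.fourierInv_coe]; rfl
  have hFK : ∀ ξ, 𝓕 (fun y => K y) ξ = k ξ := fun ξ => by
    rw [← SchwartzMap.fourier_coe, hK, FourierInvPair.fourier_fourierInv_eq]; rfl
  have hc : Integrable (fun ξ => ∫ η, V (ξ - η) * W η) := by
    have := hW1.integrable_convolution (ContinuousLinearMap.mul ℂ ℂ) hV1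
    refine this.congr (Filter.Eventually.of_forall fun ξ => ?_)
    simp only [convolution_def, ContinuousLinearMap.mul_apply']
    exact integral_congr_ae (Filter.Eventually.of_forall fun η => mul_comm _ _)
  have hFc : ∀ y, 𝓕 (fun ξ => ∫ η, V (ξ - η) * W η) y = 𝓕 V y * 𝓕 W y := fun y => by
    rw [mul_comm, ← Real.fourier_mul_convolution_eq hW1 hV1]
    refine congrFun (congrArg 𝓕 (funext fun ξ => ?_)) y
    simp only [convolution_def, ContinuousLinearMap.mul_apply']
    exact integral_congr_ae (Filter.Eventually.of_forall fun η => mul_comm _ _)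
  -- By Fourier duality the convolution becomes the product of the two transforms, so that only the
  -- supremum of `K` and Plancherel are needed.
  have e : ∫ ξ, k ξ * ∫ η, V (ξ - η) * W η = ∫ y, K y * (𝓕 V y * 𝓕 W y) := by
    have := VectorFourier.integral_fourierIntegral_smul_eq_flip (L := innerₗ ℝ) (μ := volume)
      (ν := volume) Real.continuous_fourierChar (by exact continuous_inner) K.integrable hc
    rw [flip_innerₗ] at this
    change ∫ ξ, 𝓕 (fun y => K y) ξ • _ = ∫ y, K y • 𝓕 (fun ξ => ∫ η, V (ξ - η) * W η) y at this
    simpa only [hFK, hFc, smul_eq_mul] using this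
  have hFV : MemLp (𝓕 V) 2 := ⟨(continuous_fourier_of_integrable hV1).aestronglyMeasurable, by
    rw [eLpNorm_fourier hV1 hV2]; exact hV2.2⟩
  have hFW : MemLp (𝓕 W) 2 := ⟨(continuous_fourier_of_integrable hW1).aestronglyMeasurable, by
    rw [eLpNorm_fourier hW1 hW2]; exact hW2.2⟩
  obtain ⟨hi, hle⟩ := integrable_mul_and_le hFV hFW
  have hD0 : 0 ≤ D := (norm_nonneg _).trans (hD 0)
  rw [e]
  refine (norm_integral_le_of_norm_le (hi.norm.const_mul D)
    (Filter.Eventually.of_forall fun y => ?_)).trans ?_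
  · rw [norm_mul, hKc]
    exact mul_le_mul_of_nonneg_right (hD y) (norm_nonneg _)
  · rw [integral_const_mul]
    refine mul_le_mul_of_nonneg_left (hle.trans_eq ?_) hD0
    unfold nrm
    rw [eLpNorm_fourier hV1 hV2, eLpNorm_fourier hW1 hW2]

theorem integrable_of_memLp_of_support {V : ℝ → ℂ} (hV : MemLp V 2) {A : ℝ}
    (h : ∀ x, A ≤ |x| → V x = 0) : Integrable V := by
  have h1 : IntegrableOn V (Set.Ioo (-A) A) := by
    have : MemLp V 2 (volume.restrict (Set.Ioo (-A) A)) := hV.restrict _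
    exact this.integrable (by norm_num)
  rw [← integrableOn_iff_integrable_of_support_subset (s := Set.Ioo (-A) A)]
  · exact h1
  · intro x hx
    by_contra hcon
    exact hx (h x (by
      by_contra! hlt
      exact hcon ⟨(abs_lt.1 hlt).1, (abs_lt.1 hlt).2⟩))

/-- The previous bound in the presence of a smooth compactly supported symbol. -/
theorem norm_integral_kernel_mul_symbol_le {k : ℝ → ℂ} (hk : ContDiff ℝ (⊤ : ℕ∞) k)
    (hkc : HasCompactSupport k) {D : ℝ} (hD : ∀ y, ‖𝓕⁻ k y‖ ≤ D) {m dm : ℝ × ℝ → ℂ} {A D₁ : ℝ}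
    (hA : 0 ≤ A) (hdmc : Continuous dm) (hdm : ∀ ξ s, HasDerivAt (fun s => m (ξ, s)) (dm (ξ, s)) s)
    (hm1 : ∀ x : ℝ × ℝ, A ≤ |x.1| → m x = 0) (hm2 : ∀ x : ℝ × ℝ, A ≤ |x.2| → m x = 0)
    (hD₁ : ∀ x, ‖dm x‖ ≤ D₁) {V W : ℝ → ℂ} (hVm : Measurable V) (hWm : Measurable W)
    (hV : MemLp V 2) (hW : MemLp W 2) :
    ‖∫ ξ, k ξ * ∫ η, m (ξ - η, η) * (V (ξ - η) * W η)‖ ≤ D * (2 * A * D₁) * (nrm V * nrm W) := by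
  have hD0 : 0 ≤ D := (norm_nonneg _).trans (hD 0)
  have hD₁0 : 0 ≤ D₁ := (norm_nonneg _).trans (hD₁ 0)
  set I : Set ℝ := Set.Ioo (-A) A with hI
  set V' : ℝ → ℂ := I.indicator V with hV'
  set W' : ℝ → ℂ := I.indicator W with hW'
  have hV'm : Measurable V' := hVm.indicator measurableSet_Ioo
  have hW'm : Measurable W' := hWm.indicator measurableSet_Ioo
  have hV'n : ∀ x, ‖V' x‖ ≤ ‖V x‖ := fun x => norm_indicator_le_norm_self _ _
  have hW'n : ∀ x, ‖W' x‖ ≤ ‖W x‖ := fun x => norm_indicator_le_norm_self _ _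
  have hV'2 : MemLp V' 2 := hV.indicator measurableSet_Ioo
  have hW'2 : MemLp W' 2 := hW.indicator measurableSet_Ioo
  have hout : ∀ {U : ℝ → ℂ} x, A ≤ |x| → I.indicator U x = 0 := fun x hx =>
    Set.indicator_of_notMem (fun hxI : x ∈ Set.Ioo (-A) A =>
      absurd (abs_lt.2 ⟨hxI.1, hxI.2⟩) (not_lt.2 hx)) _
  have hin : ∀ {U : ℝ → ℂ} x, ¬ A ≤ |x| → I.indicator U x = U x := fun x hx =>
    Set.indicator_of_mem (show x ∈ Set.Ioo (-A) A from abs_lt.1 (not_le.1 hx)) _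
  -- For η in (-A, A), m(ζ,η) is the integral over s in (-A, A) of ∂₂m(ζ,s) 1_{s ≤ η}: a
  -- superposition of tensor products. Each s is covered by the bound without symbol, and
  -- integrating over s costs 2A.
  set Vs : ℝ → ℝ → ℂ := fun s ζ => dm (ζ, s) * V' ζ with hVs
  set Ws : ℝ → ℝ → ℂ := fun s η => (if s ≤ η then 1 else 0) * W' η with hWs
  have hVsm : Measurable (fun p : ℝ × ℝ => Vs p.1 p.2) := by
    refine Measurable.mul (hdmc.measurable.comp (by fun_prop)) (hV'm.comp measurable_snd)
  have hWsm : Measurable (fun p : ℝ × ℝ => Ws p.1 p.2) := by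
    refine Measurable.mul (Measurable.ite (measurableSet_le measurable_fst measurable_snd)
      measurable_const measurable_const) (hW'm.comp measurable_snd)
  have hVsn : ∀ s ζ, ‖Vs s ζ‖ ≤ D₁ * ‖V ζ‖ := fun s ζ => by
    simp only [hVs]; rw [norm_mul]
    exact mul_le_mul (hD₁ _) (hV'n _) (norm_nonneg _) hD₁0
  have hWsn : ∀ s η, ‖Ws s η‖ ≤ 1 * ‖W η‖ := fun s η => by
    simp only [hWs]; rw [norm_mul]
    refine mul_le_mul ?_ (hW'n _) (norm_nonneg _) zero_le_one
    split_ifs <;> simp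
  have hVsm' : ∀ s, Measurable (Vs s) := fun s => hVsm.comp (measurable_const.prodMk measurable_id)
  have hWsm' : ∀ s, Measurable (Ws s) := fun s => hWsm.comp (measurable_const.prodMk measurable_id)
  have hVs2 : ∀ s, MemLp (Vs s) 2 := fun s =>
    MemLp.of_le_mul hV (hVsm' s).aestronglyMeasurable (Filter.Eventually.of_forall (hVsn s))
  have hWs2 : ∀ s, MemLp (Ws s) 2 := fun s =>
    MemLp.of_le_mul hW (hWsm' s).aestronglyMeasurable (Filter.Eventually.of_forall (hWsn s))
  have hVs1 : ∀ s, Integrable (Vs s) := fun s => integrable_of_memLp_of_support (hVs2 s)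
    (A := A) fun x hx => by simp only [hVs, hV', hout x hx, mul_zero]
  have hWs1 : ∀ s, Integrable (Ws s) := fun s => integrable_of_memLp_of_support (hWs2 s)
    (A := A) fun x hx => by simp only [hWs, hW', hout x hx, mul_zero]
  have hbound : ∀ s, ‖∫ ξ, k ξ * ∫ η, Vs s (ξ - η) * Ws s η‖ ≤ D * (D₁ * (nrm V * nrm W)) := by
    intro s
    refine (norm_integral_kernel_mul_convolution_le hk hkc hD (hVs1 s) (hVs2 s) (hWs1 s)
      (hWs2 s)).trans (mul_le_mul_of_nonneg_left ?_ hD0)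
    have h1 := nrm_le_of_norm_le hV hD₁0 (hVsn s)
    have h2 := nrm_le_of_norm_le hW zero_le_one (hWsn s)
    rw [one_mul] at h2
    calc nrm (Vs s) * nrm (Ws s) ≤ (D₁ * nrm V) * nrm W :=
          mul_le_mul h1 h2 (nrm_nonneg _) (mul_nonneg hD₁0 (nrm_nonneg _))
      _ = _ := by ring
  -- the symbol is the integral of its derivative
  have hrep : ∀ ξ η, m (ξ - η, η) * (V (ξ - η) * W η)
      = ∫ s in Set.Ioc (-A) A, Vs s (ξ - η) * Ws s η := by
    intro ξ η
    by_cases h1 : A ≤ |ξ - η|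
    · rw [hm1 _ h1, zero_mul]
      simp only [hVs, hV', hout _ h1, mul_zero, zero_mul, integral_zero]
    by_cases h2 : A ≤ |η|
    · rw [hm2 _ h2, zero_mul]
      simp only [hWs, hW', hout _ h2, mul_zero, integral_zero]
    have hηI := abs_lt.1 (not_le.1 h2)
    have e1 : ∀ s, Vs s (ξ - η) * Ws s η
        = (Set.Iic η).indicator (fun s => dm (ξ - η, s)) s * (V (ξ - η) * W η) := by
      intro s
      have hv : V' (ξ - η) = V (ξ - η) := hin _ h1
      have hw : W' η = W η := hin _ h2
      simp only [hVs, hWs, hv, hw, Set.indicator_apply, Set.mem_Iic]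
      split_ifs <;> ring
    simp_rw [e1]
    rw [integral_mul_const, setIntegral_indicator measurableSet_Iic, Set.Ioc_inter_Iic,
      min_eq_right hηI.2.le, ← intervalIntegral.integral_of_le hηI.1.le,
      intervalIntegral.integral_eq_sub_of_hasDerivAt (fun s _ => hdm (ξ - η) s)
        (Continuous.intervalIntegrable (by fun_prop) _ _),
      hm2 (ξ - η, -A) (by simp [abs_of_nonneg hA]), sub_zero]
  have hmeas3 : Measurable (fun p : (ℝ × ℝ) × ℝ => Vs p.1.2 (p.1.1 - p.2) * Ws p.1.2 p.2) := by
    refine Measurable.mul (hVsm.comp (by fun_prop : Measurable fun p : (ℝ × ℝ) × ℝ =>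
      (p.1.2, p.1.1 - p.2))) (hWsm.comp (by fun_prop : Measurable fun p : (ℝ × ℝ) × ℝ =>
      (p.1.2, p.2)))
  have hprod : ∀ s ξ η, ‖Vs s (ξ - η) * Ws s η‖ ≤ D₁ * ‖V (ξ - η) * W η‖ := by
    intro s ξ η
    calc ‖Vs s (ξ - η) * Ws s η‖ = ‖Vs s (ξ - η)‖ * ‖Ws s η‖ := norm_mul _ _
      _ ≤ (D₁ * ‖V (ξ - η)‖) * (1 * ‖W η‖) :=
            mul_le_mul (hVsn _ _) (hWsn _ _) (norm_nonneg _) (by positivity)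
      _ = D₁ * ‖V (ξ - η) * W η‖ := by rw [norm_mul]; ring
  have hswap1 : ∀ ξ, ∫ η, m (ξ - η, η) * (V (ξ - η) * W η)
      = ∫ s in Set.Ioc (-A) A, ∫ η, Vs s (ξ - η) * Ws s η := by
    intro ξ
    simp_rw [hrep]
    apply integral_integral_swap
    have hdom : Integrable (fun p : ℝ × ℝ => (V (ξ - p.1) * W p.1) * (D₁ : ℂ))
        (volume.prod (volume.restrict (Set.Ioc (-A) A))) :=
      (integrable_slice hV hW ξ).mul_prod (integrable_const (D₁ : ℂ))
    refine hdom.mono ?_ (Filter.Eventually.of_forall fun p => ?_)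
    · exact (hmeas3.comp (by fun_prop : Measurable fun p : ℝ × ℝ =>
        ((ξ, p.2), p.1))).aestronglyMeasurable
    · simp only [Function.uncurry]
      exact (hprod _ _ _).trans_eq (by
        rw [norm_mul _ (D₁ : ℂ), Complex.norm_real, Real.norm_of_nonneg hD₁0, mul_comm])
  have hslice : ∀ s ξ, ‖∫ η, Vs s (ξ - η) * Ws s η‖ ≤ D₁ * (nrm V * nrm W) := by
    intro s ξ
    refine (norm_integral_le_of_norm_le (((integrable_slice hV hW ξ).norm).const_mul D₁)
      (Filter.Eventually.of_forall fun η => ?_)).trans ?_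
    · exact hprod _ _ _
    · rw [integral_const_mul]
      exact mul_le_mul_of_nonneg_left (integral_norm_slice_le hV hW ξ) hD₁0
  have hki : Integrable k := hk.continuous.integrable_of_hasCompactSupport hkc
  have hswap2 : ∫ ξ, k ξ * ∫ η, m (ξ - η, η) * (V (ξ - η) * W η)
      = ∫ s in Set.Ioc (-A) A, ∫ ξ, k ξ * ∫ η, Vs s (ξ - η) * Ws s η := by
    simp_rw [hswap1]
    refine (integral_congr_ae (Filter.Eventually.of_forall fun ξ =>
      (integral_const_mul (k ξ) (fun s => ∫ η, Vs s (ξ - η) * Ws s η)).symm)).trans ?_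
    apply integral_integral_swap
    have hdom : Integrable (fun p : ℝ × ℝ => k p.1 * ((D₁ * (nrm V * nrm W) : ℝ) : ℂ))
        (volume.prod (volume.restrict (Set.Ioc (-A) A))) :=
      hki.mul_prod (integrable_const _)
    refine hdom.mono ?_ (Filter.Eventually.of_forall fun p => ?_)
    · have h1 : Measurable fun p : ℝ × ℝ => ∫ η, Vs p.2 (p.1 - η) * Ws p.2 η :=
        hmeas3.stronglyMeasurable.integral_prod_right.measurable
      exact ((hk.continuous.measurable.comp measurable_fst).mul h1).aestronglyMeasurable
    · simp only [Function.uncurry]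
      rw [norm_mul, norm_mul, Complex.norm_real, Real.norm_of_nonneg
        (mul_nonneg hD₁0 (mul_nonneg (nrm_nonneg _) (nrm_nonneg _)))]
      exact mul_le_mul_of_nonneg_left (hslice _ _) (norm_nonneg _)
  rw [hswap2]
  refine (norm_setIntegral_le_of_norm_le_const (C := D * (D₁ * (nrm V * nrm W)))
    (by simp) fun s _ => hbound s).trans (le_of_eq ?_)
  rw [Real.volume_real_Ioc_of_le (by linarith)]
  ring

/-! ### Transversality: change of variables along slices -/

theorem hasDerivAt_phase_slice {a b c : ℝ → ℝ} (hb : Differentiable ℝ b) (hc : Differentiable ℝ c)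
    (ξ η : ℝ) : HasDerivAt (fun η => phase a b c (ξ - η) η) (deriv c η - deriv b (ξ - η)) η := by
  have e : (fun η => phase a b c (ξ - η) η) = fun η => -a ξ + b (ξ - η) + c η := by
    funext η; simp [phase]
  rw [e]
  have h1 := ((hb (ξ - η)).hasDerivAt.scomp η ((hasDerivAt_id' η).const_sub ξ))
  refine ((h1.const_add (-a ξ)).add (hc η).hasDerivAt).congr_deriv ?_
  simp; ring

theorem continuous_phase {a b c : ℝ → ℝ} (ha : Continuous a) (hb : Continuous b)
    (hc : Continuous c) : Continuous (Function.uncurry (phase a b c)) := by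
  have : Function.uncurry (phase a b c) = fun p : ℝ × ℝ => -a (p.1 + p.2) + b p.1 + c p.2 := rfl
  rw [this]; fun_prop

/-- On the slices of a compact set without space resonances, the phase pushes Lebesgue measure
forward to a measure of bounded density. -/
theorem exists_lintegral_slice_le {a b c : ℝ → ℝ} (hb : ContDiff ℝ (⊤ : ℕ∞) b)
    (hc : ContDiff ℝ (⊤ : ℕ∞) c) {S : Set (ℝ × ℝ)} (hS : IsCompact S)
    (hne : ∀ x ∈ S, deriv c x.2 - deriv b x.1 ≠ 0) :
    ∃ C : ℝ≥0∞, C ≠ ∞ ∧ ∀ (ξ : ℝ) (g : ℝ → ℝ≥0∞),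
      ∫⁻ η in {η | (ξ - η, η) ∈ S}, g (phase a b c (ξ - η) η) ≤ C * ∫⁻ y, g y := by
  have hbd : Differentiable ℝ b := hb.differentiable (by simp)
  have hcd : Differentiable ℝ c := hc.differentiable (by simp)
  have hb'c : Continuous (deriv b) := hb.continuous_deriv (by simp)
  have hc'c : Continuous (deriv c) := hc.continuous_deriv (by simp)
  set d : ℝ × ℝ → ℝ := fun x => deriv c x.2 - deriv b x.1 with hd
  have hdc : Continuous d := by fun_prop
  -- The slope of the phase is kept away from zero on a whole neighbourhood of `S`, so that the
  -- bound extends to full intervals of length ε that meet a slice of `S`; the slices themselves may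
  -- be irregular sets.
  obtain ⟨ε, hε, hεS⟩ := hS.exists_cthickening_subset_open
    (isOpen_ne_fun hdc continuous_const : IsOpen {x | d x ≠ 0}) hne
  obtain ⟨l, hl, hlS⟩ : ∃ l : ℝ, 0 < l ∧ ∀ x ∈ Metric.cthickening ε S, l ≤ |d x| := by
    have hcomp : IsCompact (Metric.cthickening ε S) := hS.cthickening
    rcases (Metric.cthickening ε S).eq_empty_or_nonempty with he | hne'
    · exact ⟨1, one_pos, by simp [he]⟩
    · obtain ⟨x, hx, hmin⟩ := hcomp.exists_isMinOn hne' hdc.abs.continuousOn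
      exact ⟨|d x|, abs_pos.2 (hεS hx), fun y hy => hmin hy⟩
  obtain ⟨A, hA⟩ := hS.isBounded.exists_norm_le
  set n : ℤ := ⌈A / ε⌉ + 1 with hn
  set J : ℤ → Set ℝ := fun j => Set.Ico (j * ε) ((j + 1) * ε) with hJ
  have hθ : ∀ ξ η, HasDerivAt (fun η => phase a b c (ξ - η) η) (d (ξ - η, η)) η :=
    hasDerivAt_phase_slice hbd hcd
  have piece : ∀ (ξ : ℝ) (g : ℝ → ℝ≥0∞) (j : ℤ),
      ∫⁻ η in {η | (ξ - η, η) ∈ S} ∩ J j, g (phase a b c (ξ - η) η)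
        ≤ (ENNReal.ofReal l)⁻¹ * ∫⁻ y, g y := by
    intro ξ g j
    rcases ({η | (ξ - η, η) ∈ S} ∩ J j).eq_empty_or_nonempty with he | ⟨η₀, hη₀S, hη₀⟩
    · rw [he]; simp
    -- In the sup metric, two points of the same slice are at distance |η - η₀|, which is at most ε
    -- inside one cell.
    have hlow : ∀ η ∈ J j, l ≤ |d (ξ - η, η)| := by
      intro η hη
      refine hlS _ (Metric.mem_cthickening_of_dist_le _ (ξ - η₀, η₀) _ _ hη₀S ?_)
      have hab : |η - η₀| ≤ ε := by
        rw [abs_le]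
        constructor <;> nlinarith [hη.1, hη.2, hη₀.1, hη₀.2]
      rw [Prod.dist_eq, Real.dist_eq, Real.dist_eq]
      refine max_le ?_ hab
      rw [show ξ - η - (ξ - η₀) = -(η - η₀) by ring, abs_neg]
      exact hab
    -- Rolle: equal values would force a zero of the slope inside the cell.
    have hinj : Set.InjOn (fun η => phase a b c (ξ - η) η) (J j) := by
      have key : ∀ x ∈ J j, ∀ y ∈ J j, x < y →
          phase a b c (ξ - x) x ≠ phase a b c (ξ - y) y := by
        intro x hx y hy hxy heq
        obtain ⟨z, hz, hz0⟩ := exists_hasDerivAt_eq_zero hxy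
          (continuousOn_of_forall_continuousAt fun z _ => (hθ ξ z).continuousAt) heq
          (fun z _ => hθ ξ z)
        have := hlow z ⟨hx.1.trans hz.1.le, hz.2.trans hy.2⟩
        rw [hz0, abs_zero] at this
        linarith
      intro x hx y hy heq
      rcases lt_trichotomy x y with h | h | h
      · exact absurd heq (key x hx y hy h)
      · exact h
      · exact absurd heq.symm (key y hy x hx h)
    have hcov := lintegral_image_eq_lintegral_abs_deriv_mul (s := J j) measurableSet_Ico
      (fun x _ => (hθ ξ x).hasDerivWithinAt) hinj g
    calc ∫⁻ η in {η | (ξ - η, η) ∈ S} ∩ J j, g (phase a b c (ξ - η) η)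
        ≤ ∫⁻ η in J j, g (phase a b c (ξ - η) η) :=
          lintegral_mono_set Set.inter_subset_right
      _ ≤ ∫⁻ η in J j, (ENNReal.ofReal l)⁻¹
            * (ENNReal.ofReal |d (ξ - η, η)| * g (phase a b c (ξ - η) η)) := by
          refine setLIntegral_mono' measurableSet_Ico fun η hη => ?_
          rw [← mul_assoc]
          refine le_mul_of_one_le_left' ?_
          rw [← ENNReal.inv_mul_cancel (ENNReal.ofReal_pos.2 hl).ne' ENNReal.ofReal_ne_top]
          exact mul_le_mul_right (ENNReal.ofReal_le_ofReal (hlow η hη)) _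
      _ = (ENNReal.ofReal l)⁻¹ * ∫⁻ y in (fun η => phase a b c (ξ - η) η) '' J j, g y := by
          rw [lintegral_const_mul' _ _ (by simp [hl]), hcov]
      _ ≤ (ENNReal.ofReal l)⁻¹ * ∫⁻ y, g y :=
          mul_le_mul_right (setLIntegral_le_lintegral _ _) _
  -- Each cell contributes 1/l. As |η| ≤ A on `S`, the number of cells needed depends neither on ξ
  -- nor on `g`.
  refine ⟨(Finset.Icc (-n) n).card * (ENNReal.ofReal l)⁻¹,
    ENNReal.mul_ne_top (ENNReal.natCast_ne_top _) (by simp [hl]), fun ξ g => ?_⟩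
  have hsub : {η | (ξ - η, η) ∈ S} ⊆
      ⋃ j : (Finset.Icc (-n) n), ({η | (ξ - η, η) ∈ S} ∩ J j) := by
    intro η hη
    have hηA : |η| ≤ A := (norm_snd_le (ξ - η, η)).trans (hA _ hη)
    have h1 := Int.floor_le (η / ε)
    have h2 := Int.lt_floor_add_one (η / ε)
    have h3 : A / ε ≤ ⌈A / ε⌉ := Int.le_ceil _
    have h4 : |η / ε| ≤ A / ε := by
      rw [abs_div, abs_of_pos hε]; gcongr
    have h5 := abs_le.1 h4
    refine Set.mem_iUnion.2 ⟨⟨⌊η / ε⌋, Finset.mem_Icc.2 ⟨?_, ?_⟩⟩, hη, ?_, ?_⟩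
    · have : ((-n : ℤ) : ℝ) < ((⌊η / ε⌋ + 1 : ℤ) : ℝ) := by
        rw [hn]; push_cast; linarith
      have := Int.cast_lt.1 this
      omega
    · have : ((⌊η / ε⌋ : ℤ) : ℝ) ≤ (n : ℝ) := by
        rw [hn]; push_cast; linarith
      exact Int.cast_le.1 this
    · rw [le_div_iff₀ hε] at h1; exact h1
    · rw [div_lt_iff₀ hε] at h2; exact h2
  calc _ ≤ ∫⁻ η in ⋃ j : (Finset.Icc (-n) n), ({η | (ξ - η, η) ∈ S} ∩ J j),
          g (phase a b c (ξ - η) η) := lintegral_mono_set hsub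
    _ ≤ ∑' j : (Finset.Icc (-n) n), ∫⁻ η in {η | (ξ - η, η) ∈ S} ∩ J j,
          g (phase a b c (ξ - η) η) := lintegral_iUnion_le _ _
    _ ≤ ∑' j : (Finset.Icc (-n) n), (ENNReal.ofReal l)⁻¹ * ∫⁻ y, g y :=
          ENNReal.tsum_le_tsum fun j => piece ξ g j
    _ = _ := by
          rw [tsum_fintype, Finset.sum_const, nsmul_eq_mul, Finset.card_univ,
            Fintype.card_coe, mul_assoc]

/-! ### The bilinear profile -/

/-- The Fourier profile of the pseudo-product of two free solutions at time `τ`. -/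
def profile (φ : ℝ → ℝ → ℝ) (m : ℝ × ℝ → ℂ) (F G : ℝ → ℂ) (τ ξ : ℝ) : ℂ :=
  ∫ η, m (ξ - η, η) * (Complex.exp (Complex.I * ((τ * φ (ξ - η) η : ℝ) : ℂ))
    * (F (ξ - η) * G η))

/-- The time integral of the profile against a weight `w`. -/
def profileInt (φ : ℝ → ℝ → ℝ) (m : ℝ × ℝ → ℂ) (w F G : ℝ → ℂ) (ξ : ℝ) : ℂ :=
  ∫ τ, w τ * profile φ m F G τ ξ

/-- A symbol which is bounded and supported in the square of side `2A`. -/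
structure IsSymbol (m : ℝ × ℝ → ℂ) (A M : ℝ) : Prop where
  continuous : Continuous m
  norm_le : ∀ x, ‖m x‖ ≤ M
  fst_zero : ∀ x : ℝ × ℝ, A ≤ |x.1| → m x = 0
  snd_zero : ∀ x : ℝ × ℝ, A ≤ |x.2| → m x = 0

/-- A measurable square integrable function. -/
structure MeasL2 (F : ℝ → ℂ) : Prop where
  meas : Measurable F
  memLp : MemLp F 2

section

variable {φ : ℝ → ℝ → ℝ} {m : ℝ × ℝ → ℂ} {A M : ℝ} {F G w : ℝ → ℂ}

theorem IsSymbol.bound_nonneg (hm : IsSymbol m A M) : 0 ≤ M := (norm_nonneg _).trans (hm.norm_le 0)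

theorem norm_profile_integrand_le (hm : IsSymbol m A M) (τ ξ η : ℝ) :
    ‖m (ξ - η, η) * (Complex.exp (Complex.I * ((τ * φ (ξ - η) η : ℝ) : ℂ))
      * (F (ξ - η) * G η))‖ ≤ M * ‖F (ξ - η) * G η‖ := by
  rw [norm_mul, norm_mul, norm_cexp_I, one_mul]
  exact mul_le_mul_of_nonneg_right (hm.norm_le _) (norm_nonneg _)

theorem measurable_profile_integrand (hφ : Continuous (Function.uncurry φ)) (hm : IsSymbol m A M)
    (hF : MeasL2 F) (hG : MeasL2 G) :
    Measurable (fun p : (ℝ × ℝ) × ℝ => m (p.1.2 - p.2, p.2)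
      * (Complex.exp (Complex.I * ((p.1.1 * φ (p.1.2 - p.2) p.2 : ℝ) : ℂ))
      * (F (p.1.2 - p.2) * G p.2))) := by
  have h1 : Continuous (fun p : (ℝ × ℝ) × ℝ => m (p.1.2 - p.2, p.2)) :=
    hm.continuous.comp (by fun_prop)
  have h2 : Continuous (fun p : (ℝ × ℝ) × ℝ => φ (p.1.2 - p.2) p.2) :=
    hφ.comp (by fun_prop : Continuous fun p : (ℝ × ℝ) × ℝ => (p.1.2 - p.2, p.2))
  have h3 : Measurable (fun p : (ℝ × ℝ) × ℝ => F (p.1.2 - p.2)) := hF.meas.comp (by fun_prop)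
  have h4 : Measurable (fun p : (ℝ × ℝ) × ℝ => G p.2) := hG.meas.comp (by fun_prop)
  have h5 : Continuous (fun p : (ℝ × ℝ) × ℝ =>
    Complex.exp (Complex.I * ((p.1.1 * φ (p.1.2 - p.2) p.2 : ℝ) : ℂ))) := by fun_prop
  exact h1.measurable.mul (h5.measurable.mul (h3.mul h4))

theorem measurable_profile (hφ : Continuous (Function.uncurry φ)) (hm : IsSymbol m A M)
    (hF : MeasL2 F) (hG : MeasL2 G) :
    Measurable (fun p : ℝ × ℝ => profile φ m F G p.1 p.2) :=
  (measurable_profile_integrand hφ hm hF hG).stronglyMeasurable.integral_prod_right.measurable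

theorem integrable_profile_integrand (hφ : Continuous (Function.uncurry φ)) (hm : IsSymbol m A M)
    (hF : MeasL2 F) (hG : MeasL2 G) (τ ξ : ℝ) :
    Integrable (fun η => m (ξ - η, η) * (Complex.exp (Complex.I * ((τ * φ (ξ - η) η : ℝ) : ℂ))
      * (F (ξ - η) * G η))) := by
  refine ((integrable_slice hF.memLp hG.memLp ξ).norm.const_mul M).mono ?_
    (Filter.Eventually.of_forall fun η => ?_)
  · exact ((measurable_profile_integrand hφ hm hF hG).comp
      (by fun_prop : Measurable fun η : ℝ => ((τ, ξ), η))).aestronglyMeasurable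
  · exact (norm_profile_integrand_le hm τ ξ η).trans (le_abs_self _)

theorem norm_profile_le (hm : IsSymbol m A M) (hF : MeasL2 F) (hG : MeasL2 G) (τ ξ : ℝ) :
    ‖profile φ m F G τ ξ‖ ≤ M * (nrm F * nrm G) := by
  refine (norm_integral_le_of_norm_le ((integrable_slice hF.memLp hG.memLp ξ).norm.const_mul M)
    (Filter.Eventually.of_forall fun η => norm_profile_integrand_le hm τ ξ η)).trans ?_
  rw [integral_const_mul]
  exact mul_le_mul_of_nonneg_left (integral_norm_slice_le hF.memLp hG.memLp ξ) hm.bound_nonneg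

theorem profile_eq_zero (hm : IsSymbol m A M) (τ : ℝ) {ξ : ℝ} (hξ : 2 * A ≤ |ξ|) :
    profile φ m F G τ ξ = 0 := by
  unfold profile
  rw [← integral_zero ℝ ℂ (μ := volume)]
  congr 1
  funext η
  have : m (ξ - η, η) = 0 := by
    by_cases h : A ≤ |η|
    · exact hm.snd_zero _ h
    · refine hm.fst_zero _ ?_
      have h1 : |ξ| ≤ |ξ - η| + |η| := by
        calc |ξ| = |(ξ - η) + η| := by ring_nf
          _ ≤ _ := abs_add_le _ _
      push Not at h
      show A ≤ |ξ - η|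
      linarith
  rw [this, zero_mul]

theorem measurable_profileInt (hφ : Continuous (Function.uncurry φ)) (hm : IsSymbol m A M)
    (hF : MeasL2 F) (hG : MeasL2 G) (hw : Measurable w) : Measurable (profileInt φ m w F G) := by
  have h : Measurable (fun p : ℝ × ℝ => w p.2 * profile φ m F G p.2 p.1) :=
    (hw.comp measurable_snd).mul ((measurable_profile hφ hm hF hG).comp measurable_swap)
  exact h.stronglyMeasurable.integral_prod_right.measurable

theorem norm_profileInt_le (hm : IsSymbol m A M) (hF : MeasL2 F)
    (hG : MeasL2 G) (hw : Integrable w) (ξ : ℝ) :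
    ‖profileInt φ m w F G ξ‖ ≤ (∫ τ, ‖w τ‖) * (M * (nrm F * nrm G)) := by
  refine (norm_integral_le_of_norm_le (hw.norm.mul_const (M * (nrm F * nrm G)))
    (Filter.Eventually.of_forall fun τ => ?_)).trans_eq (integral_mul_const _ _)
  rw [norm_mul]
  exact mul_le_mul_of_nonneg_left (norm_profile_le hm hF hG τ ξ) (norm_nonneg _)

theorem profileInt_eq_zero (hm : IsSymbol m A M) {ξ : ℝ} (hξ : 2 * A ≤ |ξ|) :
    profileInt φ m w F G ξ = 0 := by
  simp [profileInt, profile_eq_zero hm _ hξ]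

theorem measL2_of_bounded_of_support {h : ℝ → ℂ} (hmeas : Measurable h) {B K : ℝ}
    (hb : ∀ x, ‖h x‖ ≤ K) (hs : ∀ x, B ≤ |x| → h x = 0) : MeasL2 h := by
  refine ⟨hmeas, ?_⟩
  have e : h = (Set.Ioo (-B) B).indicator h := by
    funext x
    by_cases hx : x ∈ Set.Ioo (-B) B
    · rw [Set.indicator_of_mem hx]
    · rw [Set.indicator_of_notMem hx]
      refine hs x ?_
      by_contra! hlt
      exact hx ⟨(abs_lt.1 hlt).1, (abs_lt.1 hlt).2⟩
  rw [e, memLp_indicator_iff_restrict measurableSet_Ioo]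
  exact MemLp.of_bound hmeas.aestronglyMeasurable K (Filter.Eventually.of_forall hb)

theorem measL2_profileInt (hφ : Continuous (Function.uncurry φ)) (hm : IsSymbol m A M)
    (hF : MeasL2 F) (hG : MeasL2 G) (hw : Measurable w) (hwi : Integrable w) :
    MeasL2 (profileInt φ m w F G) :=
  measL2_of_bounded_of_support (measurable_profileInt hφ hm hF hG hw)
    (norm_profileInt_le hm hF hG hwi) fun _ => profileInt_eq_zero hm

theorem integrable_profileInt (hφ : Continuous (Function.uncurry φ)) (hm : IsSymbol m A M)
    (hF : MeasL2 F) (hG : MeasL2 G) (hw : Measurable w) (hwi : Integrable w) :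
    Integrable (profileInt φ m w F G) :=
  integrable_of_memLp_of_support (measL2_profileInt hφ hm hF hG hw hwi).memLp
    fun _ => profileInt_eq_zero hm

end

/-! ### The `L²` estimate -/

theorem eLpNorm_two_sq (f : ℝ → ℂ) : eLpNorm f 2 volume ^ 2 = ∫⁻ x, ‖f x‖ₑ ^ 2 := by
  have := eLpNorm_nnreal_pow_eq_lintegral (μ := volume) (f := f) (p := 2) (by norm_num)
  simpa using this

theorem sq_lintegral_mul_le {f g : ℝ → ℝ≥0∞} (μ : Measure ℝ) (hf : AEMeasurable f μ)
    (hg : AEMeasurable g μ) :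
    (∫⁻ x, f x * g x ∂μ) ^ 2 ≤ (∫⁻ x, f x ^ 2 ∂μ) * ∫⁻ x, g x ^ 2 ∂μ := by
  have h := ENNReal.lintegral_mul_le_Lp_mul_Lq μ Real.HolderConjugate.two_two hf hg
  have e : ∀ y : ℝ≥0∞, (y ^ (1 / 2 : ℝ)) ^ 2 = y := fun y => by
    rw [← ENNReal.rpow_natCast, ← ENNReal.rpow_mul]; norm_num
  calc _ ≤ ((∫⁻ x, f x ^ (2 : ℝ) ∂μ) ^ (1 / 2 : ℝ) * (∫⁻ x, g x ^ (2 : ℝ) ∂μ) ^ (1 / 2 : ℝ)) ^ 2 :=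
        pow_le_pow_left' h 2
    _ = _ := by
        rw [mul_pow, e, e]
        simp only [ENNReal.rpow_ofNat]

/-- Fubini: with the time integral done first, the oscillation and the weight merge into a single
function of the value of the phase. -/
theorem integral_mul_profile_eq {φ : ℝ → ℝ → ℝ} {m : ℝ × ℝ → ℂ} {A M : ℝ} {F G w : ℝ → ℂ}
    (hφ : Continuous (Function.uncurry φ)) (hm : IsSymbol m A M)
    (hF : MeasL2 F) (hG : MeasL2 G) (hw : Measurable w) (hwi : Integrable w) (ξ : ℝ) :
    profileInt φ m w F G ξ = ∫ η, m (ξ - η, η) * (((Real.sqrt (2 * Real.pi) : ℝ) : ℂ)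
      * invHat w (φ (ξ - η) η) * (F (ξ - η) * G η)) := by
  have e1 : ∀ τ, w τ * profile φ m F G τ ξ = ∫ η, w τ * (m (ξ - η, η)
      * (Complex.exp (Complex.I * ((τ * φ (ξ - η) η : ℝ) : ℂ)) * (F (ξ - η) * G η))) := fun τ =>
    (integral_const_mul _ _).symm
  simp only [profileInt, e1]
  rw [integral_integral_swap]
  · congr 1
    funext η
    rw [invHat_eq_integral]
    have hs : ((Real.sqrt (2 * Real.pi) : ℝ) : ℂ) ≠ 0 := by exact_mod_cast sqrt_two_pi_pos.ne'
    rw [Complex.ofReal_inv, mul_inv_cancel_left₀ hs, ← integral_mul_const, ← integral_const_mul]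
    congr 1
    funext τ
    rw [mul_comm τ]
    ring
  · have hdom : Integrable (fun p : ℝ × ℝ => w p.1 * ((M : ℂ) * (F (ξ - p.2) * G p.2)))
        (volume.prod volume) :=
      hwi.mul_prod ((integrable_slice hF.memLp hG.memLp ξ).const_mul (M : ℂ))
    refine hdom.mono ?_ (Filter.Eventually.of_forall fun p => ?_)
    · exact ((hw.comp measurable_fst).mul ((measurable_profile_integrand hφ hm hF hG).comp
        (by fun_prop : Measurable fun p : ℝ × ℝ => ((p.1, ξ), p.2)))).aestronglyMeasurable
    · simp only [Function.uncurry]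
      rw [norm_mul, norm_mul (w p.1)]
      refine mul_le_mul_of_nonneg_left ((norm_profile_integrand_le hm _ _ _).trans_eq ?_)
        (norm_nonneg _)
      rw [norm_mul (M : ℂ), Complex.norm_real, Real.norm_of_nonneg hm.bound_nonneg]

theorem lintegral_slice_sq {F G : ℝ → ℂ} (hF : MeasL2 F) (hG : MeasL2 G) :
    ∫⁻ ξ, ∫⁻ η, ‖F (ξ - η) * G η‖ₑ ^ 2 = eLpNorm F 2 volume ^ 2 * eLpNorm G 2 volume ^ 2 := by
  have hm : Measurable (fun p : ℝ × ℝ => ‖F (p.1 - p.2) * G p.2‖ₑ ^ 2) := by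
    have h3 : Measurable (fun p : ℝ × ℝ => F (p.1 - p.2)) := hF.meas.comp (by fun_prop)
    have h4 : Measurable (fun p : ℝ × ℝ => G p.2) := hG.meas.comp (by fun_prop)
    exact (h3.mul h4).enorm.pow_const 2
  rw [lintegral_lintegral_swap hm.aemeasurable]
  have e : ∀ η, ∫⁻ ξ, ‖F (ξ - η) * G η‖ₑ ^ 2 = eLpNorm F 2 volume ^ 2 * ‖G η‖ₑ ^ 2 := by
    intro η
    simp_rw [enorm_mul, mul_pow]
    rw [lintegral_mul_const' _ _ (by finiteness), eLpNorm_two_sq,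
      lintegral_sub_right_eq_self (fun x => ‖F x‖ₑ ^ 2) η]
  simp_rw [e]
  rw [lintegral_const_mul' _ _ (by have := hF.memLp.2.ne; finiteness), eLpNorm_two_sq G]

/-- The `L²` bound: transversality turns the time integral into an `L²` norm of the weight. -/
theorem exists_nrm_profileInt_le {a b c : ℝ → ℝ} (ha : Continuous a) (hb : ContDiff ℝ (⊤ : ℕ∞) b)
    (hc : ContDiff ℝ (⊤ : ℕ∞) c) {S : Set (ℝ × ℝ)} (hS : IsCompact S)
    (hne : ∀ x ∈ S, deriv c x.2 - deriv b x.1 ≠ 0) {m : ℝ × ℝ → ℂ} {A M : ℝ}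
    (hm : IsSymbol m A M) (hmS : ∀ x ∉ S, m x = 0) :
    ∃ C : ℝ, 0 ≤ C ∧ ∀ w F G : ℝ → ℂ, Measurable w → Integrable w → MemLp w 2 → MeasL2 F →
      MeasL2 G → nrm (profileInt (phase a b c) m w F G) ≤ C * nrm w * (nrm F * nrm G) := by
  obtain ⟨C, hC, hslice⟩ := exists_lintegral_slice_le (a := a) hb hc hS hne
  have hbc : Continuous b := hb.continuous
  have hcc : Continuous c := hc.continuous
  have hφ := continuous_phase ha hbc hcc
  set s2 : ℝ := Real.sqrt (2 * Real.pi) with hs2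
  set K : ℝ≥0∞ := ENNReal.ofReal (M * s2) with hK
  have hKtop : K ≠ ∞ := ENNReal.ofReal_ne_top
  refine ⟨(K * C ^ (1 / 2 : ℝ)).toReal, ENNReal.toReal_nonneg,
    fun w F G hw hwi hw2 hF hG => ?_⟩
  have hκc : Continuous (invHat w) := continuous_invHat hwi
  have hκn : ∫⁻ y, ‖invHat w y‖ₑ ^ 2 = eLpNorm w 2 volume ^ 2 := by
    rw [← eLpNorm_two_sq, eLpNorm_invHat hwi hw2]
  -- Cauchy-Schwarz in η over the slice of `S`. The factor with `invHat w` is handled by the change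
  -- of variables to the phase and Plancherel; the other factor is integrable in ξ, with an integral
  -- that splits into the two `L²` norms.
  have hpoint : ∀ ξ, ‖profileInt (phase a b c) m w F G ξ‖ₑ ^ 2
      ≤ K ^ 2 * (C * eLpNorm w 2 volume ^ 2) * ∫⁻ η, ‖F (ξ - η) * G η‖ₑ ^ 2 := by
    intro ξ
    set Sξ : Set ℝ := {η | (ξ - η, η) ∈ S} with hSξ
    have hSm : MeasurableSet Sξ :=
      (hS.isClosed.preimage (by fun_prop : Continuous fun η : ℝ => (ξ - η, η))).measurableSet
    have hκm : Measurable fun η => ‖invHat w (phase a b c (ξ - η) η)‖ₑ :=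
      (hκc.comp (hφ.comp (by fun_prop : Continuous fun η : ℝ => (ξ - η, η)))).measurable.enorm
    have hFGm : Measurable fun η => ‖F (ξ - η) * G η‖ₑ :=
      ((hF.meas.comp (by fun_prop)).mul hG.meas).enorm
    have h1 : ‖profileInt (phase a b c) m w F G ξ‖ₑ
        ≤ K * ∫⁻ η in Sξ, ‖invHat w (phase a b c (ξ - η) η)‖ₑ * ‖F (ξ - η) * G η‖ₑ := by
      rw [integral_mul_profile_eq hφ hm hF hG hw hwi]
      refine (enorm_integral_le_lintegral_enorm _).trans ?_
      rw [← lintegral_const_mul' _ _ hKtop, ← lintegral_indicator hSm]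
      refine lintegral_mono fun η => ?_
      by_cases hη : η ∈ Sξ
      · rw [Set.indicator_of_mem hη, enorm_mul, enorm_mul, enorm_mul, ← mul_assoc, ← mul_assoc,
          ← mul_assoc]
        gcongr
        rw [hK, ENNReal.ofReal_mul hm.bound_nonneg]
        gcongr
        · rw [← ofReal_norm]; exact ENNReal.ofReal_le_ofReal (hm.norm_le _)
        · rw [← ofReal_norm, Complex.norm_real, Real.norm_of_nonneg (Real.sqrt_nonneg _)]
      · rw [hmS _ hη, zero_mul, enorm_zero]; exact zero_le
    calc _ ≤ (K * ∫⁻ η in Sξ, ‖invHat w (phase a b c (ξ - η) η)‖ₑ * ‖F (ξ - η) * G η‖ₑ) ^ 2 :=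
          pow_le_pow_left' h1 2
      _ ≤ K ^ 2 * ((∫⁻ η in Sξ, ‖invHat w (phase a b c (ξ - η) η)‖ₑ ^ 2)
            * ∫⁻ η in Sξ, ‖F (ξ - η) * G η‖ₑ ^ 2) := by
          rw [mul_pow]
          gcongr
          exact sq_lintegral_mul_le _ hκm.aemeasurable hFGm.aemeasurable
      _ ≤ K ^ 2 * ((C * eLpNorm w 2 volume ^ 2) * ∫⁻ η, ‖F (ξ - η) * G η‖ₑ ^ 2) := by
          gcongr
          · rw [← hκn]
            exact hslice ξ (fun y => ‖invHat w y‖ₑ ^ 2)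
          · exact Measure.restrict_le_self
      _ = _ := by ring
  have hsq : eLpNorm (profileInt (phase a b c) m w F G) 2 volume ^ 2
      ≤ (K * C ^ (1 / 2 : ℝ) * eLpNorm w 2 volume
        * (eLpNorm F 2 volume * eLpNorm G 2 volume)) ^ 2 := by
    rw [eLpNorm_two_sq]
    refine (lintegral_mono hpoint).trans ?_
    have hwt := hw2.2.ne
    rw [lintegral_const_mul' _ _ (by finiteness), lintegral_slice_sq hF hG]
    refine le_of_eq ?_
    have e : (C ^ (1 / 2 : ℝ)) ^ 2 = C := by
      rw [← ENNReal.rpow_natCast, ← ENNReal.rpow_mul]; norm_num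
    rw [mul_pow, mul_pow, mul_pow, e, mul_pow]
    ring
  have hle := (ENNReal.pow_le_pow_left_iff (by norm_num)).1 hsq
  have hwt := hw2.2.ne
  have hFt := hF.memLp.2.ne
  have hGt := hG.memLp.2.ne
  have := ENNReal.toReal_mono (by finiteness) hle
  simpa only [nrm, ENNReal.toReal_mul] using this

/-! ### The `L^∞` estimate -/

theorem exists_isSymbol {m : ℝ × ℝ → ℂ} (hm : ContDiff ℝ (⊤ : ℕ∞) m) (hmc : HasCompactSupport m) :
    ∃ A M : ℝ, 0 ≤ A ∧ IsSymbol m A M ∧ ∀ x, ‖fderiv ℝ m x‖ ≤ M := by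
  obtain ⟨A, hA⟩ := hmc.isCompact.isBounded.exists_norm_le
  obtain ⟨M₁, hM₁⟩ := hmc.exists_bound_of_continuous hm.continuous
  obtain ⟨M₂, hM₂⟩ := (hmc.fderiv ℝ).exists_bound_of_continuous (hm.continuous_fderiv (by simp))
  -- The radius is enlarged by one so that the symbol vanishes on the boundary of the square too, as
  -- `IsSymbol` requires.
  have hz : ∀ x : ℝ × ℝ, |A| + 1 ≤ ‖x‖ → m x = 0 := fun x hx => by
    by_contra hne
    have := hA x (subset_tsupport m hne)
    linarith [le_abs_self A]
  exact ⟨|A| + 1, max M₁ M₂, by positivity, ⟨hm.continuous,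
    fun x => (hM₁ x).trans (le_max_left _ _), fun x hx => hz x (hx.trans (norm_fst_le x)),
    fun x hx => hz x (hx.trans (norm_snd_le x))⟩, fun x => (hM₂ x).trans (le_max_right _ _)⟩

theorem exists_cutoff (B : ℝ) (hB : 0 ≤ B) : ∃ (ψ : ℝ → ℂ) (D : ℝ), ContDiff ℝ (⊤ : ℕ∞) ψ ∧
    HasCompactSupport ψ ∧ (∀ x, |x| ≤ B → ψ x = 1) ∧ (∀ x, B + 1 ≤ |x| → ψ x = 0) ∧
    ∀ x, ‖deriv ψ x‖ ≤ D := by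
  let f : ContDiffBump (0 : ℝ) := ⟨B + 1 / 2, B + 1, by positivity, by linarith⟩
  have hfs : ContDiff ℝ (⊤ : ℕ∞) (fun x => (f x : ℂ)) := Complex.ofRealCLM.contDiff.comp f.contDiff
  have hfc : HasCompactSupport (fun x => (f x : ℂ)) :=
    f.hasCompactSupport.comp_left (g := fun x : ℝ => (x : ℂ)) (by simp)
  obtain ⟨D, hD⟩ := hfc.deriv.exists_bound_of_continuous (hfs.continuous_deriv (by simp))
  refine ⟨fun x => (f x : ℂ), D, hfs, hfc, fun x hx => ?_, fun x hx => ?_, hD⟩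
  · show ((f x : ℝ) : ℂ) = 1
    rw [f.one_of_mem_closedBall (by
      rw [mem_closedBall_zero_iff, Real.norm_eq_abs]
      show |x| ≤ B + 1 / 2
      linarith)]; simp
  · show ((f x : ℝ) : ℂ) = 0
    rw [f.zero_of_le_dist (by simpa using hx)]; simp

/-- Dispersive decay of the frequency-localised propagator kernel. -/
theorem norm_fourierInv_propagator_le {a : ℝ → ℝ} (ha : ContDiff ℝ (⊤ : ℕ∞) a) {κ : ℝ}
    (hκ : 0 < κ) (hκa : ∀ ξ, κ ≤ |deriv (deriv a) ξ|) {ψ : ℝ → ℂ} {B D : ℝ} (hB : 0 ≤ B)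
    (hψ : ContDiff ℝ (⊤ : ℕ∞) ψ) (hψ0 : ∀ x, B ≤ |x| → ψ x = 0) (hD : ∀ x, ‖deriv ψ x‖ ≤ D)
    {σ : ℝ} (hσ : 0 < σ) (x y : ℝ) :
    ‖𝓕⁻ (fun ξ => Complex.exp (Complex.I * ((x * ξ + σ * a ξ : ℝ) : ℂ)) * ψ ξ) y‖
      ≤ 12 * B * D / Real.sqrt κ * (Real.sqrt σ)⁻¹ := by
  have ha' : ContDiff ℝ (⊤ : ℕ∞) (deriv a) := by
    have h : ContDiff ℝ ((⊤ : ℕ∞) + 1) a := ha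
    exact (contDiff_succ_iff_deriv.1 h).2.2
  have had : Differentiable ℝ a := ha.differentiable (by simp)
  have ha'd : Differentiable ℝ (deriv a) := ha'.differentiable (by simp)
  have ha''c : Continuous (deriv (deriv a)) := ha'.continuous_deriv (by simp)
  -- The position `y` and the modulation `x` enter the phase linearly and drop out of the second
  -- derivative, so the bound is uniform in both.
  have h := norm_integral_cexp_mul_le (θ := fun ξ => (2 * Real.pi * y + x) * ξ + σ * a ξ)
    (θ₁ := fun ξ => (2 * Real.pi * y + x) + σ * deriv a ξ) (θ₂ := fun ξ => σ * deriv (deriv a) ξ)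
    (fun ξ => by
      simpa using ((hasDerivAt_id' ξ).const_mul (2 * Real.pi * y + x)).fun_add
        ((had ξ).hasDerivAt.const_mul σ))
    (fun ξ => by
      simpa using ((ha'd ξ).hasDerivAt.const_mul σ).const_add (2 * Real.pi * y + x))
    (by fun_prop) (l := σ * κ) (by positivity)
    (fun ξ => by
      rw [abs_mul, abs_of_pos hσ]
      exact mul_le_mul_of_nonneg_left (hκa ξ) hσ.le)
    (ψ := ψ) (hψ.of_le (by simp)) hB hψ0 hD
  rw [Real.fourierInv_eq']
  have e : (fun v : ℝ => Complex.exp (((2 * Real.pi * inner ℝ v y : ℝ) : ℂ) * Complex.I)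
      • (Complex.exp (Complex.I * ((x * v + σ * a v : ℝ) : ℂ)) * ψ v))
      = fun v => Complex.exp (Complex.I * (((2 * Real.pi * y + x) * v + σ * a v : ℝ) : ℂ)) * ψ v := by
    funext v
    rw [smul_eq_mul, ← mul_assoc, ← Complex.exp_add]
    congr 2
    simp only [RCLike.inner_apply, conj_trivial]
    push_cast; ring
  rw [e]
  refine h.trans (le_of_eq ?_)
  rw [Real.sqrt_mul hσ.le]
  field_simp

theorem MeasL2.phase_mul {F : ℝ → ℂ} (hF : MeasL2 F) {θ : ℝ → ℝ} (hθ : Continuous θ) :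
    MeasL2 (fun ξ => Complex.exp (Complex.I * (θ ξ : ℂ)) * F ξ) ∧
      nrm (fun ξ => Complex.exp (Complex.I * (θ ξ : ℂ)) * F ξ) ≤ nrm F := by
  have hm : Measurable (fun ξ => Complex.exp (Complex.I * (θ ξ : ℂ)) * F ξ) :=
    (by fun_prop : Continuous fun ξ => Complex.exp (Complex.I * (θ ξ : ℂ))).measurable.mul hF.meas
  have hb : ∀ ξ, ‖Complex.exp (Complex.I * (θ ξ : ℂ)) * F ξ‖ ≤ 1 * ‖F ξ‖ := fun ξ => by
    rw [norm_mul, norm_cexp_I]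
  refine ⟨⟨hm, MemLp.of_le_mul hF.memLp hm.aestronglyMeasurable (Filter.Eventually.of_forall hb)⟩, ?_⟩
  simpa using nrm_le_of_norm_le hF.memLp zero_le_one hb

/-- The dispersive bound for the time-integrated profile. -/
theorem exists_norm_integral_profileInt_le {a b c : ℝ → ℝ} (ha : ContDiff ℝ (⊤ : ℕ∞) a)
    (hHa : SecondDerivBoundedAway a) (hb : Continuous b) (hc : Continuous c)
    {m : ℝ × ℝ → ℂ} (hms : ContDiff ℝ (⊤ : ℕ∞) m) (hmc : HasCompactSupport m) :
    ∃ C : ℝ, 0 ≤ C ∧ ∀ (t x : ℝ) (w F G : ℝ → ℂ), Measurable w → Integrable w →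
      (∀ τ, t ≤ τ → w τ = 0) → Integrable (fun τ => ‖w τ‖ * (Real.sqrt (t - τ))⁻¹) →
      MeasL2 F → MeasL2 G →
      ‖∫ ξ, Complex.exp (Complex.I * ((x * ξ : ℝ) : ℂ)) * (Complex.exp (Complex.I *
        ((t * a ξ : ℝ) : ℂ)) * profileInt (phase a b c) m w F G ξ)‖
        ≤ C * (∫ τ, ‖w τ‖ * (Real.sqrt (t - τ))⁻¹) * (nrm F * nrm G) := by
  obtain ⟨κ, hκ, hκa⟩ := hHa
  obtain ⟨A, M, hA, hm, hdm⟩ := exists_isSymbol hms hmc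
  -- The profile lives in |ξ| ≤ 2A, where ψ = 1; inserting ψ is free and makes the propagator kernel
  -- compactly supported in frequency.
  obtain ⟨ψ, D, hψ, hψc, hψ1, hψ0, hψD⟩ := exists_cutoff (2 * A) (by positivity)
  have hac : Continuous a := ha.continuous
  have hφ := continuous_phase hac hb hc
  have hM0 := hm.bound_nonneg
  have hD0 : 0 ≤ D := (norm_nonneg _).trans (hψD 0)
  set E : ℝ := 12 * (2 * A + 1) * D / Real.sqrt κ with hE
  have hE0 : 0 ≤ E := by positivity
  refine ⟨E * (2 * A * M), by positivity, fun t x w F G hw hwi hwt hwint hF hG => ?_⟩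
  have hN0 : 0 ≤ nrm F * nrm G := mul_nonneg (nrm_nonneg _) (nrm_nonneg _)
  set e : ℝ → ℂ := fun ξ => Complex.exp (Complex.I * ((x * ξ : ℝ) : ℂ))
    * Complex.exp (Complex.I * ((t * a ξ : ℝ) : ℂ)) with he
  have hec : Continuous e := by fun_prop
  have hen : ∀ ξ, ‖e ξ‖ = 1 := fun ξ => by
    simp only [he]; rw [norm_mul, norm_cexp_I, norm_cexp_I, one_mul]
  have hswap : ∫ ξ, Complex.exp (Complex.I * ((x * ξ : ℝ) : ℂ)) * (Complex.exp (Complex.I *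
        ((t * a ξ : ℝ) : ℂ)) * profileInt (phase a b c) m w F G ξ)
      = ∫ τ, w τ * ∫ ξ, e ξ * profile (phase a b c) m F G τ ξ := by
    have e1 : ∀ ξ, Complex.exp (Complex.I * ((x * ξ : ℝ) : ℂ)) * (Complex.exp (Complex.I *
        ((t * a ξ : ℝ) : ℂ)) * profileInt (phase a b c) m w F G ξ)
        = ∫ τ, w τ * (e ξ * profile (phase a b c) m F G τ ξ) := by
      intro ξ
      rw [← mul_assoc, profileInt, ← integral_const_mul]
      congr 1; funext τ; simp only [he]; ring
    simp_rw [e1]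
    rw [integral_integral_swap]
    · congr 1; funext τ; rw [integral_const_mul]
    · have hi : Integrable ((Set.Icc (-(2 * A)) (2 * A)).indicator
          (fun _ : ℝ => ((M * (nrm F * nrm G) : ℝ) : ℂ))) :=
        (integrable_indicator_iff measurableSet_Icc).2 (integrableOn_const (by simp))
      refine (hi.mul_prod hwi).mono ?_ (Filter.Eventually.of_forall fun p => ?_)
      · exact ((hw.comp measurable_snd).mul ((hec.measurable.comp measurable_fst).mul
          ((measurable_profile hφ hm hF hG).comp measurable_swap))).aestronglyMeasurable
      · simp only [Function.uncurry]
        rw [norm_mul, norm_mul, hen, one_mul, norm_mul, mul_comm]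
        refine mul_le_mul_of_nonneg_right ?_ (norm_nonneg _)
        by_cases hp : p.1 ∈ Set.Icc (-(2 * A)) (2 * A)
        · rw [Set.indicator_of_mem hp, Complex.norm_real, Real.norm_of_nonneg (by positivity)]
          exact norm_profile_le hm hF hG _ _
        · rw [profile_eq_zero hm, norm_zero]
          · exact norm_nonneg _
          · by_contra! hlt
            exact hp ⟨(abs_lt.1 hlt).1.le, (abs_lt.1 hlt).2.le⟩
  have hτ : ∀ τ, τ < t → ‖∫ ξ, e ξ * profile (phase a b c) m F G τ ξ‖
      ≤ E * (Real.sqrt (t - τ))⁻¹ * (2 * A * M) * (nrm F * nrm G) := by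
    intro τ hτt
    -- The factor e^{ita(ξ)} e^{iτφ} splits as e^{i(t-τ)a(ξ)} e^{iτb(ξ-η)} e^{iτc(η)}. The last two
    -- factors are absorbed into `F` and `G` without changing their norms; the first is the
    -- propagator over the remaining time.
    obtain ⟨hV, hVn⟩ := hF.phase_mul (θ := fun ξ => τ * b ξ) (by fun_prop)
    obtain ⟨hW, hWn⟩ := hG.phase_mul (θ := fun ξ => τ * c ξ) (by fun_prop)
    have hks : ContDiff ℝ (⊤ : ℕ∞) (fun ξ => Complex.exp (Complex.I *
        ((x * ξ + (t - τ) * a ξ : ℝ) : ℂ)) * ψ ξ) :=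
      (contDiff_const.mul (Complex.ofRealCLM.contDiff.comp
        ((contDiff_const.mul contDiff_id).add (contDiff_const.mul ha)))).cexp.mul hψ
    have h := norm_integral_kernel_mul_symbol_le hks hψc.mul_left
      (norm_fourierInv_propagator_le ha hκ hκa (by positivity) hψ hψ0 hψD (sub_pos.2 hτt) x)
      (m := m) (dm := fun x => fderiv ℝ m x (0, 1)) hA
      ((hms.continuous_fderiv (by simp)).clm_apply continuous_const)
      (fun ξ s => by
        have h1 := (hms.differentiable (by simp) (ξ, s)).hasFDerivAt
        exact h1.comp_hasDerivAt s ((hasDerivAt_const s ξ).prodMk (hasDerivAt_id' s)))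
      hm.fst_zero hm.snd_zero (D₁ := M)
      (fun x => ((fderiv ℝ m x).le_opNorm _).trans (by
        have : ‖((0 : ℝ), (1 : ℝ))‖ ≤ 1 := by simp [Prod.norm_def]
        calc _ ≤ M * 1 := mul_le_mul (hdm x) this (norm_nonneg _) hM0
          _ = M := mul_one M))
      hV.meas hW.meas hV.memLp hW.memLp
    have hid : ∫ ξ, e ξ * profile (phase a b c) m F G τ ξ
        = ∫ ξ, (Complex.exp (Complex.I * ((x * ξ + (t - τ) * a ξ : ℝ) : ℂ)) * ψ ξ) *
          ∫ η, m (ξ - η, η) * ((Complex.exp (Complex.I * ((τ * b (ξ - η) : ℝ) : ℂ)) * F (ξ - η))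
            * (Complex.exp (Complex.I * ((τ * c η : ℝ) : ℂ)) * G η)) := by
      congr 1
      funext ξ
      by_cases hξ : 2 * A ≤ |ξ|
      · have h0 : ∫ η, m (ξ - η, η) * ((Complex.exp (Complex.I * ((τ * b (ξ - η) : ℝ) : ℂ))
            * F (ξ - η)) * (Complex.exp (Complex.I * ((τ * c η : ℝ) : ℂ)) * G η)) = 0 := by
          have := profile_eq_zero (φ := fun _ _ => 0) (F := fun ξ => Complex.exp (Complex.I *
            ((τ * b ξ : ℝ) : ℂ)) * F ξ) (G := fun ξ => Complex.exp (Complex.I *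
            ((τ * c ξ : ℝ) : ℂ)) * G ξ) hm τ hξ
          simpa [profile] using this
        rw [profile_eq_zero hm τ hξ, h0, mul_zero, mul_zero]
      · rw [hψ1 ξ (not_le.1 hξ).le, mul_one, profile, ← integral_const_mul, ← integral_const_mul]
        congr 1
        funext η
        have hexp : e ξ * Complex.exp (Complex.I * ((τ * phase a b c (ξ - η) η : ℝ) : ℂ))
            = Complex.exp (Complex.I * ((x * ξ + (t - τ) * a ξ : ℝ) : ℂ))
              * Complex.exp (Complex.I * ((τ * b (ξ - η) : ℝ) : ℂ))
              * Complex.exp (Complex.I * ((τ * c η : ℝ) : ℂ)) := by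
          simp only [he, ← Complex.exp_add, phase, sub_add_cancel]
          congr 1
          push_cast; ring
        linear_combination (m (ξ - η, η) * F (ξ - η) * G η) * hexp
    rw [hid]
    exact h.trans (mul_le_mul_of_nonneg_left
      (mul_le_mul hVn hWn (nrm_nonneg _) (nrm_nonneg _)) (by positivity))
  rw [hswap]
  refine (norm_integral_le_of_norm_le ((hwint.const_mul (E * (2 * A * M))).mul_const
    (nrm F * nrm G)) (Filter.Eventually.of_forall fun τ => ?_)).trans_eq ?_
  · rcases lt_or_ge τ t with h | h
    · rw [norm_mul]
      refine (mul_le_mul_of_nonneg_left (hτ τ h) (norm_nonneg _)).trans_eq ?_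
      ring
    · rw [hwt τ h]; simp
  · rw [integral_mul_const, integral_const_mul]

/-! ### Integration by parts along slices -/

/-- The symbol divided by the derivative of the phase along slices. -/
def divSymbol (b c : ℝ → ℝ) (m : ℝ × ℝ → ℂ) (x : ℝ × ℝ) : ℂ :=
  m x * (((deriv c x.2 - deriv b x.1 : ℝ) : ℂ))⁻¹

/-- The derivative of the divided symbol along slices. -/
def slopeSymbol (b c : ℝ → ℝ) (m : ℝ × ℝ → ℂ) (x : ℝ × ℝ) : ℂ :=
  fderiv ℝ (divSymbol b c m) x (-1, 1)

section

variable {b c : ℝ → ℝ} {m : ℝ × ℝ → ℂ}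

theorem contDiff_deriv_of_smooth {a : ℝ → ℝ} (ha : ContDiff ℝ (⊤ : ℕ∞) a) :
    ContDiff ℝ (⊤ : ℕ∞) (deriv a) := by
  have h : ContDiff ℝ ((⊤ : ℕ∞) + 1) a := ha
  exact (contDiff_succ_iff_deriv.1 h).2.2

/-- The denominator may vanish, but only off the support of `m`, and near such points the quotient
is identically zero. -/
theorem contDiff_divSymbol (hb : ContDiff ℝ (⊤ : ℕ∞) b) (hc : ContDiff ℝ (⊤ : ℕ∞) c)
    (hm : ContDiff ℝ (⊤ : ℕ∞) m) (hne : ∀ x ∈ tsupport m, deriv c x.2 - deriv b x.1 ≠ 0) :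
    ContDiff ℝ (⊤ : ℕ∞) (divSymbol b c m) := by
  have hd : ContDiff ℝ (⊤ : ℕ∞) (fun x : ℝ × ℝ => ((deriv c x.2 - deriv b x.1 : ℝ) : ℂ)) :=
    Complex.ofRealCLM.contDiff.comp (((contDiff_deriv_of_smooth hc).comp contDiff_snd).sub
      ((contDiff_deriv_of_smooth hb).comp contDiff_fst))
  rw [contDiff_iff_contDiffAt]
  intro x
  by_cases hx : x ∈ tsupport m
  · exact hm.contDiffAt.mul (hd.contDiffAt.inv (by exact_mod_cast hne x hx))
  · refine (contDiffAt_const (c := (0 : ℂ))).congr_of_eventuallyEq ?_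
    filter_upwards [notMem_tsupport_iff_eventuallyEq.1 hx] with y hy
    simp [divSymbol, hy]

theorem divSymbol_eq_zero {x : ℝ × ℝ} (hx : x ∉ tsupport m) : divSymbol b c m x = 0 := by
  simp [divSymbol, image_eq_zero_of_notMem_tsupport hx]

theorem slopeSymbol_eq_zero {x : ℝ × ℝ} (hx : x ∉ tsupport m) : slopeSymbol b c m x = 0 := by
  have h : divSymbol b c m =ᶠ[nhds x] fun _ => 0 := by
    filter_upwards [notMem_tsupport_iff_eventuallyEq.1 hx] with y hy
    simp [divSymbol, hy]
  simp [slopeSymbol, h.fderiv_eq]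

theorem hasCompactSupport_divSymbol (hmc : HasCompactSupport m) :
    HasCompactSupport (divSymbol b c m) :=
  HasCompactSupport.intro hmc fun _ => divSymbol_eq_zero

theorem hasCompactSupport_slopeSymbol (hmc : HasCompactSupport m) :
    HasCompactSupport (slopeSymbol b c m) :=
  HasCompactSupport.intro hmc fun _ => slopeSymbol_eq_zero

theorem contDiff_slopeSymbol (hb : ContDiff ℝ (⊤ : ℕ∞) b) (hc : ContDiff ℝ (⊤ : ℕ∞) c)
    (hm : ContDiff ℝ (⊤ : ℕ∞) m) (hne : ∀ x ∈ tsupport m, deriv c x.2 - deriv b x.1 ≠ 0) :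
    ContDiff ℝ (⊤ : ℕ∞) (slopeSymbol b c m) :=
  ((contDiff_divSymbol hb hc hm hne).fderiv_right (m := (⊤ : ℕ∞)) (by simp)).clm_apply
    contDiff_const

/-- A differentiable function which is square integrable together with its derivative, the norms
being controlled by `X` and `R * X`. -/
structure IsLocalised (F F' : ℝ → ℂ) (R X : ℝ) : Prop where
  measL2 : MeasL2 F
  measL2' : MeasL2 F'
  hasDerivAt : ∀ ξ, HasDerivAt F (F' ξ) ξ
  nrm_le : nrm F ≤ X
  nrm_le' : nrm F' ≤ R * X

theorem integral_sub_add_add_mul {f₁ f₂ f₃ f₀ : ℝ → ℂ} (h₁ : Integrable f₁) (h₂ : Integrable f₂)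
    (h₃ : Integrable f₃) (h₀ : Integrable f₀) (r : ℂ) :
    ∫ x, (f₁ x - f₂ x + f₃ x + r * f₀ x)
      = (∫ x, f₁ x) - (∫ x, f₂ x) + (∫ x, f₃ x) + r * ∫ x, f₀ x := by
  have h12 : Integrable (fun x => f₁ x - f₂ x) := h₁.sub h₂
  have h123 : Integrable (fun x => f₁ x - f₂ x + f₃ x) := h12.add h₃
  rw [integral_add h123 (h₀.const_mul r), integral_add h12 h₃, integral_sub h₁ h₂,
    integral_const_mul]

/-- One integration by parts in η at fixed ξ: the exponential reproduces itself times iτ(c'(η) -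
b'(ξ-η)), and `divSymbol` compensates for the slope. The three terms record which factor is
differentiated; the minus sign comes from `F` being evaluated at ξ - η. -/
theorem profile_eq_of_ne_zero {a : ℝ → ℝ} (ha : Continuous a) (hb : ContDiff ℝ (⊤ : ℕ∞) b)
    (hc : ContDiff ℝ (⊤ : ℕ∞) c) (hm : ContDiff ℝ (⊤ : ℕ∞) m) (hmc : HasCompactSupport m)
    (hne : ∀ x ∈ tsupport m, deriv c x.2 - deriv b x.1 ≠ 0) {F F' G G' : ℝ → ℂ} {R X Y : ℝ}
    (hF : IsLocalised F F' R X) (hG : IsLocalised G G' R Y) {τ : ℝ} (hτ : τ ≠ 0) (ξ : ℝ) :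
    profile (phase a b c) m F G τ ξ = (Complex.I / τ) *
      (profile (phase a b c) (slopeSymbol b c m) F G τ ξ
        - profile (phase a b c) (divSymbol b c m) F' G τ ξ
        + profile (phase a b c) (divSymbol b c m) F G' τ ξ) := by
  obtain ⟨A₀, M₀, -, hm₀, -⟩ := exists_isSymbol hm hmc
  have hd2 := contDiff_divSymbol hb hc hm hne
  obtain ⟨A₁, M₁, -, hm₁, -⟩ := exists_isSymbol (contDiff_slopeSymbol hb hc hm hne)
    (hasCompactSupport_slopeSymbol hmc)
  obtain ⟨A₂, M₂, -, hm₂, -⟩ := exists_isSymbol hd2 (hasCompactSupport_divSymbol hmc)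
  have hφ := continuous_phase ha hb.continuous hc.continuous
  set E : ℝ → ℂ := fun η => Complex.exp (Complex.I * ((τ * phase a b c (ξ - η) η : ℝ) : ℂ)) with hE
  have hE' : ∀ η, HasDerivAt E (E η * (Complex.I * ((τ * (deriv c η - deriv b (ξ - η)) : ℝ) : ℂ)))
      η := fun η =>
    hasDerivAt_cexp_I ((hasDerivAt_phase_slice (hb.differentiable (by simp))
      (hc.differentiable (by simp)) ξ η).const_mul τ)
  have hs : ∀ η, HasDerivAt (fun η : ℝ => ξ - η) (-1) η := fun η => (hasDerivAt_id' η).const_sub ξ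
  have hp : ∀ η, HasDerivAt (fun η => divSymbol b c m (ξ - η, η)) (slopeSymbol b c m (ξ - η, η)) η :=
    fun η => (hd2.differentiable (by simp) (ξ - η, η)).hasFDerivAt.comp_hasDerivAt
      (f := fun η => (ξ - η, η)) η ((hs η).prodMk (hasDerivAt_id' η))
  have hF' : ∀ η, HasDerivAt (fun η => F (ξ - η)) (-F' (ξ - η)) η := fun η => by
    simpa [Function.comp_def] using (hF.hasDerivAt (ξ - η)).scomp η (hs η)
  have i0 := integrable_profile_integrand hφ hm₀ hF.measL2 hG.measL2 τ ξ
  have i1 := integrable_profile_integrand hφ hm₁ hF.measL2 hG.measL2 τ ξ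
  have i2 := integrable_profile_integrand hφ hm₂ hF.measL2' hG.measL2 τ ξ
  have i3 := integrable_profile_integrand hφ hm₂ hF.measL2 hG.measL2' τ ξ
  have i4 := integrable_profile_integrand hφ hm₂ hF.measL2 hG.measL2 τ ξ
  have hmd : ∀ η, m (ξ - η, η) = divSymbol b c m (ξ - η, η)
      * ((deriv c η - deriv b (ξ - η) : ℝ) : ℂ) := by
    intro η
    by_cases hx : (ξ - η, η) ∈ tsupport m
    · have : ((deriv c η - deriv b (ξ - η) : ℝ) : ℂ) ≠ 0 := by exact_mod_cast hne _ hx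
      simp only [divSymbol]
      rw [inv_mul_cancel_right₀ this]
    · rw [divSymbol_eq_zero hx, image_eq_zero_of_notMem_tsupport hx, zero_mul]
  -- No boundary term appears: both the product and its derivative are integrable on the line.
  have hzero := integral_eq_zero_of_hasDerivAt_of_integrable
    (f := fun η => divSymbol b c m (ξ - η, η) * (E η * (F (ξ - η) * G η)))
    (f' := fun η => slopeSymbol b c m (ξ - η, η) * (E η * (F (ξ - η) * G η))
      - divSymbol b c m (ξ - η, η) * (E η * (F' (ξ - η) * G η))
      + divSymbol b c m (ξ - η, η) * (E η * (F (ξ - η) * G' η))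
      + (Complex.I * τ) * (m (ξ - η, η) * (E η * (F (ξ - η) * G η))))
    (fun η => by
      refine ((hp η).mul ((hE' η).mul ((hF' η).mul (hG.hasDerivAt η)))).congr_deriv ?_
      rw [hmd η]
      simp only [Pi.mul_apply]
      push_cast
      ring)
    (((i1.sub i2).add i3).add (i0.const_mul _)) i4
  have hz : profile (phase a b c) (slopeSymbol b c m) F G τ ξ
      - profile (phase a b c) (divSymbol b c m) F' G τ ξ
      + profile (phase a b c) (divSymbol b c m) F G' τ ξ
      + (Complex.I * τ) * profile (phase a b c) m F G τ ξ = 0 :=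
    (integral_sub_add_add_mul i1 i2 i3 i0 (Complex.I * τ)).symm.trans hzero
  have hτC : (τ : ℂ) ≠ 0 := by exact_mod_cast hτ
  rw [div_mul_eq_mul_div, eq_div_iff hτC]
  linear_combination (-Complex.I) * hz + (τ : ℂ) * profile (phase a b c) m F G τ ξ * Complex.I_sq

theorem integrable_mul_profile {φ : ℝ → ℝ → ℝ} {A M : ℝ} {F G v : ℝ → ℂ}
    (hφ : Continuous (Function.uncurry φ)) (hm : IsSymbol m A M) (hF : MeasL2 F) (hG : MeasL2 G)
    (hv : Measurable v) (hvi : Integrable v) (ξ : ℝ) :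
    Integrable (fun τ => v τ * profile φ m F G τ ξ) :=
  (hvi.norm.mul_const (M * (nrm F * nrm G))).mono
    (hv.mul ((measurable_profile hφ hm hF hG).comp
      (by fun_prop : Measurable fun τ : ℝ => (τ, ξ)))).aestronglyMeasurable
    (Filter.Eventually.of_forall fun τ => by
      rw [norm_mul]
      exact (mul_le_mul_of_nonneg_left (norm_profile_le hm hF hG τ ξ) (norm_nonneg _)).trans
        (le_abs_self _))

/-- Moves the factor i/τ of the integration by parts into the time weight, so that the bounds for
general weights apply to each term. At τ = 0, where the integration by parts fails, both weights
vanish. -/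
theorem profileInt_eq_of_support {a : ℝ → ℝ} (ha : Continuous a) (hb : ContDiff ℝ (⊤ : ℕ∞) b)
    (hc : ContDiff ℝ (⊤ : ℕ∞) c) (hm : ContDiff ℝ (⊤ : ℕ∞) m) (hmc : HasCompactSupport m)
    (hne : ∀ x ∈ tsupport m, deriv c x.2 - deriv b x.1 ≠ 0) {F F' G G' : ℝ → ℂ} {R X Y : ℝ}
    (hF : IsLocalised F F' R X) (hG : IsLocalised G G' R Y) {w v : ℝ → ℂ} (hv : Measurable v)
    (hvi : Integrable v) (hwv : ∀ τ, w τ * Complex.I = v τ * τ) (hw0 : w 0 = 0) (hv0 : v 0 = 0)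
    (ξ : ℝ) :
    profileInt (phase a b c) m w F G ξ = profileInt (phase a b c) (slopeSymbol b c m) v F G ξ
        - profileInt (phase a b c) (divSymbol b c m) v F' G ξ
        + profileInt (phase a b c) (divSymbol b c m) v F G' ξ := by
  obtain ⟨A₁, M₁, -, hm₁, -⟩ := exists_isSymbol (contDiff_slopeSymbol hb hc hm hne)
    (hasCompactSupport_slopeSymbol hmc)
  obtain ⟨A₂, M₂, -, hm₂, -⟩ := exists_isSymbol (contDiff_divSymbol hb hc hm hne)
    (hasCompactSupport_divSymbol hmc)
  have hφ := continuous_phase ha hb.continuous hc.continuous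
  have i1 := integrable_mul_profile hφ hm₁ hF.measL2 hG.measL2 hv hvi ξ
  have i2 := integrable_mul_profile hφ hm₂ hF.measL2' hG.measL2 hv hvi ξ
  have i3 := integrable_mul_profile hφ hm₂ hF.measL2 hG.measL2' hv hvi ξ
  have h := integral_sub_add_add_mul i1 i2 i3 i1 0
  rw [zero_mul, add_zero] at h
  simp only [profileInt]
  rw [← h]
  congr 1
  funext τ
  rcases eq_or_ne τ 0 with rfl | hτ
  · simp [hw0, hv0]
  · rw [profile_eq_of_ne_zero ha hb hc hm hmc hne hF hG hτ]
    have hτC : (τ : ℂ) ≠ 0 := by exact_mod_cast hτ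
    have hv' : v τ = w τ * (Complex.I / τ) := by
      rw [← mul_div_assoc, hwv, mul_div_cancel_right₀ _ hτC]
    rw [hv']; ring

end

/-! ### Time weights -/

/-- The indicator of the time interval `(0, T)`. -/
def initialWeight (T : ℝ) : ℝ → ℂ := (Set.Ioo 0 T).indicator fun _ => 1

/-- The weight `i / τ` on `[R, t)`, produced by an integration by parts. -/
def tailWeight (R t : ℝ) : ℝ → ℂ := (Set.Ico R t).indicator fun τ => Complex.I / τ

theorem measurable_initialWeight (T : ℝ) : Measurable (initialWeight T) :=
  measurable_const.indicator measurableSet_Ioo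

theorem measurable_tailWeight (R t : ℝ) : Measurable (tailWeight R t) :=
  (by fun_prop : Measurable fun τ : ℝ => Complex.I / (τ : ℂ)).indicator measurableSet_Ico

theorem integrable_initialWeight (T : ℝ) : Integrable (initialWeight T) :=
  (integrable_indicator_iff measurableSet_Ioo).2 (integrableOn_const (by simp))

theorem nrm_sq_eq {f : ℝ → ℂ} (hf : MemLp f 2) : nrm f ^ 2 = ∫ x, ‖f x‖ ^ 2 := by
  have h1 : Integrable (fun x => ‖f x‖ ^ 2) := hf.integrable_norm_pow (by norm_num)
  rw [integral_eq_lintegral_of_nonneg_ae (Filter.Eventually.of_forall fun x => by positivity) h1.1,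
    nrm, ← ENNReal.toReal_pow, eLpNorm_two_sq]
  congr 1
  refine lintegral_congr fun x => ?_
  rw [ENNReal.ofReal_pow (norm_nonneg _), ofReal_norm]

theorem nrm_le_of_integral_le {f : ℝ → ℂ} (hf : MemLp f 2) {B : ℝ} (h : ∫ x, ‖f x‖ ^ 2 ≤ B) :
    nrm f ≤ Real.sqrt B := by
  rw [← nrm_sq_eq hf] at h
  exact Real.le_sqrt_of_sq_le h

theorem memLp_initialWeight (T : ℝ) : MemLp (initialWeight T) 2 :=
  memLp_indicator_const 2 measurableSet_Ioo 1 (Or.inr (by simp))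

theorem nrm_initialWeight_le {T : ℝ} (hT : 0 ≤ T) : nrm (initialWeight T) ≤ Real.sqrt T := by
  refine nrm_le_of_integral_le (memLp_initialWeight T) ?_
  have e : (fun x => ‖initialWeight T x‖ ^ 2) = (Set.Ioo 0 T).indicator fun _ => (1 : ℝ) := by
    funext x
    simp only [initialWeight, Set.indicator_apply]
    split_ifs <;> simp
  rw [e, integral_indicator measurableSet_Ioo]
  simp [hT]

theorem norm_tailWeight_le {R t : ℝ} (hR : 0 < R) (τ : ℝ) : ‖tailWeight R t τ‖ ≤ R⁻¹ := by
  simp only [tailWeight, Set.indicator_apply]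
  split_ifs with h
  · rw [norm_div, Complex.norm_I, Complex.norm_real, Real.norm_of_nonneg (hR.le.trans h.1), one_div]
    exact inv_anti₀ hR h.1
  · simpa using hR.le

theorem measL2_tailWeight {R t : ℝ} (hR : 0 < R) : MeasL2 (tailWeight R t) :=
  measL2_of_bounded_of_support (measurable_tailWeight R t) (B := |t|) (norm_tailWeight_le hR)
    fun x hx => by
      refine Set.indicator_of_notMem (fun h : x ∈ Set.Ico R t => ?_) _
      rw [abs_of_pos (hR.trans_le h.1)] at hx
      exact absurd h.2 (not_lt.2 ((le_abs_self t).trans hx))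

theorem integrable_tailWeight {R t : ℝ} (hR : 0 < R) : Integrable (tailWeight R t) :=
  integrable_of_memLp_of_support (measL2_tailWeight hR).memLp (A := |t|)
    fun x hx => by
      refine Set.indicator_of_notMem (fun h : x ∈ Set.Ico R t => ?_) _
      rw [abs_of_pos (hR.trans_le h.1)] at hx
      exact absurd h.2 (not_lt.2 ((le_abs_self t).trans hx))

/-- The integral of τ⁻² over [R, t] is at most 1/R. -/
theorem nrm_tailWeight_le {R t : ℝ} (hR : 0 < R) (hRt : R ≤ t) :
    nrm (tailWeight R t) ≤ (Real.sqrt R)⁻¹ := by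
  rw [← Real.sqrt_inv]
  refine nrm_le_of_integral_le (measL2_tailWeight hR).memLp ?_
  have e : (fun x => ‖tailWeight R t x‖ ^ 2) = (Set.Ico R t).indicator fun τ => (τ ^ 2)⁻¹ := by
    funext x
    simp only [tailWeight, Set.indicator_apply]
    split_ifs <;> simp
  rw [e, integral_indicator measurableSet_Ico, integral_Ico_eq_integral_Ioc,
    ← intervalIntegral.integral_of_le hRt]
  have hpos : ∀ x ∈ Set.uIcc R t, x ≠ 0 := fun x hx => by
    rw [Set.uIcc_of_le hRt] at hx
    exact (hR.trans_le hx.1).ne'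
  have := intervalIntegral.integral_eq_sub_of_hasDerivAt (a := R) (b := t)
    (f := fun x => -x⁻¹) (f' := fun x => (x ^ 2)⁻¹)
    (fun x hx => by simpa using (hasDerivAt_inv (hpos x hx)).fun_neg)
    (ContinuousOn.intervalIntegrable (continuousOn_id.pow 2 |>.inv₀ fun x hx =>
      pow_ne_zero 2 (hpos x hx)))
  rw [this]
  have : 0 < t⁻¹ := inv_pos.2 (hR.trans_le hRt)
  linarith

/-- The integral equals 2(√t - √(t-T)), and √(t-T) √t ≥ t - T makes the bound linear in `T`. This is
how the early times τ < R contribute only R/√t. -/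
theorem integrableOn_inv_sqrt_sub {t T : ℝ} (hT : 0 ≤ T) (hTt : T ≤ t) :
    IntegrableOn (fun τ => (Real.sqrt (t - τ))⁻¹) (Set.Ioo 0 T) ∧
      ∫ τ in Set.Ioo 0 T, (Real.sqrt (t - τ))⁻¹ ≤ 2 * T / Real.sqrt t := by
  have hd : ∀ τ ∈ Set.Ioo 0 T, HasDerivAt (fun τ => -2 * Real.sqrt (t - τ))
      ((Real.sqrt (t - τ))⁻¹) τ := by
    intro τ hτ
    have hpos : 0 < t - τ := by linarith [hτ.2]
    have := ((Real.hasDerivAt_sqrt hpos.ne').scomp τ ((hasDerivAt_id' τ).const_sub t)).const_mul (-2)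
    refine this.congr_deriv ?_
    simp only [smul_eq_mul]
    field_simp
  have hc : ContinuousOn (fun τ => -2 * Real.sqrt (t - τ)) (Set.Icc 0 T) :=
    Continuous.continuousOn (by fun_prop)
  have hi : IntegrableOn (fun τ => (Real.sqrt (t - τ))⁻¹) (Set.Ioc 0 T) :=
    intervalIntegral.integrableOn_deriv_of_nonneg hc hd fun τ _ => by positivity
  refine ⟨hi.mono_set Set.Ioo_subset_Ioc_self, ?_⟩
  rw [← integral_Ioc_eq_integral_Ioo, ← intervalIntegral.integral_of_le hT,
    intervalIntegral.integral_eq_sub_of_hasDerivAt_of_le hT hc hd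
      ((intervalIntegrable_iff_integrableOn_Ioc_of_le hT).2 hi)]
  rcases eq_or_lt_of_le (hT.trans hTt) with h0 | h0
  · have : T = 0 := le_antisymm (h0 ▸ hTt) hT
    simp [this]
  · have hs : 0 < Real.sqrt t := Real.sqrt_pos.2 h0
    rw [le_div_iff₀ hs, sub_zero]
    have h1 : Real.sqrt t * Real.sqrt t = t := Real.mul_self_sqrt h0.le
    have h2 : Real.sqrt (t - T) * Real.sqrt (t - T) = t - T := Real.mul_self_sqrt (by linarith)
    have h3 : Real.sqrt (t - T) ≤ Real.sqrt t := Real.sqrt_le_sqrt (by linarith)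
    nlinarith [mul_le_mul_of_nonneg_left h3 (Real.sqrt_nonneg (t - T))]

theorem initialWeight_dispersive {t T : ℝ} (hT : 0 ≤ T) (hTt : T ≤ t) :
    Integrable (fun τ => ‖initialWeight T τ‖ * (Real.sqrt (t - τ))⁻¹) ∧
      ∫ τ, ‖initialWeight T τ‖ * (Real.sqrt (t - τ))⁻¹ ≤ 2 * T / Real.sqrt t := by
  obtain ⟨h1, h2⟩ := integrableOn_inv_sqrt_sub hT hTt
  have e : (fun τ => ‖initialWeight T τ‖ * (Real.sqrt (t - τ))⁻¹)
      = (Set.Ioo 0 T).indicator fun τ => (Real.sqrt (t - τ))⁻¹ := by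
    funext τ
    simp only [initialWeight, Set.indicator_apply]
    split_ifs <;> simp
  rw [e]
  refine ⟨(integrable_indicator_iff measurableSet_Ioo).2 h1, ?_⟩
  rwa [integral_indicator measurableSet_Ioo]

/-- For τ ≤ t/2 the square root is comparable to √t and 1/τ produces the logarithm; for τ ≥ t/2 one
has 1/τ ≤ 2/t and the singularity at τ = t is integrable. -/
theorem tailWeight_dispersive {t R : ℝ} (hR : 1 ≤ R) (hRt : R ≤ t) :
    Integrable (fun τ => ‖tailWeight R t τ‖ * (Real.sqrt (t - τ))⁻¹) ∧
      ∫ τ, ‖tailWeight R t τ‖ * (Real.sqrt (t - τ))⁻¹ ≤ (2 * Real.log t + 4) / Real.sqrt t := by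
  have hR0 : 0 < R := one_pos.trans_le hR
  have ht : 0 < t := hR0.trans_le hRt
  have hs : 0 < Real.sqrt t := Real.sqrt_pos.2 ht
  obtain ⟨h1, h2⟩ := integrableOn_inv_sqrt_sub ht.le le_rfl
  have hi1 : IntegrableOn (fun τ : ℝ => τ⁻¹) (Set.Ico R t) := by
    refine (ContinuousOn.integrableOn_Icc ?_).mono_set Set.Ico_subset_Icc_self
    exact continuousOn_id.inv₀ fun x hx => (hR0.trans_le hx.1).ne'
  have hsub : Set.Ico R t ⊆ Set.Ioo 0 t := fun x hx => ⟨hR0.trans_le hx.1, hx.2⟩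
  have hi2 := h1.mono_set hsub
  -- The sum of the bounds from the two halves dominates on the whole interval, which avoids
  -- splitting the integral.
  have hdom : IntegrableOn (fun τ : ℝ => 2 / Real.sqrt t * τ⁻¹ + 2 / t * (Real.sqrt (t - τ))⁻¹)
      (Set.Ico R t) := (hi1.const_mul _).add (hi2.const_mul _)
  have hb : ∀ τ ∈ Set.Ico R t, τ⁻¹ * (Real.sqrt (t - τ))⁻¹
      ≤ 2 / Real.sqrt t * τ⁻¹ + 2 / t * (Real.sqrt (t - τ))⁻¹ := by
    intro τ hτ
    have hτ0 : 0 < τ := hR0.trans_le hτ.1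
    rcases le_total τ (t / 2) with h | h
    · have h3 : (Real.sqrt (t - τ))⁻¹ ≤ 2 / Real.sqrt t := by
        have h4 : Real.sqrt t / 2 ≤ Real.sqrt (t - τ) := by
          apply Real.le_sqrt_of_sq_le
          rw [div_pow, Real.sq_sqrt ht.le]
          linarith
        calc (Real.sqrt (t - τ))⁻¹ ≤ (Real.sqrt t / 2)⁻¹ := inv_anti₀ (by positivity) h4
          _ = 2 / Real.sqrt t := by rw [inv_div]
      have h5 : 0 ≤ 2 / t * (Real.sqrt (t - τ))⁻¹ := by positivity
      have := mul_le_mul_of_nonneg_left h3 (inv_nonneg.2 hτ0.le)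
      linarith
    · have h3 : τ⁻¹ ≤ 2 / t := by
        calc τ⁻¹ ≤ (t / 2)⁻¹ := inv_anti₀ (by positivity) h
          _ = 2 / t := by rw [inv_div]
      have h5 : 0 ≤ 2 / Real.sqrt t * τ⁻¹ := by positivity
      have := mul_le_mul_of_nonneg_right h3 (inv_nonneg.2 (Real.sqrt_nonneg (t - τ)))
      linarith
  have hint : IntegrableOn (fun τ : ℝ => τ⁻¹ * (Real.sqrt (t - τ))⁻¹) (Set.Ico R t) := by
    refine Integrable.mono hdom
      (by fun_prop : Measurable fun τ : ℝ => τ⁻¹ * (Real.sqrt (t - τ))⁻¹).aestronglyMeasurable ?_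
    filter_upwards [ae_restrict_mem measurableSet_Ico] with τ hτ
    have hτ0 : 0 < τ := hR0.trans_le hτ.1
    rw [Real.norm_of_nonneg (by positivity)]
    exact (hb τ hτ).trans (le_abs_self _)
  have e : (fun τ => ‖tailWeight R t τ‖ * (Real.sqrt (t - τ))⁻¹)
      = (Set.Ico R t).indicator fun τ => τ⁻¹ * (Real.sqrt (t - τ))⁻¹ := by
    funext τ
    simp only [tailWeight, Set.indicator_apply]
    split_ifs with h
    · rw [norm_div, Complex.norm_I, Complex.norm_real, Real.norm_of_nonneg (hR0.le.trans h.1),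
        one_div]
    · simp
  rw [e]
  refine ⟨(integrable_indicator_iff measurableSet_Ico).2 hint, ?_⟩
  rw [integral_indicator measurableSet_Ico]
  calc ∫ τ in Set.Ico R t, τ⁻¹ * (Real.sqrt (t - τ))⁻¹
      ≤ ∫ τ in Set.Ico R t, (2 / Real.sqrt t * τ⁻¹ + 2 / t * (Real.sqrt (t - τ))⁻¹) :=
        setIntegral_mono_on hint hdom measurableSet_Ico hb
    _ = 2 / Real.sqrt t * (∫ τ in Set.Ico R t, τ⁻¹)
        + 2 / t * ∫ τ in Set.Ico R t, (Real.sqrt (t - τ))⁻¹ := by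
        rw [integral_add (hi1.const_mul _) (hi2.const_mul _), integral_const_mul,
          integral_const_mul]
    _ ≤ 2 / Real.sqrt t * Real.log t + 2 / t * (2 * t / Real.sqrt t) := by
        gcongr
        · rw [integral_Ico_eq_integral_Ioc, ← intervalIntegral.integral_of_le hRt,
            integral_inv_of_pos hR0 ht]
          exact Real.log_le_log (by positivity) (div_le_self ht.le hR)
        · refine le_trans ?_ h2
          exact setIntegral_mono_set h1 (Filter.Eventually.of_forall fun τ => by positivity)
            hsub.eventuallyLE
    _ = _ := by field_simp; ring

/-! ### Block estimates -/

theorem nrm_add_le {f g : ℝ → ℂ} (hf : MemLp f 2) (hg : MemLp g 2) :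
    nrm (fun x => f x + g x) ≤ nrm f + nrm g := by
  have h := eLpNorm_add_le (p := 2) hf.1 hg.1 (by norm_num)
  have h2 := ENNReal.toReal_mono (ENNReal.add_ne_top.2 ⟨hf.2.ne, hg.2.ne⟩) h
  rwa [ENNReal.toReal_add hf.2.ne hg.2.ne] at h2

theorem nrm_neg (f : ℝ → ℂ) : nrm (fun x => -f x) = nrm f :=
  congrArg ENNReal.toReal (eLpNorm_neg f 2 volume)

/-- The free evolution at time `t` of a function with Fourier transform `h`, up to a constant. -/
def evolve (a : ℝ → ℝ) (t : ℝ) (h : ℝ → ℂ) (x : ℝ) : ℂ :=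
  ∫ ξ, Complex.exp (Complex.I * ((x * ξ : ℝ) : ℂ)) * (Complex.exp (Complex.I *
    ((t * a ξ : ℝ) : ℂ)) * h ξ)

theorem integrable_evolve {a : ℝ → ℝ} (ha : Continuous a) (t x : ℝ) {h : ℝ → ℂ}
    (hh : Integrable h) : Integrable (fun ξ => Complex.exp (Complex.I * ((x * ξ : ℝ) : ℂ))
      * (Complex.exp (Complex.I * ((t * a ξ : ℝ) : ℂ)) * h ξ)) := by
  have h1 : Continuous (fun ξ => Complex.exp (Complex.I * ((x * ξ : ℝ) : ℂ))) := by fun_prop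
  have h2 : Continuous (fun ξ => Complex.exp (Complex.I * ((t * a ξ : ℝ) : ℂ))) := by fun_prop
  refine hh.mono (h1.aestronglyMeasurable.mul (h2.aestronglyMeasurable.mul hh.1))
    (Filter.Eventually.of_forall fun ξ => ?_)
  rw [norm_mul, norm_mul, norm_cexp_I, norm_cexp_I, one_mul, one_mul]

theorem evolve_add {a : ℝ → ℝ} (ha : Continuous a) (t x : ℝ) {f g : ℝ → ℂ}
    (hf : Integrable f) (hg : Integrable g) :
    evolve a t (fun ξ => f ξ + g ξ) x = evolve a t f x + evolve a t g x := by
  simp only [evolve]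
  rw [← integral_add (integrable_evolve ha t x hf) (integrable_evolve ha t x hg)]
  congr 1; funext ξ; ring

theorem evolve_neg (a : ℝ → ℝ) (t x : ℝ) (f : ℝ → ℂ) :
    evolve a t (fun ξ => -f ξ) x = -evolve a t f x := by
  simp only [evolve]
  rw [← integral_neg]
  congr 1; funext ξ; ring

theorem norm_evolve_le (a : ℝ → ℝ) (t x : ℝ) (f : ℝ → ℂ) :
    ‖evolve a t f x‖ ≤ ∫ ξ, ‖f ξ‖ := by
  refine (norm_integral_le_integral_norm _).trans_eq ?_
  congr 1; funext ξ
  rw [norm_mul, norm_mul, norm_cexp_I, norm_cexp_I, one_mul, one_mul]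

/-- The hypotheses on the dispersion relations and the symbol. -/
structure Setting (a b c : ℝ → ℝ) (m : ℝ × ℝ → ℂ) : Prop where
  smooth_a : ContDiff ℝ (⊤ : ℕ∞) a
  smooth_b : ContDiff ℝ (⊤ : ℕ∞) b
  smooth_c : ContDiff ℝ (⊤ : ℕ∞) c
  smooth_m : ContDiff ℝ (⊤ : ℕ∞) m
  compact_m : HasCompactSupport m
  curved : SecondDerivBoundedAway a
  transversal : ∀ x ∈ tsupport m, deriv c x.2 - deriv b x.1 ≠ 0

section

variable {a b c : ℝ → ℝ} {m : ℝ × ℝ → ℂ}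

theorem Setting.continuous_phase (h : Setting a b c m) :
    Continuous (Function.uncurry (phase a b c)) :=
  BilinearDispersive.continuous_phase h.smooth_a.continuous h.smooth_b.continuous
    h.smooth_c.continuous

/-- The `L²` and dispersive bounds for weights vanishing after time `t`, for symbols `n` with the
support of `m`. -/
theorem Setting.exists_weight_bounds (h : Setting a b c m) {n : ℝ × ℝ → ℂ}
    (hn : ContDiff ℝ (⊤ : ℕ∞) n) (hnm : ∀ x ∉ tsupport m, n x = 0) :
    ∃ C : ℝ, 0 ≤ C ∧ ∀ w F G : ℝ → ℂ, Measurable w → Integrable w → MemLp w 2 → MeasL2 F →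
      MeasL2 G → nrm (profileInt (phase a b c) n w F G) ≤ C * nrm w * (nrm F * nrm G) ∧
      ∀ t x : ℝ, (∀ τ, t ≤ τ → w τ = 0) → Integrable (fun τ => ‖w τ‖ * (Real.sqrt (t - τ))⁻¹) →
        ‖evolve a t (profileInt (phase a b c) n w F G) x‖
          ≤ C * (∫ τ, ‖w τ‖ * (Real.sqrt (t - τ))⁻¹) * (nrm F * nrm G) := by
  have hnc : HasCompactSupport n := HasCompactSupport.intro h.compact_m hnm
  obtain ⟨A, M, -, hsym, -⟩ := exists_isSymbol hn hnc
  obtain ⟨C₁, hC₁, h₁⟩ := exists_nrm_profileInt_le h.smooth_a.continuous h.smooth_b h.smooth_c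
    h.compact_m.isCompact h.transversal hsym hnm
  obtain ⟨C₂, hC₂, h₂⟩ := exists_norm_integral_profileInt_le h.smooth_a h.curved
    h.smooth_b.continuous h.smooth_c.continuous hn hnc
  refine ⟨max C₁ C₂, hC₁.trans (le_max_left _ _), fun w F G hw hwi hw2 hF hG => ⟨?_, ?_⟩⟩
  · have hN : 0 ≤ nrm w * (nrm F * nrm G) :=
      mul_nonneg (nrm_nonneg _) (mul_nonneg (nrm_nonneg _) (nrm_nonneg _))
    refine (h₁ w F G hw hwi hw2 hF hG).trans ?_
    rw [mul_assoc, mul_assoc]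
    exact mul_le_mul_of_nonneg_right (le_max_left _ _) hN
  · intro t x hwt hwd
    refine (h₂ t x w F G hw hwi hwt hwd hF hG).trans ?_
    rw [mul_assoc, mul_assoc]
    exact mul_le_mul_of_nonneg_right (le_max_right _ _)
      (mul_nonneg (integral_nonneg fun τ => by positivity)
        (mul_nonneg (nrm_nonneg _) (nrm_nonneg _)))

/-- The Duhamel profile at time `t`. -/
def duhamel (a b c : ℝ → ℝ) (m : ℝ × ℝ → ℂ) (t : ℝ) (F G : ℝ → ℂ) : ℝ → ℂ :=
  profileInt (phase a b c) m (initialWeight t) F G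

theorem initialWeight_eq_zero {t τ : ℝ} (h : t ≤ τ) : initialWeight t τ = 0 :=
  Set.indicator_of_notMem (fun h' : τ ∈ Set.Ioo 0 t => absurd h'.2 (not_lt.2 h)) _

theorem tailWeight_eq_zero {R t τ : ℝ} (h : t ≤ τ) : tailWeight R t τ = 0 :=
  Set.indicator_of_notMem (fun h' : τ ∈ Set.Ico R t => absurd h'.2 (not_lt.2 h)) _

theorem Setting.measL2_duhamel (h : Setting a b c m) (t : ℝ) {F G : ℝ → ℂ} (hF : MeasL2 F)
    (hG : MeasL2 G) : MeasL2 (duhamel a b c m t F G) ∧ Integrable (duhamel a b c m t F G) := by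
  obtain ⟨A, M, -, hsym, -⟩ := exists_isSymbol h.smooth_m h.compact_m
  exact ⟨measL2_profileInt h.continuous_phase hsym hF hG (measurable_initialWeight t)
      (integrable_initialWeight t),
    integrable_profileInt h.continuous_phase hsym hF hG (measurable_initialWeight t)
      (integrable_initialWeight t)⟩

/-- The estimate for general data. -/
theorem Setting.exists_duhamel_le (h : Setting a b c m) :
    ∃ C : ℝ, 0 ≤ C ∧ ∀ (t : ℝ) (F G : ℝ → ℂ), 0 < t → MeasL2 F → MeasL2 G →
      nrm (duhamel a b c m t F G) ≤ C * Real.sqrt t * (nrm F * nrm G) ∧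
      ∀ x, ‖evolve a t (duhamel a b c m t F G) x‖ ≤ C * Real.sqrt t * (nrm F * nrm G) := by
  obtain ⟨C, hC, hb⟩ := h.exists_weight_bounds h.smooth_m
    (fun x hx => image_eq_zero_of_notMem_tsupport hx)
  -- The 2 comes from ∫_0^t (t-τ)^{-1/2} dτ = 2√t.
  refine ⟨2 * C, by positivity, fun t F G ht hF hG => ?_⟩
  have hN : 0 ≤ nrm F * nrm G := mul_nonneg (nrm_nonneg _) (nrm_nonneg _)
  obtain ⟨h1, h2⟩ := hb _ F G (measurable_initialWeight t) (integrable_initialWeight t)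
    (memLp_initialWeight t) hF hG
  obtain ⟨h3, h4⟩ := initialWeight_dispersive ht.le le_rfl
  refine ⟨h1.trans (mul_le_mul_of_nonneg_right ?_ hN), fun x =>
    (h2 t x (fun τ => initialWeight_eq_zero) h3).trans (mul_le_mul_of_nonneg_right ?_ hN)⟩
  · have h5 := nrm_initialWeight_le ht.le
    have h6 := mul_le_mul_of_nonneg_left h5 hC
    have h7 : 0 ≤ C * Real.sqrt t := mul_nonneg hC (Real.sqrt_nonneg t)
    linarith
  · have h5 : 2 * t / Real.sqrt t = 2 * Real.sqrt t := by
      rw [mul_div_assoc, Real.div_sqrt]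
    rw [h5] at h4
    have h6 := mul_le_mul_of_nonneg_left h4 hC
    linarith

/-- The estimate for small times. -/
theorem Setting.exists_duhamel_le_small (h : Setting a b c m) :
    ∃ C : ℝ, 0 ≤ C ∧ ∀ (t : ℝ) (F G : ℝ → ℂ), 0 < t → MeasL2 F → MeasL2 G →
      nrm (duhamel a b c m t F G) ≤ C * t * (nrm F * nrm G) ∧
      ∀ x, ‖evolve a t (duhamel a b c m t F G) x‖ ≤ C * t * (nrm F * nrm G) := by
  obtain ⟨A, M, hA, hsym, -⟩ := exists_isSymbol h.smooth_m h.compact_m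
  have hM := hsym.bound_nonneg
  refine ⟨M * (4 * A + 1), by positivity, fun t F G ht hF hG => ?_⟩
  have hN : 0 ≤ nrm F * nrm G := mul_nonneg (nrm_nonneg _) (nrm_nonneg _)
  obtain ⟨hH, hHi⟩ := h.measL2_duhamel t hF hG
  set K : ℝ := t * (M * (nrm F * nrm G)) with hK
  have hK0 : 0 ≤ K := by positivity
  -- No oscillation is used: the profile is bounded and frequency localised to an interval of length
  -- 4A. The factor 4A + 1 covers both 4A for L^∞ and its square root for L².
  have hbd : ∀ ξ, ‖duhamel a b c m t F G ξ‖ ≤ (Set.Icc (-(2 * A)) (2 * A)).indicator (fun _ => K) ξ := by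
    intro ξ
    by_cases hξ : ξ ∈ Set.Icc (-(2 * A)) (2 * A)
    · rw [Set.indicator_of_mem hξ]
      refine (norm_profileInt_le hsym hF hG (integrable_initialWeight t) ξ).trans (le_of_eq ?_)
      rw [hK]
      congr 1
      have e : (fun τ => ‖initialWeight t τ‖) = (Set.Ioo 0 t).indicator fun _ => (1 : ℝ) := by
        funext x
        simp only [initialWeight, Set.indicator_apply]
        split_ifs <;> simp
      rw [e, integral_indicator measurableSet_Ioo]
      simp [ht.le]
    · rw [Set.indicator_of_notMem hξ, duhamel, profileInt_eq_zero hsym, norm_zero]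
      by_contra! hlt
      exact hξ ⟨(abs_lt.1 hlt).1.le, (abs_lt.1 hlt).2.le⟩
  have hII : ∀ r : ℝ, ∫ ξ, (Set.Icc (-(2 * A)) (2 * A)).indicator (fun _ => r) ξ = 4 * A * r := by
    intro r
    rw [integral_indicator measurableSet_Icc, setIntegral_const,
      Real.volume_real_Icc_of_le (by linarith), smul_eq_mul]
    ring
  have hIi : ∀ r : ℝ, Integrable ((Set.Icc (-(2 * A)) (2 * A)).indicator (fun _ : ℝ => r)) :=
    fun r => (integrable_indicator_iff measurableSet_Icc).2 (integrableOn_const (by simp))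
  have hfin : M * (4 * A + 1) * t * (nrm F * nrm G) = (4 * A + 1) * K := by rw [hK]; ring
  rw [hfin]
  constructor
  · have h1 : ∫ ξ, ‖duhamel a b c m t F G ξ‖ ^ 2 ≤ ((4 * A + 1) * K) ^ 2 := by
      calc _ ≤ ∫ ξ, (Set.Icc (-(2 * A)) (2 * A)).indicator (fun _ => K ^ 2) ξ := by
            refine integral_mono (hH.memLp.integrable_norm_pow (by norm_num)) (hIi _) fun ξ => ?_
            have := pow_le_pow_left₀ (norm_nonneg _) (hbd ξ) 2
            refine this.trans (le_of_eq ?_)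
            simp only [Set.indicator_apply]
            split_ifs <;> simp
        _ = 4 * A * K ^ 2 := hII _
        _ ≤ _ := by
            have : 4 * A ≤ (4 * A + 1) ^ 2 := by nlinarith
            exact (mul_le_mul_of_nonneg_right this (sq_nonneg K)).trans_eq
              (mul_pow (4 * A + 1) K 2).symm
    refine (nrm_le_of_integral_le hH.memLp h1).trans_eq ?_
    exact Real.sqrt_sq (by positivity)
  · intro x
    refine (norm_evolve_le a t x _).trans ((integral_mono hHi.norm (hIi K) hbd).trans ?_)
    rw [hII]
    nlinarith

/-- The estimate for data localised in `|x| ≤ R`. -/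
theorem Setting.exists_duhamel_le_of_isLocalised (h : Setting a b c m) :
    ∃ C : ℝ, 0 ≤ C ∧ ∀ (t R X Y : ℝ) (F F' G G' : ℝ → ℂ), 1 ≤ R → R ≤ t →
      IsLocalised F F' R X → IsLocalised G G' R Y →
      nrm (duhamel a b c m t F G) ≤ C * Real.sqrt R * (X * Y) ∧
      ∀ x, ‖evolve a t (duhamel a b c m t F G) x‖
        ≤ C * (R * (Real.log t + 1) / Real.sqrt t) * (X * Y) := by
  obtain ⟨C₀, hC₀, hb₀⟩ := h.exists_weight_bounds h.smooth_m
    (fun x hx => image_eq_zero_of_notMem_tsupport hx)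
  have hs₁ := contDiff_slopeSymbol h.smooth_b h.smooth_c h.smooth_m h.transversal
  have hs₂ := contDiff_divSymbol h.smooth_b h.smooth_c h.smooth_m h.transversal
  obtain ⟨C₁, hC₁, hb₁⟩ := h.exists_weight_bounds hs₁ fun _ => slopeSymbol_eq_zero
  obtain ⟨C₂, hC₂, hb₂⟩ := h.exists_weight_bounds hs₂ fun _ => divSymbol_eq_zero
  obtain ⟨A₀, M₀, -, hm₀, -⟩ := exists_isSymbol h.smooth_m h.compact_m
  obtain ⟨A₁, M₁, -, hm₁, -⟩ := exists_isSymbol hs₁ (hasCompactSupport_slopeSymbol h.compact_m)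
  obtain ⟨A₂, M₂, -, hm₂, -⟩ := exists_isSymbol hs₂ (hasCompactSupport_divSymbol h.compact_m)
  -- Dictated by the dispersive bound: 2R/√t before time `R`, 2 log t + 4 ≤ 4(log t + 1) after it,
  -- and the divided symbol occurs in two terms.
  refine ⟨2 * C₀ + 4 * C₁ + 8 * C₂, by positivity, fun t R X Y F F' G G' hR hRt hF hG => ?_⟩
  have hR0 : 0 < R := one_pos.trans_le hR
  have ht : 0 < t := hR0.trans_le hRt
  have hX : 0 ≤ X := (nrm_nonneg _).trans hF.nrm_le
  have hY : 0 ≤ Y := (nrm_nonneg _).trans hG.nrm_le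
  have hφ := h.continuous_phase
  set H₀ := profileInt (phase a b c) m (initialWeight R) F G with hH₀
  set H₁ := profileInt (phase a b c) (slopeSymbol b c m) (tailWeight R t) F G with hH₁
  set H₂ := profileInt (phase a b c) (divSymbol b c m) (tailWeight R t) F' G with hH₂
  set H₃ := profileInt (phase a b c) (divSymbol b c m) (tailWeight R t) F G' with hH₃
  have hwm := measurable_initialWeight R
  have hwi := integrable_initialWeight R
  have hvm := measurable_tailWeight R t
  have hvi : Integrable (tailWeight R t) := integrable_tailWeight hR0
  have hv2 := (measL2_tailWeight (t := t) hR0).memLp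
  -- Time is cut at τ = R, where the loss `R` of a derivative equals the gain τ: earlier,
  -- integrating by parts would not pay.
  set v₀ : ℝ → ℂ := (Set.Ico R t).indicator fun _ => 1 with hv₀
  have hv₀m : Measurable v₀ := measurable_const.indicator measurableSet_Ico
  have hv₀i : Integrable v₀ :=
    (integrable_indicator_iff measurableSet_Ico).2 (integrableOn_const (by simp))
  have hsplit : duhamel a b c m t F G = fun ξ => H₀ ξ + (H₁ ξ + (-H₂ ξ + H₃ ξ)) := by
    funext ξ
    have e1 := profileInt_eq_of_support h.smooth_a.continuous h.smooth_b h.smooth_c h.smooth_m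
      h.compact_m h.transversal hF hG hvm hvi (w := v₀) (fun τ => by
        simp only [hv₀, tailWeight, Set.indicator_apply]
        split_ifs with hτ
        · have : (τ : ℂ) ≠ 0 := by exact_mod_cast (hR0.trans_le hτ.1).ne'
          rw [one_mul, div_mul_cancel₀ _ this]
        · simp)
      (Set.indicator_of_notMem (fun h' : (0 : ℝ) ∈ Set.Ico R t => absurd h'.1 (not_le.2 hR0)) _)
      (Set.indicator_of_notMem (fun h' : (0 : ℝ) ∈ Set.Ico R t => absurd h'.1 (not_le.2 hR0)) _) ξ
    have e2 : duhamel a b c m t F G ξ = H₀ ξ + profileInt (phase a b c) m v₀ F G ξ := by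
      simp only [duhamel, hH₀, profileInt]
      rw [← integral_add (integrable_mul_profile hφ hm₀ hF.measL2 hG.measL2 hwm hwi ξ)
        (integrable_mul_profile hφ hm₀ hF.measL2 hG.measL2 hv₀m hv₀i ξ)]
      congr 1; funext τ
      rw [← add_mul]
      congr 1
      simp only [initialWeight, hv₀, Set.indicator_apply, Set.mem_Ioo, Set.mem_Ico]
      by_cases h1 : τ < R
      · simp [h1, not_le.2 h1, h1.trans_le hRt]
      · have h2 := not_lt.1 h1
        simp [h1, h2, hR0.trans_le h2]
    rw [e2, e1]
    ring
  obtain ⟨n0, d0⟩ := hb₀ _ F G hwm hwi (memLp_initialWeight R) hF.measL2 hG.measL2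
  obtain ⟨n1, d1⟩ := hb₁ _ F G hvm hvi hv2 hF.measL2 hG.measL2
  obtain ⟨n2, d2⟩ := hb₂ _ F' G hvm hvi hv2 hF.measL2' hG.measL2
  obtain ⟨n3, d3⟩ := hb₂ _ F G' hvm hvi hv2 hF.measL2 hG.measL2'
  have hFG : nrm F * nrm G ≤ X * Y := mul_le_mul hF.nrm_le hG.nrm_le (nrm_nonneg _) hX
  -- Here 1 ≤ R lets the term in which the symbol is differentiated be treated like the two in which
  -- the data are.
  have hFG1 : nrm F * nrm G ≤ R * (X * Y) :=
    hFG.trans (le_mul_of_one_le_left (mul_nonneg hX hY) hR)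
  have hF'G : nrm F' * nrm G ≤ R * (X * Y) := by
    rw [← mul_assoc]
    exact mul_le_mul hF.nrm_le' hG.nrm_le (nrm_nonneg _) (by positivity)
  have hFG' : nrm F * nrm G' ≤ R * (X * Y) := by
    rw [mul_left_comm]
    exact mul_le_mul hF.nrm_le hG.nrm_le' (nrm_nonneg _) hX
  have hXY : 0 ≤ X * Y := mul_nonneg hX hY
  rw [hsplit]
  constructor
  · have l0 := (measL2_profileInt hφ hm₀ hF.measL2 hG.measL2 hwm hwi).memLp
    have l1 := (measL2_profileInt hφ hm₁ hF.measL2 hG.measL2 hvm hvi).memLp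
    have l2 := (measL2_profileInt hφ hm₂ hF.measL2' hG.measL2 hvm hvi).memLp
    have l3 := (measL2_profileInt hφ hm₂ hF.measL2 hG.measL2' hvm hvi).memLp
    have t1 := nrm_add_le l0 (l1.add (l2.neg.add l3))
    have t2 := nrm_add_le l1 (l2.neg.add l3)
    have t3 := nrm_add_le l2.neg l3
    have t4 := nrm_neg H₂
    have hS := Real.sqrt_nonneg R
    have hv : ∀ {C Z : ℝ}, 0 ≤ C → 0 ≤ Z → Z ≤ R * (X * Y) →
        C * nrm (tailWeight R t) * Z ≤ C * Real.sqrt R * (X * Y) := by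
      intro C Z hC hZ0 hZ
      calc C * nrm (tailWeight R t) * Z ≤ C * (Real.sqrt R)⁻¹ * (R * (X * Y)) := by
            have := nrm_tailWeight_le hR0 hRt
            gcongr
        _ = C * (R / Real.sqrt R) * (X * Y) := by ring
        _ = _ := by rw [Real.div_sqrt]
    have b0 : C₀ * nrm (initialWeight R) * (nrm F * nrm G) ≤ C₀ * Real.sqrt R * (X * Y) := by
      have := nrm_initialWeight_le hR0.le
      have := mul_nonneg (nrm_nonneg F) (nrm_nonneg G)
      gcongr
    have b1 := hv hC₁ (mul_nonneg (nrm_nonneg F) (nrm_nonneg G)) hFG1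
    have b2 := hv hC₂ (mul_nonneg (nrm_nonneg F') (nrm_nonneg G)) hF'G
    have b3 := hv hC₂ (mul_nonneg (nrm_nonneg F) (nrm_nonneg G')) hFG'
    have p0 : 0 ≤ C₀ * Real.sqrt R * (X * Y) := by positivity
    have p1 : 0 ≤ C₁ * Real.sqrt R * (X * Y) := by positivity
    have p2 : 0 ≤ C₂ * Real.sqrt R * (X * Y) := by positivity
    have e : (2 * C₀ + 4 * C₁ + 8 * C₂) * Real.sqrt R * (X * Y)
        = 2 * (C₀ * Real.sqrt R * (X * Y)) + 4 * (C₁ * Real.sqrt R * (X * Y))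
          + 8 * (C₂ * Real.sqrt R * (X * Y)) := by ring
    rw [e]
    simp only [Pi.add_apply, Pi.neg_apply] at t1 t2 t3
    change nrm (fun x => H₀ x + (H₁ x + (-H₂ x + H₃ x)))
      ≤ nrm H₀ + nrm (fun x => H₁ x + (-H₂ x + H₃ x)) at t1
    change nrm (fun x => H₁ x + (-H₂ x + H₃ x)) ≤ nrm H₁ + nrm (fun x => -H₂ x + H₃ x) at t2
    change nrm (fun x => -H₂ x + H₃ x) ≤ nrm (fun x => -H₂ x) + nrm H₃ at t3
    linarith
  · intro x
    have l0 : Integrable H₀ := integrable_profileInt hφ hm₀ hF.measL2 hG.measL2 hwm hwi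
    have l1 : Integrable H₁ := integrable_profileInt hφ hm₁ hF.measL2 hG.measL2 hvm hvi
    have l2 : Integrable H₂ := integrable_profileInt hφ hm₂ hF.measL2' hG.measL2 hvm hvi
    have l3 : Integrable H₃ := integrable_profileInt hφ hm₂ hF.measL2 hG.measL2' hvm hvi
    have l2n : Integrable (fun ξ => -H₂ ξ) := l2.neg
    have l23 : Integrable (fun ξ => -H₂ ξ + H₃ ξ) := l2n.add l3
    have l123 : Integrable (fun ξ => H₁ ξ + (-H₂ ξ + H₃ ξ)) := l1.add l23
    have hac := h.smooth_a.continuous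
    obtain ⟨q1, q2⟩ := initialWeight_dispersive hR0.le hRt
    obtain ⟨r1, r2⟩ := tailWeight_dispersive hR hRt
    have hlog : 0 ≤ Real.log t := Real.log_nonneg (hR.trans hRt)
    have hs : 0 < Real.sqrt t := Real.sqrt_pos.2 ht
    set L := (Real.log t + 1) / Real.sqrt t with hL
    have hL0 : 0 ≤ L := by positivity
    have s0 := d0 t x (fun τ hτ => initialWeight_eq_zero (hRt.trans hτ)) q1
    have s1 := d1 t x (fun τ hτ => tailWeight_eq_zero hτ) r1
    have s2 := d2 t x (fun τ hτ => tailWeight_eq_zero hτ) r1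
    have s3 := d3 t x (fun τ hτ => tailWeight_eq_zero hτ) r1
    have hv : ∀ {C Z : ℝ}, 0 ≤ C → 0 ≤ Z → Z ≤ R * (X * Y) →
        C * (∫ τ, ‖tailWeight R t τ‖ * (Real.sqrt (t - τ))⁻¹) * Z
          ≤ C * (4 * L) * (R * (X * Y)) := by
      intro C Z hC hZ0 hZ
      have : (2 * Real.log t + 4) / Real.sqrt t ≤ 4 * L := by
        rw [hL, ← mul_div_assoc]
        gcongr
        linarith
      have := r2.trans this
      gcongr
    have b0 : C₀ * (∫ τ, ‖initialWeight R τ‖ * (Real.sqrt (t - τ))⁻¹) * (nrm F * nrm G)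
        ≤ C₀ * (2 * R * L) * (X * Y) := by
      have h1 : 2 * R / Real.sqrt t ≤ 2 * R * L := by
        rw [hL, ← mul_div_assoc]
        exact div_le_div_of_nonneg_right (by nlinarith [mul_nonneg hR0.le hlog]) hs.le
      have := q2.trans h1
      have := mul_nonneg (nrm_nonneg F) (nrm_nonneg G)
      gcongr
    have b1 := hv hC₁ (mul_nonneg (nrm_nonneg F) (nrm_nonneg G)) hFG1
    have b2 := hv hC₂ (mul_nonneg (nrm_nonneg F') (nrm_nonneg G)) hF'G
    have b3 := hv hC₂ (mul_nonneg (nrm_nonneg F) (nrm_nonneg G')) hFG'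
    rw [evolve_add hac t x l0 l123, evolve_add hac t x l1 l23, evolve_add hac t x l2n l3, evolve_neg]
    have n1 := norm_add_le (evolve a t H₀ x) (evolve a t H₁ x + (-evolve a t H₂ x + evolve a t H₃ x))
    have n2 := norm_add_le (evolve a t H₁ x) (-evolve a t H₂ x + evolve a t H₃ x)
    have n3 := norm_add_le (-evolve a t H₂ x) (evolve a t H₃ x)
    rw [norm_neg] at n3
    have e : (2 * C₀ + 4 * C₁ + 8 * C₂) * (R * (Real.log t + 1) / Real.sqrt t) * (X * Y)
        = C₀ * (2 * R * L) * (X * Y) + C₁ * (4 * L) * (R * (X * Y))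
          + 2 * (C₂ * (4 * L) * (R * (X * Y))) := by rw [hL]; ring
    rw [e]
    linarith

end

/-! ### Weak solutions -/

/-- A test function evolved backwards by the free flow. -/
def flowTest (p : ℝ → ℝ) (χ : ℝ → ℂ) (t ξ : ℝ) : ℂ :=
  Complex.exp (Complex.I * ((-(t * p ξ) : ℝ) : ℂ)) * χ ξ

theorem measL2_hat (f : L2) : MeasL2 (hat f) := ⟨measurable_hat f, memLp_hat f⟩

theorem nrm_hat_sub (f g : L2) : nrm (fun ξ => hat f ξ - hat g ξ) = ‖f - g‖ := by
  have h := eLpNorm_hat (f - g)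
  rw [eLpNorm_congr_ae (hat_sub f g)] at h
  rw [Lp.norm_def, ← h]
  rfl

theorem norm_cexp_I_sub_le (α β : ℝ) :
    ‖Complex.exp (Complex.I * (α : ℂ)) - Complex.exp (Complex.I * (β : ℂ))‖ ≤ |α - β| := by
  have e : Complex.exp (Complex.I * (α : ℂ)) - Complex.exp (Complex.I * (β : ℂ))
      = Complex.exp (Complex.I * (β : ℂ)) * (Complex.exp (Complex.I * ((α - β : ℝ) : ℂ)) - 1) := by
    rw [mul_sub, ← Complex.exp_add, mul_one]
    congr 2
    push_cast; ring
  rw [e, norm_mul, norm_cexp_I, one_mul]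
  exact Real.norm_exp_I_mul_ofReal_sub_one_le

section

variable {p : ℝ → ℝ} {χ : ℝ → ℂ}

theorem contDiff_flowTest (hp : ContDiff ℝ (⊤ : ℕ∞) p) (hχ : ContDiff ℝ (⊤ : ℕ∞) χ) (t : ℝ) :
    ContDiff ℝ (⊤ : ℕ∞) (flowTest p χ t) :=
  (contDiff_const.mul (Complex.ofRealCLM.contDiff.comp
    (contDiff_const.mul hp).neg)).cexp.mul hχ

theorem hasCompactSupport_flowTest (hχ : HasCompactSupport χ) (t : ℝ) :
    HasCompactSupport (flowTest p χ t) := hχ.mul_left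

/-- The weak equation in the interaction picture. -/
theorem IsWeakSolution.hasDerivAt_flowTest {N : ℝ → ℝ → ℂ} {u₀ : L2} {u : ℝ → L2}
    (hu : IsWeakSolution p N u₀ u) (hp : ContDiff ℝ (⊤ : ℕ∞) p) (hχ : ContDiff ℝ (⊤ : ℕ∞) χ)
    (hχc : HasCompactSupport χ) (t : ℝ) :
    HasDerivAt (fun τ => ∫ ξ, hat (u τ) ξ * flowTest p χ τ ξ)
      (-Complex.I * ∫ ξ, N t ξ * flowTest p χ t ξ) t := by
  have hpc : Continuous p := hp.continuous
  have hT : ∀ τ, MemLp (flowTest p χ τ) 2 := fun τ =>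
    (contDiff_flowTest hp hχ τ).continuous.memLp_of_hasCompactSupport
      (hasCompactSupport_flowTest hχc τ)
  have hpχc : HasCompactSupport (fun ξ => (p ξ : ℂ) * χ ξ) := hχc.mul_left
  have hpχ : MemLp (fun ξ => (p ξ : ℂ) * χ ξ) 2 :=
    (by have := hχ.continuous; fun_prop : Continuous fun ξ => (p ξ : ℂ) * χ ξ).memLp_of_hasCompactSupport
      hpχc
  have hint : ∀ σ τ, Integrable (fun ξ => hat (u σ) ξ * flowTest p χ τ ξ) := fun σ τ =>
    (integrable_mul_and_le (memLp_hat (u σ)) (hT τ)).1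
  -- The weak equation only admits test functions independent of time, so it is applied with the
  -- evolved test function frozen at `t`; a product rule then accounts for its motion.
  obtain ⟨d, hd, hdeq⟩ := hu.equation (flowTest p χ t) (contDiff_flowTest hp hχ t)
    (hasCompactSupport_flowTest hχc t) t
  -- the explicit time dependence
  have h2 : HasDerivAt (fun τ => ∫ ξ, hat (u t) ξ * flowTest p χ τ ξ)
      (∫ ξ, hat (u t) ξ * (flowTest p χ t ξ * (Complex.I * ((-p ξ : ℝ) : ℂ)))) t := by
    refine (hasDerivAt_integral_of_dominated_loc_of_deriv_le
      (F := fun τ ξ => hat (u t) ξ * flowTest p χ τ ξ)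
      (F' := fun τ ξ => hat (u t) ξ * (flowTest p χ τ ξ * (Complex.I * ((-p ξ : ℝ) : ℂ))))
      (bound := fun ξ => ‖hat (u t) ξ * ((p ξ : ℂ) * χ ξ)‖) Filter.univ_mem
      (Filter.Eventually.of_forall fun τ => (hint t τ).1) (hint t t) ?_ ?_ ?_ ?_).2
    · refine ((measurable_hat (u t)).mul
        ((contDiff_flowTest hp hχ t).continuous.measurable.mul ?_)).aestronglyMeasurable
      exact (by fun_prop : Continuous fun ξ => Complex.I * ((-p ξ : ℝ) : ℂ)).measurable
    · refine Filter.Eventually.of_forall fun ξ τ _ => le_of_eq ?_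
      simp only [flowTest, norm_mul, norm_cexp_I, Complex.norm_I, Complex.norm_real, norm_neg]
      ring
    · exact (integrable_mul_and_le (memLp_hat (u t)) hpχ).1.norm
    · refine Filter.Eventually.of_forall fun ξ τ _ => ?_
      have h := (hasDerivAt_cexp_I (((hasDerivAt_id' τ).mul_const (p ξ)).fun_neg)).mul_const (χ ξ)
      refine (h.const_mul (hat (u t) ξ)).congr_deriv ?_
      simp only [flowTest]
      push_cast; ring
  -- the remainder
  set r : ℝ → ℂ := fun τ => ∫ ξ, (hat (u τ) ξ - hat (u t) ξ)
    * (flowTest p χ τ ξ - flowTest p χ t ξ) with hr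
  -- The remainder pairs two increments: that of `u` tends to zero by continuity, that of the test
  -- function is Lipschitz in time, so the remainder is o(|τ - t|).
  have hrb : ∀ τ, ‖r τ‖ ≤ ‖u τ - u t‖ * (|τ - t| * nrm (fun ξ => (p ξ : ℂ) * χ ξ)) := by
    intro τ
    obtain ⟨-, h⟩ := integrable_mul_and_le ((memLp_hat (u τ)).sub (memLp_hat (u t)))
      ((hT τ).sub (hT t))
    refine (norm_integral_le_integral_norm _).trans (h.trans ?_)
    change nrm (fun ξ => hat (u τ) ξ - hat (u t) ξ) * nrm _ ≤ _
    rw [nrm_hat_sub]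
    refine mul_le_mul_of_nonneg_left (nrm_le_of_norm_le hpχ (abs_nonneg _) fun ξ => ?_)
      (norm_nonneg _)
    simp only [Pi.sub_apply, flowTest]
    rw [← sub_mul, norm_mul, norm_mul, Complex.norm_real, ← mul_assoc]
    refine mul_le_mul_of_nonneg_right ((norm_cexp_I_sub_le _ _).trans_eq ?_) (norm_nonneg _)
    rw [Real.norm_eq_abs, ← abs_mul, ← abs_neg]
    congr 1; ring
  have h3 : HasDerivAt r 0 t := by
    rw [hasDerivAt_iff_isLittleO]
    have hrt : r t = 0 := by simp [hr]
    simp only [hrt, sub_zero, smul_zero]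
    rw [Asymptotics.isLittleO_iff]
    intro ε hε
    set K := nrm (fun ξ => (p ξ : ℂ) * χ ξ) with hK
    have hK0 : 0 ≤ K := nrm_nonneg _
    have hcont := hu.continuous.tendsto t
    rw [Metric.tendsto_nhds] at hcont
    filter_upwards [hcont (ε / (K + 1)) (by positivity)] with τ hτ
    rw [dist_eq_norm] at hτ
    refine (hrb τ).trans ?_
    rw [Real.norm_eq_abs]
    have h1 : ‖u τ - u t‖ * K ≤ ε := by
      calc _ ≤ ε / (K + 1) * (K + 1) := by
            have := norm_nonneg (u τ - u t)
            gcongr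
            linarith
        _ = ε := by field_simp
    calc _ = (‖u τ - u t‖ * K) * |τ - t| := by ring
      _ ≤ _ := mul_le_mul_of_nonneg_right h1 (abs_nonneg _)
  have hsum : (fun τ => ∫ ξ, hat (u τ) ξ * flowTest p χ τ ξ)
      = fun τ => (∫ ξ, hat (u τ) ξ * flowTest p χ t ξ)
        + ((∫ ξ, hat (u t) ξ * flowTest p χ τ ξ) + r τ)
        - ∫ ξ, hat (u t) ξ * flowTest p χ t ξ := by
    funext τ
    have e : r τ = (∫ ξ, hat (u τ) ξ * flowTest p χ τ ξ) - (∫ ξ, hat (u τ) ξ * flowTest p χ t ξ)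
        + (∫ ξ, hat (u t) ξ * flowTest p χ t ξ)
        + (-1) * ∫ ξ, hat (u t) ξ * flowTest p χ τ ξ := by
      rw [← integral_sub_add_add_mul (hint τ τ) (hint τ t) (hint t t) (hint t τ)]
      simp only [hr]
      congr 1; funext ξ; ring
    rw [e]; ring
  rw [hsum]
  refine ((hd.add (h2.add h3)).sub_const _).congr_deriv ?_
  have e2 : ∫ ξ, hat (u t) ξ * (flowTest p χ t ξ * (Complex.I * ((-p ξ : ℝ) : ℂ)))
      = -Complex.I * ∫ ξ, (p ξ : ℂ) * hat (u t) ξ * flowTest p χ t ξ := by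
    rw [← integral_const_mul]
    congr 1; funext ξ; push_cast; ring
  rw [e2, ← hdeq, add_zero]
  linear_combination d * Complex.I_sq

/-- Turns an identity tested in the interaction picture into a formula for the transform: test
functions separate, and the unimodular flow factor can be inverted. -/
theorem ae_eq_of_forall_flowTest {h k : ℝ → ℂ} (hp : Continuous p) (hh : MemLp h 2) (hk : MemLp k 2)
    (t : ℝ) (heq : ∀ χ : ℝ → ℂ, ContDiff ℝ (⊤ : ℕ∞) χ → HasCompactSupport χ →
      ∫ ξ, h ξ * flowTest p χ t ξ = ∫ ξ, k ξ * χ ξ) :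
    h =ᵐ[volume] fun ξ => Complex.exp (Complex.I * ((t * p ξ : ℝ) : ℂ)) * k ξ := by
  have hec : Continuous fun ξ => Complex.exp (Complex.I * ((-(t * p ξ) : ℝ) : ℂ)) := by fun_prop
  have hmul : MemLp (fun ξ => Complex.exp (Complex.I * ((-(t * p ξ) : ℝ) : ℂ)) * h ξ) 2 :=
    hh.of_le (hec.aestronglyMeasurable.mul hh.1) (Filter.Eventually.of_forall fun ξ => by
      rw [norm_mul, norm_cexp_I, one_mul])
  have := ae_eq_of_integral_contDiff_smul_eq (hmul.locallyIntegrable (by norm_num))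
    (hk.locallyIntegrable (by norm_num)) (fun g hg hgc => by
      have h1 := heq (fun x => (g x : ℂ)) (Complex.ofRealCLM.contDiff.comp hg)
        (hgc.comp_left (g := fun x : ℝ => (x : ℂ)) (by simp))
      simp only [Complex.real_smul]
      simp only [flowTest] at h1
      calc _ = _ := by congr 1; funext ξ; ring
        _ = _ := h1
        _ = _ := by congr 1; funext ξ; ring)
  filter_upwards [this] with ξ hξ
  rw [← hξ, ← mul_assoc, ← Complex.exp_add, ← mul_add, ← Complex.ofReal_add, add_neg_cancel]
  simp

theorem flowTest_zero (p : ℝ → ℝ) (χ : ℝ → ℂ) : flowTest p χ 0 = χ := by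
  funext ξ; simp [flowTest]

/-- Free solutions are given by the propagator. -/
theorem IsWeakSolution.hat_eq_of_free {f : L2} {v : ℝ → L2}
    (hv : IsWeakSolution p (fun _ _ => 0) f v) (hp : ContDiff ℝ (⊤ : ℕ∞) p) (t : ℝ) :
    hat (v t) =ᵐ[volume] fun ξ => Complex.exp (Complex.I * ((t * p ξ : ℝ) : ℂ)) * hat f ξ := by
  refine ae_eq_of_forall_flowTest hp.continuous (memLp_hat _) (memLp_hat _) t fun χ hχ hχc => ?_
  have hd := fun τ => hv.hasDerivAt_flowTest hp hχ hχc τ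
  simp only [zero_mul, integral_zero, mul_zero] at hd
  have hconst := is_const_of_deriv_eq_zero (fun τ => (hd τ).differentiableAt)
    (fun τ => (hd τ).deriv) t 0
  rw [hconst, hv.initial, flowTest_zero]

end

/-- Duhamel's formula for the solution of the system. -/
theorem IsSystemSolution.hat_eq_duhamel {a b c : ℝ → ℝ} {m : ℝ × ℝ → ℂ} (h : Setting a b c m)
    {f g : L2} {u v w : ℝ → L2} (hs : IsSystemSolution a b c m f g u v w) {t : ℝ} (ht : 0 ≤ t) :
    hat (u t) =ᵐ[volume] fun ξ => Complex.exp (Complex.I * ((t * a ξ : ℝ) : ℂ))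
      * (-Complex.I * duhamel a b c m t (hat f) (hat g) ξ) := by
  obtain ⟨A, M, -, hm, -⟩ := exists_isSymbol h.smooth_m h.compact_m
  have hF := measL2_hat f
  have hG := measL2_hat g
  have hprof := measurable_profile h.continuous_phase hm hF hG
  refine ae_eq_of_forall_flowTest h.smooth_a.continuous (memLp_hat _)
    ((h.measL2_duhamel t hF hG).1.memLp.const_mul _) t fun χ hχ hχc => ?_
  have hχi : Integrable χ := hχ.continuous.integrable_of_hasCompactSupport hχc
  -- Substituting the free solutions for `v` and `w`, the backward flow of the test function
  -- supplies the term -a of the phase, and the forcing becomes the profile.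
  have hN : ∀ τ, ∫ ξ, pseudoProductHat m (v τ) (w τ) ξ * flowTest a χ τ ξ
      = ∫ ξ, χ ξ * profile (phase a b c) m (hat f) (hat g) τ ξ := by
    intro τ
    congr 1; funext ξ
    have hv := (Measure.measurePreserving_sub_left volume ξ).quasiMeasurePreserving.ae
      (hs.eq_v.hat_eq_of_free h.smooth_b τ)
    have hw := hs.eq_w.hat_eq_of_free h.smooth_c τ
    simp only [pseudoProductHat, flowTest, profile]
    rw [← integral_mul_const, ← integral_const_mul]
    apply integral_congr_ae
    filter_upwards [hv, hw] with η h1 h2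
    rw [h1, h2]
    have hexp : Complex.exp (Complex.I * ((τ * phase a b c (ξ - η) η : ℝ) : ℂ))
        = Complex.exp (Complex.I * ((-(τ * a ξ) : ℝ) : ℂ))
          * Complex.exp (Complex.I * ((τ * b (ξ - η) : ℝ) : ℂ))
          * Complex.exp (Complex.I * ((τ * c η : ℝ) : ℂ)) := by
      simp only [← Complex.exp_add, phase, sub_add_cancel]
      congr 1
      push_cast; ring
    rw [hexp]; ring
  have hd : ∀ τ, HasDerivAt (fun τ => ∫ ξ, hat (u τ) ξ * flowTest a χ τ ξ)
      (-Complex.I * ∫ ξ, χ ξ * profile (phase a b c) m (hat f) (hat g) τ ξ) τ := fun τ => by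
    rw [← hN]
    exact hs.eq_u.hasDerivAt_flowTest h.smooth_a hχ hχc τ
  set B : ℝ := M * (nrm (hat f) * nrm (hat g)) with hB
  have hbd : ∀ τ ξ, ‖χ ξ * profile (phase a b c) m (hat f) (hat g) τ ξ‖ ≤ ‖χ ξ‖ * B :=
    fun τ ξ => by
      rw [norm_mul]
      exact mul_le_mul_of_nonneg_left (norm_profile_le hm hF hG τ ξ) (norm_nonneg _)
  have hmeas2 : Measurable (fun p : ℝ × ℝ =>
      χ p.2 * profile (phase a b c) m (hat f) (hat g) p.1 p.2) :=
    (hχ.continuous.measurable.comp measurable_snd).mul hprof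
  -- For the fundamental theorem of calculus a bounded measurable derivative suffices; continuity in
  -- time of the profile is not needed.
  have hint : IntervalIntegrable (fun τ => -Complex.I * ∫ ξ, χ ξ
      * profile (phase a b c) m (hat f) (hat g) τ ξ) volume 0 t := by
    rw [intervalIntegrable_iff]
    refine Integrable.const_mul ?_ _
    refine Measure.integrableOn_of_bounded (M := ∫ ξ, ‖χ ξ‖ * B) (by simp)
      hmeas2.stronglyMeasurable.integral_prod_right.aestronglyMeasurable
      (Filter.Eventually.of_forall fun τ => norm_integral_le_of_norm_le (hχi.norm.mul_const B)
        (Filter.Eventually.of_forall fun ξ => hbd τ ξ))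
  have hftc := intervalIntegral.integral_eq_sub_of_hasDerivAt (fun τ _ => hd τ) hint
  have h0 : ∫ ξ, hat (u 0) ξ * flowTest a χ 0 ξ = 0 := by
    rw [hs.eq_u.initial, ← integral_zero ℝ ℂ (μ := volume)]
    apply integral_congr_ae
    filter_upwards [hat_zero] with ξ hξ
    rw [hξ]; simp
  rw [h0, sub_zero] at hftc
  rw [← hftc, intervalIntegral.integral_of_le ht, integral_const_mul, integral_Ioc_eq_integral_Ioo,
    integral_integral_swap]
  · rw [← integral_const_mul]
    congr 1; funext ξ
    rw [integral_const_mul, duhamel, profileInt]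
    have e : ∫ τ, initialWeight t τ * profile (phase a b c) m (hat f) (hat g) τ ξ
        = ∫ τ in Set.Ioo 0 t, profile (phase a b c) m (hat f) (hat g) τ ξ := by
      rw [← integral_indicator measurableSet_Ioo]
      congr 1; funext τ
      simp only [initialWeight, Set.indicator_apply]
      split_ifs <;> simp
    rw [e]; ring
  · have hdom : Integrable (fun p : ℝ × ℝ => (1 : ℂ) * (χ p.2 * (B : ℂ)))
        ((volume.restrict (Set.Ioo 0 t)).prod volume) :=
      (integrable_const (1 : ℂ)).mul_prod (hχi.mul_const (B : ℂ))
    refine hdom.mono hmeas2.aestronglyMeasurable (Filter.Eventually.of_forall fun p => ?_)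
    refine (hbd p.1 p.2).trans (le_of_eq ?_)
    rw [one_mul, norm_mul, Complex.norm_real, Real.norm_of_nonneg
      (mul_nonneg hm.bound_nonneg (mul_nonneg (nrm_nonneg _) (nrm_nonneg _)))]

/-! ### Interpolation between `L²` and `L^∞` -/

theorem inv_toReal_le_half {q : ℝ≥0∞} (hq : 2 ≤ q) : (q⁻¹).toReal ≤ 1 / 2 := by
  have h := ENNReal.toReal_mono (by simp) (ENNReal.inv_le_inv.2 hq)
  simpa using h

theorem ofReal_nrm {h : ℝ → ℂ} (hh : MemLp h 2) : ENNReal.ofReal (nrm h) = eLpNorm h 2 volume :=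
  ENNReal.ofReal_toReal hh.2.ne

/-- For finite q, |h|^q ≤ B^{q-2} |h|² pointwise, and q-th roots are taken after integrating. -/
theorem eLpNorm_le_interpolation {h : ℝ → ℂ} (hh : MemLp h 2) {q : ℝ≥0∞} (hq : 2 ≤ q) {A B : ℝ}
    (hB : 0 ≤ B) (hA2 : nrm h ≤ A) (hb : ∀ x, ‖h x‖ ≤ B) :
    eLpNorm h q volume
      ≤ ENNReal.ofReal (A ^ (2 * (q⁻¹).toReal) * B ^ (1 - 2 * (q⁻¹).toReal)) := by
  have hA : 0 ≤ A := (nrm_nonneg h).trans hA2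
  rcases eq_or_ne q ∞ with rfl | hqt
  · simp only [ENNReal.inv_top, ENNReal.toReal_zero, mul_zero, sub_zero, Real.rpow_zero,
      Real.rpow_one, one_mul]
    rw [eLpNorm_exponent_top]
    exact eLpNormEssSup_le_of_ae_bound (Filter.Eventually.of_forall hb)
  have hq0 : q ≠ 0 := fun h0 => by rw [h0] at hq; simp at hq
  set Q := q.toReal with hQ
  have hQ2 : 2 ≤ Q := by simpa using ENNReal.toReal_mono hqt hq
  have hr : (q⁻¹).toReal = Q⁻¹ := ENNReal.toReal_inv q
  have hQ0 : 0 < Q := by linarith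
  rw [eLpNorm_eq_lintegral_rpow_enorm_toReal hq0 hqt, hr]
  have h1 : ∫⁻ x, ‖h x‖ₑ ^ Q ≤ ENNReal.ofReal B ^ (Q - 2) * ENNReal.ofReal A ^ (2 : ℝ) := by
    calc ∫⁻ x, ‖h x‖ₑ ^ Q ≤ ∫⁻ x, ENNReal.ofReal B ^ (Q - 2) * ‖h x‖ₑ ^ 2 := by
          refine lintegral_mono fun x => ?_
          have e : ‖h x‖ₑ ^ Q = ‖h x‖ₑ ^ (Q - 2) * ‖h x‖ₑ ^ 2 := by
            rw [← ENNReal.rpow_ofNat, ← ENNReal.rpow_add_of_nonneg _ _ (by linarith) (by norm_num)]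
            norm_num
          show ‖h x‖ₑ ^ Q ≤ _
          rw [e]
          gcongr
          rw [← ofReal_norm]
          exact ENNReal.ofReal_le_ofReal (hb x)
      _ = ENNReal.ofReal B ^ (Q - 2) * eLpNorm h 2 volume ^ 2 := by
          rw [lintegral_const_mul' _ _
            (ENNReal.rpow_ne_top_of_nonneg (by linarith) ENNReal.ofReal_ne_top), eLpNorm_two_sq]
      _ ≤ _ := by
          rw [← ofReal_nrm hh, ENNReal.rpow_ofNat]
          gcongr
  calc _ ≤ (ENNReal.ofReal B ^ (Q - 2) * ENNReal.ofReal A ^ (2 : ℝ)) ^ (1 / Q) := by gcongr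
    _ = ENNReal.ofReal A ^ (2 * Q⁻¹) * ENNReal.ofReal B ^ (1 - 2 * Q⁻¹) := by
        rw [ENNReal.mul_rpow_of_nonneg _ _ (by positivity), ← ENNReal.rpow_mul, ← ENNReal.rpow_mul,
          mul_comm]
        congr 2
        · ring
        · field_simp
    _ = _ := by
        have h2 : 2 * Q⁻¹ ≤ 1 := by
          rw [← div_eq_mul_inv, div_le_one hQ0]; exact hQ2
        rw [ENNReal.ofReal_rpow_of_nonneg hA (by positivity),
          ENNReal.ofReal_rpow_of_nonneg hB (by linarith), ← ENNReal.ofReal_mul (by positivity)]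

/-! ### Bilinearity of the Duhamel term -/

/-- The Duhamel term in physical space. -/
def duhamelSol (a b c : ℝ → ℝ) (m : ℝ × ℝ → ℂ) (t : ℝ) (F G : ℝ → ℂ) : ℝ → ℂ :=
  invHat fun ξ => Complex.exp (Complex.I * ((t * a ξ : ℝ) : ℂ))
    * (-Complex.I * duhamel a b c m t F G ξ)

theorem MeasL2.add {F G : ℝ → ℂ} (hF : MeasL2 F) (hG : MeasL2 G) : MeasL2 (fun x => F x + G x) :=
  ⟨hF.meas.add hG.meas, hF.memLp.add hG.memLp⟩

section

variable {a b c : ℝ → ℝ} {m : ℝ × ℝ → ℂ}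

theorem Setting.duhamel_add_left (h : Setting a b c m) (t : ℝ) {F₁ F₂ G : ℝ → ℂ} (h₁ : MeasL2 F₁)
    (h₂ : MeasL2 F₂) (hG : MeasL2 G) (ξ : ℝ) :
    duhamel a b c m t (fun x => F₁ x + F₂ x) G ξ
      = duhamel a b c m t F₁ G ξ + duhamel a b c m t F₂ G ξ := by
  obtain ⟨A, M, -, hm, -⟩ := exists_isSymbol h.smooth_m h.compact_m
  have hw := measurable_initialWeight t
  have hi := integrable_initialWeight t
  have hφ := h.continuous_phase
  simp only [duhamel, profileInt]
  rw [← integral_add (integrable_mul_profile hφ hm h₁ hG hw hi ξ)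
    (integrable_mul_profile hφ hm h₂ hG hw hi ξ)]
  congr 1; funext τ
  rw [← mul_add]
  congr 1
  simp only [profile]
  rw [← integral_add (integrable_profile_integrand hφ hm h₁ hG τ ξ)
    (integrable_profile_integrand hφ hm h₂ hG τ ξ)]
  congr 1; funext η; ring

theorem Setting.duhamel_add_right (h : Setting a b c m) (t : ℝ) {F G₁ G₂ : ℝ → ℂ} (hF : MeasL2 F)
    (h₁ : MeasL2 G₁) (h₂ : MeasL2 G₂) (ξ : ℝ) :
    duhamel a b c m t F (fun x => G₁ x + G₂ x) ξ
      = duhamel a b c m t F G₁ ξ + duhamel a b c m t F G₂ ξ := by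
  obtain ⟨A, M, -, hm, -⟩ := exists_isSymbol h.smooth_m h.compact_m
  have hw := measurable_initialWeight t
  have hi := integrable_initialWeight t
  have hφ := h.continuous_phase
  simp only [duhamel, profileInt]
  rw [← integral_add (integrable_mul_profile hφ hm hF h₁ hw hi ξ)
    (integrable_mul_profile hφ hm hF h₂ hw hi ξ)]
  congr 1; funext τ
  rw [← mul_add]
  congr 1
  simp only [profile]
  rw [← integral_add (integrable_profile_integrand hφ hm hF h₁ τ ξ)
    (integrable_profile_integrand hφ hm hF h₂ τ ξ)]
  congr 1; funext η; ring

theorem Setting.integrable_flow_duhamel (h : Setting a b c m) (t : ℝ) {F G : ℝ → ℂ} (hF : MeasL2 F)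
    (hG : MeasL2 G) :
    Integrable (fun ξ => Complex.exp (Complex.I * ((t * a ξ : ℝ) : ℂ))
      * (-Complex.I * duhamel a b c m t F G ξ)) ∧
    MemLp (fun ξ => Complex.exp (Complex.I * ((t * a ξ : ℝ) : ℂ))
      * (-Complex.I * duhamel a b c m t F G ξ)) 2 := by
  obtain ⟨h1, h2⟩ := h.measL2_duhamel t hF hG
  have hac := h.smooth_a.continuous
  have hc : Continuous fun ξ => Complex.exp (Complex.I * ((t * a ξ : ℝ) : ℂ)) := by fun_prop
  have hn : ∀ ξ, ‖Complex.exp (Complex.I * ((t * a ξ : ℝ) : ℂ))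
      * (-Complex.I * duhamel a b c m t F G ξ)‖ ≤ ‖duhamel a b c m t F G ξ‖ := fun ξ => by
    rw [norm_mul, norm_cexp_I, norm_mul, norm_neg, Complex.norm_I, one_mul, one_mul]
  have hm := hc.aestronglyMeasurable.mul (h2.1.const_mul (-Complex.I))
  exact ⟨h2.mono hm (Filter.Eventually.of_forall hn),
    h1.memLp.of_le hm (Filter.Eventually.of_forall hn)⟩

theorem invHat_add {f g : ℝ → ℂ} (hf : Integrable f) (hg : Integrable g) :
    invHat (fun ξ => f ξ + g ξ) = fun x => invHat f x + invHat g x := by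
  funext x
  have hx : ∀ {f : ℝ → ℂ}, Integrable f →
      Integrable (fun ξ : ℝ => Complex.exp (Complex.I * ((x * ξ : ℝ) : ℂ)) * f ξ) := by
    intro f hf
    have hc : Continuous fun ξ : ℝ => Complex.exp (Complex.I * ((x * ξ : ℝ) : ℂ)) := by fun_prop
    exact hf.mono (hc.aestronglyMeasurable.mul hf.1) (Filter.Eventually.of_forall fun ξ => by
      rw [norm_mul, norm_cexp_I, one_mul])
  simp only [invHat_eq_integral]
  rw [← mul_add, ← integral_add (hx hf) (hx hg)]
  congr 2; funext ξ; ring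

theorem Setting.eLpNorm_duhamelSol_add_left (h : Setting a b c m) {q : ℝ≥0∞} (hq : 1 ≤ q) (t : ℝ)
    {F₁ F₂ G : ℝ → ℂ} (h₁ : MeasL2 F₁) (h₂ : MeasL2 F₂) (hG : MeasL2 G) :
    eLpNorm (duhamelSol a b c m t (fun x => F₁ x + F₂ x) G) q volume
      ≤ eLpNorm (duhamelSol a b c m t F₁ G) q volume
        + eLpNorm (duhamelSol a b c m t F₂ G) q volume := by
  have i1 := (h.integrable_flow_duhamel t h₁ hG).1
  have i2 := (h.integrable_flow_duhamel t h₂ hG).1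
  have e : duhamelSol a b c m t (fun x => F₁ x + F₂ x) G
      = duhamelSol a b c m t F₁ G + duhamelSol a b c m t F₂ G := by
    refine Eq.trans ?_ (invHat_add i1 i2)
    simp only [duhamelSol, h.duhamel_add_left t h₁ h₂ hG, mul_add]
  rw [e]
  exact eLpNorm_add_le (continuous_invHat i1).aestronglyMeasurable
    (continuous_invHat i2).aestronglyMeasurable hq

theorem Setting.eLpNorm_duhamelSol_add_right (h : Setting a b c m) {q : ℝ≥0∞} (hq : 1 ≤ q) (t : ℝ)
    {F G₁ G₂ : ℝ → ℂ} (hF : MeasL2 F) (h₁ : MeasL2 G₁) (h₂ : MeasL2 G₂) :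
    eLpNorm (duhamelSol a b c m t F (fun x => G₁ x + G₂ x)) q volume
      ≤ eLpNorm (duhamelSol a b c m t F G₁) q volume
        + eLpNorm (duhamelSol a b c m t F G₂) q volume := by
  have i1 := (h.integrable_flow_duhamel t hF h₁).1
  have i2 := (h.integrable_flow_duhamel t hF h₂).1
  have e : duhamelSol a b c m t F (fun x => G₁ x + G₂ x)
      = duhamelSol a b c m t F G₁ + duhamelSol a b c m t F G₂ := by
    refine Eq.trans ?_ (invHat_add i1 i2)
    simp only [duhamelSol, h.duhamel_add_right t hF h₁ h₂, mul_add]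
  rw [e]
  exact eLpNorm_add_le (continuous_invHat i1).aestronglyMeasurable
    (continuous_invHat i2).aestronglyMeasurable hq

/-- `L^q` bounds for the Duhamel term from `L²` and dispersive bounds on its transform. -/
theorem Setting.eLpNorm_duhamelSol_le (h : Setting a b c m) {q : ℝ≥0∞} (hq : 2 ≤ q) (t : ℝ)
    {F G : ℝ → ℂ} (hF : MeasL2 F) (hG : MeasL2 G) {Z A B : ℝ} (hZ : 0 ≤ Z) (hA : 0 ≤ A)
    (hB : 0 ≤ B) (h2 : nrm (duhamel a b c m t F G) ≤ A * Z)
    (hinf : ∀ x, ‖evolve a t (duhamel a b c m t F G) x‖ ≤ B * Z) :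
    eLpNorm (duhamelSol a b c m t F G) q volume
      ≤ ENNReal.ofReal (A ^ (2 * (q⁻¹).toReal) * B ^ (1 - 2 * (q⁻¹).toReal) * Z) := by
  obtain ⟨i1, i2⟩ := h.integrable_flow_duhamel t hF hG
  have hr := inv_toReal_le_half hq
  have hr0 : 0 ≤ (q⁻¹).toReal := ENNReal.toReal_nonneg
  have hmem : MemLp (duhamelSol a b c m t F G) 2 :=
    ⟨(continuous_invHat i1).aestronglyMeasurable, by
      rw [duhamelSol, eLpNorm_invHat i1 i2]; exact i2.2⟩
  have hn : nrm (duhamelSol a b c m t F G) ≤ A * Z := by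
    refine le_trans ?_ h2
    unfold nrm
    rw [duhamelSol, eLpNorm_invHat i1 i2]
    have := nrm_le_of_norm_le (h.measL2_duhamel t hF hG).1.memLp zero_le_one (F := fun ξ =>
      Complex.exp (Complex.I * ((t * a ξ : ℝ) : ℂ)) * (-Complex.I * duhamel a b c m t F G ξ))
      (fun ξ => by
        rw [norm_mul, norm_cexp_I, norm_mul, norm_neg, Complex.norm_I, one_mul])
    rwa [one_mul] at this
  have hpt : ∀ x, ‖duhamelSol a b c m t F G x‖ ≤ B * Z := by
    intro x
    refine le_trans ?_ (hinf x)
    have e : duhamelSol a b c m t F G x = (((Real.sqrt (2 * Real.pi))⁻¹ : ℝ) : ℂ)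
        * (-Complex.I * evolve a t (duhamel a b c m t F G) x) := by
      rw [duhamelSol, invHat_eq_integral, evolve]
      congr 1
      rw [← integral_const_mul]
      congr 1; funext ξ; ring
    rw [e, norm_mul, norm_mul, norm_neg, Complex.norm_I, one_mul, Complex.norm_real,
      Real.norm_of_nonneg (inv_nonneg.2 (Real.sqrt_nonneg _))]
    -- The normalising constant (2π)^{-1/2} of `invHat` is at most 1 and is dropped.
    refine mul_le_of_le_one_left (norm_nonneg _) (inv_le_one_of_one_le₀ ?_)
    rw [Real.one_le_sqrt]
    linarith [Real.pi_gt_three]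
  refine (eLpNorm_le_interpolation hmem hq (by positivity) hn hpt).trans
    (ENNReal.ofReal_le_ofReal (le_of_eq ?_))
  -- The two interpolation exponents sum to 1, so the data norm `Z` comes out linearly.
  rw [Real.mul_rpow hA hZ, Real.mul_rpow hB hZ]
  have e : Z ^ (2 * (q⁻¹).toReal) * Z ^ (1 - 2 * (q⁻¹).toReal) = Z := by
    rw [← Real.rpow_add_of_nonneg hZ (by linarith) (by linarith)]
    norm_num
  calc _ = A ^ (2 * (q⁻¹).toReal) * B ^ (1 - 2 * (q⁻¹).toReal)
      * (Z ^ (2 * (q⁻¹).toReal) * Z ^ (1 - 2 * (q⁻¹).toReal)) := by ring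
    _ = _ := by rw [e]

/-- `L^q` bound for small times. -/
theorem Setting.exists_eLpNorm_duhamelSol_le_small (h : Setting a b c m) {q : ℝ≥0∞} (hq : 2 ≤ q) :
    ∃ C : ℝ, 0 ≤ C ∧ ∀ (t : ℝ) (F G : ℝ → ℂ), 0 < t → MeasL2 F → MeasL2 G →
      eLpNorm (duhamelSol a b c m t F G) q volume
        ≤ ENNReal.ofReal (C * t * (nrm F * nrm G)) := by
  obtain ⟨C, hC, hb⟩ := h.exists_duhamel_le_small
  refine ⟨C, hC, fun t F G ht hF hG => ?_⟩
  obtain ⟨h1, h2⟩ := hb t F G ht hF hG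
  have hr := inv_toReal_le_half hq
  have hr0 : 0 ≤ (q⁻¹).toReal := ENNReal.toReal_nonneg
  have hCt : 0 ≤ C * t := by positivity
  have := h.eLpNorm_duhamelSol_le hq t hF hG (mul_nonneg (nrm_nonneg _) (nrm_nonneg _)) hCt hCt h1 h2
  rwa [← Real.rpow_add_of_nonneg hCt (by linarith) (by linarith), add_sub_cancel,
    Real.rpow_one] at this

/-- `L^q` bound for general data. -/
theorem Setting.exists_eLpNorm_duhamelSol_le (h : Setting a b c m) {q : ℝ≥0∞} (hq : 2 ≤ q) :
    ∃ C : ℝ, 0 ≤ C ∧ ∀ (t : ℝ) (F G : ℝ → ℂ), 0 < t → MeasL2 F → MeasL2 G →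
      eLpNorm (duhamelSol a b c m t F G) q volume
        ≤ ENNReal.ofReal (C * t ^ (1 / 2 : ℝ) * (nrm F * nrm G)) := by
  obtain ⟨C, hC, hb⟩ := h.exists_duhamel_le
  refine ⟨C, hC, fun t F G ht hF hG => ?_⟩
  obtain ⟨h1, h2⟩ := hb t F G ht hF hG
  have hr := inv_toReal_le_half hq
  have hr0 : 0 ≤ (q⁻¹).toReal := ENNReal.toReal_nonneg
  have hCt : 0 ≤ C * Real.sqrt t := by positivity
  have := h.eLpNorm_duhamelSol_le hq t hF hG (mul_nonneg (nrm_nonneg _) (nrm_nonneg _)) hCt hCt h1 h2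
  rwa [← Real.rpow_add_of_nonneg hCt (by linarith) (by linarith), add_sub_cancel,
    Real.rpow_one, Real.sqrt_eq_rpow] at this

/-- `L^q` bound for localised data. -/
theorem Setting.exists_eLpNorm_duhamelSol_le_of_isLocalised (h : Setting a b c m) {q : ℝ≥0∞}
    (hq : 2 ≤ q) {δ : ℝ} (hδ : 0 < δ) :
    ∃ C : ℝ, 0 ≤ C ∧ ∀ (t R X Y : ℝ) (F F' G G' : ℝ → ℂ), 1 ≤ R → R ≤ t →
      IsLocalised F F' R X → IsLocalised G G' R Y →
      eLpNorm (duhamelSol a b c m t F G) q volume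
        ≤ ENNReal.ofReal (C * (R ^ (1 - (q⁻¹).toReal) * t ^ ((q⁻¹).toReal - 1 / 2 + δ))
          * (X * Y)) := by
  obtain ⟨C, hC, hb⟩ := h.exists_duhamel_le_of_isLocalised
  refine ⟨C * (1 / δ + 1), by positivity, fun t R X Y F F' G G' hR hRt hF hG => ?_⟩
  have hX : 0 ≤ X := (nrm_nonneg _).trans hF.nrm_le
  have hY : 0 ≤ Y := (nrm_nonneg _).trans hG.nrm_le
  have hXY : 0 ≤ X * Y := mul_nonneg hX hY
  obtain ⟨h1, h2⟩ := hb t R X Y F F' G G' hR hRt hF hG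
  set r := (q⁻¹).toReal with hrdef
  have hr : r ≤ 1 / 2 := inv_toReal_le_half hq
  have hr0 : 0 ≤ r := ENNReal.toReal_nonneg
  have hR0 : 0 < R := one_pos.trans_le hR
  have ht1 : 1 ≤ t := hR.trans hRt
  have ht : 0 < t := one_pos.trans_le ht1
  have hlog : 0 ≤ Real.log t := Real.log_nonneg ht1
  set L := Real.log t + 1 with hL
  have hL1 : 1 ≤ L := by linarith
  -- The logarithm from the tail weight is the only loss here, and it is paid for by t^δ.
  have hLt : L ≤ (1 / δ + 1) * t ^ δ := by
    have e1 := Real.log_le_rpow_div ht.le hδ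
    have e2 : 1 ≤ t ^ δ := Real.one_le_rpow ht1 hδ.le
    have e3 : (1 / δ + 1) * t ^ δ = t ^ δ / δ + t ^ δ := by ring
    linarith
  have h1' : nrm (duhamel a b c m t F G) ≤ Real.sqrt R * (C * (X * Y)) := by
    refine h1.trans_eq ?_; ring
  have h2' : ∀ x, ‖evolve a t (duhamel a b c m t F G) x‖
      ≤ (R * L / Real.sqrt t) * (C * (X * Y)) := fun x => by
    refine (h2 x).trans_eq ?_; ring
  refine (h.eLpNorm_duhamelSol_le hq t hF.measL2 hG.measL2 (by positivity) (Real.sqrt_nonneg R)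
    (by positivity) h1' h2').trans (ENNReal.ofReal_le_ofReal ?_)
  have e1 : Real.sqrt R ^ (2 * r) = R ^ r := by
    rw [Real.sqrt_eq_rpow, ← Real.rpow_mul hR0.le]
    congr 1; ring
  have e2 : (R * L / Real.sqrt t) ^ (1 - 2 * r)
      = R ^ (1 - 2 * r) * L ^ (1 - 2 * r) * t ^ (r - 1 / 2) := by
    rw [Real.div_rpow (by positivity) (Real.sqrt_nonneg t), Real.mul_rpow hR0.le (by linarith),
      Real.sqrt_eq_rpow, ← Real.rpow_mul ht.le, div_eq_mul_inv, ← Real.rpow_neg ht.le]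
    congr 2; ring
  have e3 : L ^ (1 - 2 * r) ≤ (1 / δ + 1) * t ^ δ := by
    calc L ^ (1 - 2 * r) ≤ L ^ (1 : ℝ) := Real.rpow_le_rpow_of_exponent_le hL1 (by linarith)
      _ = L := Real.rpow_one L
      _ ≤ _ := hLt
  rw [e1, e2]
  calc R ^ r * (R ^ (1 - 2 * r) * L ^ (1 - 2 * r) * t ^ (r - 1 / 2)) * (C * (X * Y))
      = (R ^ r * R ^ (1 - 2 * r)) * L ^ (1 - 2 * r) * t ^ (r - 1 / 2) * (C * (X * Y)) := by ring
    _ ≤ (R ^ r * R ^ (1 - 2 * r)) * ((1 / δ + 1) * t ^ δ) * t ^ (r - 1 / 2) * (C * (X * Y)) := by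
        gcongr
    _ = C * (1 / δ + 1) * ((R ^ r * R ^ (1 - 2 * r)) * (t ^ (r - 1 / 2) * t ^ δ)) * (X * Y) := by
        ring
    _ = _ := by
        rw [← Real.rpow_add hR0, ← Real.rpow_add ht, show r + (1 - 2 * r) = 1 - r by ring]

end

/-! ### Spatial truncation of the data -/

theorem hatI_add {f g : ℝ → ℂ} (hf : Integrable f) (hg : Integrable g) :
    hatI (fun x => f x + g x) = fun ξ => hatI f ξ + hatI g ξ := by
  funext ξ
  have hx : ∀ {f : ℝ → ℂ}, hatI f ξ = invHat f (-ξ) := by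
    intro f; rw [invHat, neg_neg]
  simp only [hx]
  exact congrFun (invHat_add hf hg) (-ξ)

theorem IsLocalised.mono {F F' : ℝ → ℂ} {R R₁ X : ℝ} (h : IsLocalised F F' R X) (hR : R ≤ R₁) :
    IsLocalised F F' R₁ X where
  measL2 := h.measL2
  measL2' := h.measL2'
  hasDerivAt := h.hasDerivAt
  nrm_le := h.nrm_le
  nrm_le' := h.nrm_le'.trans
    (mul_le_mul_of_nonneg_right hR ((nrm_nonneg _).trans h.nrm_le))

/-- Functions supported in `[-R, R]` have localised transforms. -/
theorem isLocalised_hatI {V : ℝ → ℂ} (hV : MemLp V 2) {R X : ℝ} (hR : 0 ≤ R)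
    (hsupp : ∀ x, R ≤ |x| → V x = 0) (hX : nrm V ≤ X) :
    IsLocalised (hatI V) (hatI fun x => (-Complex.I * x) * V x) R X := by
  have hb : ∀ x, ‖(-Complex.I * x) * V x‖ ≤ R * ‖V x‖ := fun x => by
    rw [norm_mul, norm_mul, norm_neg, Complex.norm_I, one_mul, Complex.norm_real, Real.norm_eq_abs]
    rcases le_or_gt R |x| with h | h
    · simp [hsupp x h]
    · gcongr
  have hc : Continuous fun x : ℝ => -Complex.I * (x : ℂ) := by fun_prop
  have hW : MemLp (fun x => (-Complex.I * x) * V x) 2 :=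
    hV.of_le_mul (hc.aestronglyMeasurable.mul hV.1) (Filter.Eventually.of_forall hb)
  have i1 : Integrable V := integrable_of_memLp_of_support hV hsupp
  have i2 : Integrable fun x => (-Complex.I * x) * V x :=
    integrable_of_memLp_of_support hW fun x hx => by rw [hsupp x hx, mul_zero]
  have i3 : Integrable fun x : ℝ => x • V x := by
    refine (i2.const_mul Complex.I).congr (Filter.Eventually.of_forall fun x => ?_)
    simp only [Complex.real_smul]
    linear_combination (-(x : ℂ) * V x) * Complex.I_sq
  have hn : ∀ {W : ℝ → ℂ}, Integrable W → MemLp W 2 → nrm (hatI W) = nrm W := fun h1 h2 => by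
    rw [nrm, eLpNorm_hatI h1 h2, nrm]
  refine ⟨⟨(continuous_hatI i1).measurable, memLp_hatI i1 hV⟩,
    ⟨(continuous_hatI i2).measurable, memLp_hatI i2 hW⟩, hasDerivAt_hatI i1 i3, ?_, ?_⟩
  · rwa [hn i1 hV]
  · rw [hn i2 hW]
    exact (nrm_le_of_norm_le hV hR hb).trans (mul_le_mul_of_nonneg_left hX hR)

theorem nrm_indicator_le {s : ℝ} {f : L2} (hf : MemLp (weighted s f) 2) {E : Set ℝ} {K : ℝ}
    (hK : 0 ≤ K) (hE : ∀ x ∈ E, 1 ≤ K * Real.sqrt (1 + x ^ 2) ^ s) :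
    nrm (E.indicator f) ≤ K * nrm (weighted s f) := by
  refine nrm_le_of_norm_le hf hK fun x => ?_
  have h0 : 0 ≤ Real.sqrt (1 + x ^ 2) ^ s := Real.rpow_nonneg (Real.sqrt_nonneg _) s
  rw [weighted, norm_mul, Complex.norm_real, Real.norm_of_nonneg h0, ← mul_assoc]
  by_cases hx : x ∈ E
  · rw [Set.indicator_of_mem hx]
    exact le_mul_of_one_le_left (norm_nonneg _) (hE x hx)
  · rw [Set.indicator_of_notMem hx, norm_zero]
    positivity

theorem nrm_indicator_le_of_nonneg {s : ℝ} (hs : 0 ≤ s) {f : L2} (hf : MemLp (weighted s f) 2)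
    (E : Set ℝ) : nrm (E.indicator f) ≤ nrm (weighted s f) := by
  have := nrm_indicator_le hf (E := E) zero_le_one fun x _ => by
    rw [one_mul]
    exact Real.one_le_rpow (Real.one_le_sqrt.2 (by nlinarith [sq_nonneg x])) hs
  rwa [one_mul] at this

theorem nrm_indicator_le_rpow {s : ℝ} (hs : 0 ≤ s) {f : L2} (hf : MemLp (weighted s f) 2)
    {E : Set ℝ} {ρ : ℝ} (hρ : 0 < ρ) (hE : ∀ x ∈ E, ρ ≤ |x|) :
    nrm (E.indicator f) ≤ ρ ^ (-s) * nrm (weighted s f) := by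
  refine nrm_indicator_le hf (by positivity) fun x hx => ?_
  have h1 : ρ ≤ Real.sqrt (1 + x ^ 2) := by
    refine (hE x hx).trans (Real.abs_le_sqrt ?_)
    linarith
  calc (1 : ℝ) = ρ ^ (-s) * ρ ^ s := by rw [← Real.rpow_add hρ]; simp
    _ ≤ _ := by gcongr

theorem nrm_hat_le {s : ℝ} (hs : 0 ≤ s) {f : L2} (hf : MemLp (weighted s f) 2) :
    nrm (hat f) ≤ nrm (weighted s f) := by
  have h1 := nrm_indicator_le_of_nonneg hs hf Set.univ
  rwa [Set.indicator_univ, nrm, ← eLpNorm_hat, ← nrm] at h1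

/-- The part of `f` in `|x| < R`. -/
def low (f : L2) (R : ℝ) : ℝ → ℂ := {x : ℝ | |x| < R}.indicator f

/-- The part of `f` in `R ≤ |x| < R'`. -/
def band (f : L2) (R R' : ℝ) : ℝ → ℂ := {x : ℝ | R ≤ |x| ∧ |x| < R'}.indicator f

theorem measurableSet_low (R : ℝ) : MeasurableSet {x : ℝ | |x| < R} :=
  measurableSet_lt (by fun_prop) measurable_const

theorem memLp_low (f : L2) (R : ℝ) : MemLp (low f R) 2 :=
  (Lp.memLp f).indicator (measurableSet_low R)

theorem memLp_band (f : L2) (R R' : ℝ) : MemLp (band f R R') 2 :=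
  (Lp.memLp f).indicator
    ((measurableSet_le (measurable_const (a := R)) (by fun_prop : Measurable fun x : ℝ => |x|)).inter
      (measurableSet_low R') : MeasurableSet {x : ℝ | R ≤ |x| ∧ |x| < R'})

theorem low_eq_zero (f : L2) (R : ℝ) (x : ℝ) (hx : R ≤ |x|) : low f R x = 0 :=
  Set.indicator_of_notMem (by simpa using hx) _

theorem band_eq_zero (f : L2) (R R' : ℝ) (x : ℝ) (hx : R' ≤ |x|) : band f R R' x = 0 :=
  Set.indicator_of_notMem (by simp only [Set.mem_ofPred_eq, not_and, not_lt]; exact fun _ => hx) _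

theorem hatI_low_eq (f : L2) {R R' : ℝ} (hR : R ≤ R') :
    hatI (low f R') = fun ξ => hatI (low f R) ξ + hatI (band f R R') ξ := by
  rw [← hatI_add (integrable_of_memLp_of_support (memLp_low f R) (low_eq_zero f R))
    (integrable_of_memLp_of_support (memLp_band f R R') (band_eq_zero f R R'))]
  congr 1; funext x
  simp only [low, band, Set.indicator_apply, Set.mem_ofPred_eq]
  rcases lt_or_ge |x| R with h | h
  · simp [h, h.trans_le hR, not_le.2 h]
  · simp [h, not_lt.2 h]

/-- Plancherel for the outer part of `f`. That part need not be integrable, so its transform is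
represented by this difference rather than by `hatI`. -/
theorem nrm_hat_sub_hatI_low (f : L2) (R : ℝ) :
    nrm (fun ξ => hat f ξ - hatI (low f R) ξ) = nrm ({x : ℝ | R ≤ |x|}.indicator f) := by
  have hm := memLp_low f R
  have hi := integrable_of_memLp_of_support hm (low_eq_zero f R)
  have h1 : nrm (fun ξ => hat f ξ - hatI (low f R) ξ)
      = nrm (fun ξ => hat f ξ - hat (hm.toLp (low f R)) ξ) := by
    unfold nrm
    congr 1
    apply eLpNorm_congr_ae
    filter_upwards [hat_toLp hi hm] with ξ hξ
    rw [hξ]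
  rw [h1, nrm_hat_sub, Lp.norm_def, nrm]
  congr 1
  apply eLpNorm_congr_ae
  filter_upwards [Lp.coeFn_sub f (hm.toLp (low f R)), hm.coeFn_toLp] with x h1 h2
  rw [h1, Pi.sub_apply, h2, low]
  simp only [Set.indicator_apply, Set.mem_ofPred_eq]
  rcases lt_or_ge |x| R with h | h
  · simp [h, not_le.2 h]
  · simp [h, not_lt.2 h]

/-! ### The decay estimate -/

section

variable {a b c : ℝ → ℝ} {m : ℝ × ℝ → ℂ}

/-- The second argument is expanded only against `F`, while `D` meets it undivided. Three terms
instead of four are enough for telescoping. -/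
theorem Setting.eLpNorm_duhamelSol_add_add_le (h : Setting a b c m) {q : ℝ≥0∞} (hq : 1 ≤ q) (t : ℝ)
    {F D G E : ℝ → ℂ} (hF : MeasL2 F) (hD : MeasL2 D) (hG : MeasL2 G) (hE : MeasL2 E) :
    eLpNorm (duhamelSol a b c m t (fun x => F x + D x) (fun x => G x + E x)) q volume
      ≤ eLpNorm (duhamelSol a b c m t F G) q volume + eLpNorm (duhamelSol a b c m t F E) q volume
        + eLpNorm (duhamelSol a b c m t D (fun x => G x + E x)) q volume :=
  (h.eLpNorm_duhamelSol_add_left hq t hF hD (hG.add hE)).trans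
    (add_le_add_left (h.eLpNorm_duhamelSol_add_right hq t hF hG hE) _)

/-- The `L^q` estimate for weighted data and large times. -/
theorem Setting.exists_eLpNorm_duhamelSol_le_weighted (h : Setting a b c m) {q : ℝ≥0∞} (hq : 2 ≤ q)
    {s δ e : ℝ} (hs : 0 ≤ s) (hδ : 0 < δ) (he₁ : (q⁻¹).toReal - 1 / 2 + δ ≤ e)
    (he₂ : 1 / 2 - s + δ ≤ e) :
    ∃ C : ℝ, 0 ≤ C ∧ ∀ (t : ℝ) (f g : L2), 1 ≤ t → MemLp (weighted s f) 2 →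
      MemLp (weighted s g) 2 →
      eLpNorm (duhamelSol a b c m t (hat f) (hat g)) q volume
        ≤ ENNReal.ofReal (C * t ^ e * (nrm (weighted s f) * nrm (weighted s g))) := by
  -- Half of δ pays for the logarithm; the other half pays for the ratio t^{1/J} of consecutive
  -- radii, whence the choice 1/J < δ/2 below.
  obtain ⟨C₁, hC₁, hloc⟩ := h.exists_eLpNorm_duhamelSol_le_of_isLocalised hq (half_pos hδ)
  obtain ⟨C₂, hC₂, hgen⟩ := h.exists_eLpNorm_duhamelSol_le hq
  obtain ⟨n, hn⟩ := exists_nat_one_div_lt (half_pos hδ)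
  set J : ℝ := (n : ℝ) + 1 with hJ
  have hJ0 : 0 < J := by positivity
  have hq1 : 1 ≤ q := one_le_two.trans hq
  have hr : (q⁻¹).toReal ≤ 1 / 2 := inv_toReal_le_half hq
  have hr0 : 0 ≤ (q⁻¹).toReal := ENNReal.toReal_nonneg
  set r := (q⁻¹).toReal with hrdef
  -- The 2(n+1) + 1 terms of the telescoping sum, plus two for the data outside |x| < t.
  refine ⟨(2 * (n + 1) + 3) * (C₁ + C₂), by positivity, fun t f g ht hf hg => ?_⟩
  have ht0 : 0 < t := one_pos.trans_le ht
  set X := nrm (weighted s f) with hX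
  set Y := nrm (weighted s g) with hY
  have hX0 : 0 ≤ X := nrm_nonneg _
  have hY0 : 0 ≤ Y := nrm_nonneg _
  set K : ℝ := (C₁ + C₂) * t ^ e * (X * Y) with hK
  have hK0 : 0 ≤ K := by positivity
  -- Powers of `t` instead of dyadic radii: the number of scales between 1 and `t` is then
  -- independent of `t`.
  set R : ℕ → ℝ := fun j => t ^ ((j : ℝ) / J) with hRdef
  have hR1 : ∀ j, 1 ≤ R j := fun j => Real.one_le_rpow ht (by positivity)
  have hR0 : ∀ j, 0 < R j := fun j => one_pos.trans_le (hR1 j)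
  have hRmono : ∀ j, R j ≤ R (j + 1) := fun j =>
    Real.rpow_le_rpow_of_exponent_le ht (by push_cast; gcongr; linarith)
  have hRt : ∀ j, j ≤ n + 1 → R j ≤ t := fun j hj => by
    refine (Real.rpow_le_rpow_of_exponent_le ht ?_).trans_eq (Real.rpow_one t)
    rw [div_le_one hJ0, hJ]
    exact_mod_cast hj
  have hlow : ∀ {f : L2} (j), MemLp (weighted s f) 2 → IsLocalised (hatI (low f (R j)))
      (hatI fun x => (-Complex.I * x) * low f (R j) x) (R j) (nrm (weighted s f)) := fun j hf =>
    isLocalised_hatI (memLp_low _ _) (hR0 j).le (low_eq_zero _ _)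
      (nrm_indicator_le_of_nonneg hs hf _)
  have hband : ∀ {f : L2} (j), MemLp (weighted s f) 2 → IsLocalised (hatI (band f (R j) (R (j + 1))))
      (hatI fun x => (-Complex.I * x) * band f (R j) (R (j + 1)) x) (R (j + 1))
      (R j ^ (-s) * nrm (weighted s f)) := fun j hf =>
    isLocalised_hatI (memLp_band _ _ _) (hR0 _).le (band_eq_zero _ _ _)
      (nrm_indicator_le_rpow hs hf (hR0 j) fun x hx => hx.1)
  have hdyadic : ∀ j, j < n + 1 → C₁ * (R (j + 1) ^ (1 - r) * t ^ (r - 1 / 2 + δ / 2))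
      * (R j ^ (-s) * (X * Y)) ≤ K := by
    intro j hj
    -- With y = j/J, the exponent is at most y(1/2 - s + δ) + (1-y)(r - 1/2 + δ): a convex
    -- combination of two numbers that `he₁` and `he₂` bound by `e`.
    have h1 : R (j + 1) ^ (1 - r) * t ^ (r - 1 / 2 + δ / 2) * R j ^ (-s) ≤ t ^ e := by
      simp only [hRdef]
      rw [← Real.rpow_mul ht0.le, ← Real.rpow_mul ht0.le, ← Real.rpow_add ht0, ← Real.rpow_add ht0]
      refine Real.rpow_le_rpow_of_exponent_le ht ?_
      have hy0 : 0 ≤ (j : ℝ) / J := by positivity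
      have hy1 : (j : ℝ) / J ≤ 1 := by
        rw [div_le_one hJ0, hJ]; exact_mod_cast hj.le
      have hstep : ((j + 1 : ℕ) : ℝ) / J = j / J + 1 / J := by push_cast; ring
      rw [hstep]
      have hJ1 : 0 < 1 / J := by positivity
      set y := (j : ℝ) / J
      nlinarith [mul_nonneg hy0 (sub_nonneg.2 he₂), mul_nonneg (sub_nonneg.2 hy1)
        (sub_nonneg.2 he₁), mul_nonneg hr0 hJ1.le]
    calc _ = C₁ * (R (j + 1) ^ (1 - r) * t ^ (r - 1 / 2 + δ / 2) * R j ^ (-s)) * (X * Y) := by ring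
      _ ≤ C₁ * t ^ e * (X * Y) := by gcongr
      _ ≤ K := by
        rw [hK]; gcongr; linarith
  have htail : C₂ * t ^ (1 / 2 : ℝ) * (t ^ (-s) * (X * Y)) ≤ K := by
    have h1 : t ^ (1 / 2 : ℝ) * t ^ (-s) ≤ t ^ e := by
      rw [← Real.rpow_add ht0]
      exact Real.rpow_le_rpow_of_exponent_le ht (by linarith)
    calc _ = C₂ * (t ^ (1 / 2 : ℝ) * t ^ (-s)) * (X * Y) := by ring
      _ ≤ C₂ * t ^ e * (X * Y) := by gcongr
      _ ≤ K := by
        rw [hK]; gcongr; linarith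
  -- Enlarging the radius once adds two products, each with an annulus in one slot and a ball in the
  -- other, and each at most `K`.
  have hind : ∀ j, j ≤ n + 1 →
      eLpNorm (duhamelSol a b c m t (hatI (low f (R j))) (hatI (low g (R j)))) q volume
        ≤ ENNReal.ofReal ((2 * j + 1) * K) := by
    intro j
    induction j with
    | zero =>
      intro _
      refine (hloc t (R 0) X Y _ _ _ _ (hR1 0) (hRt 0 (Nat.zero_le _)) (hlow 0 hf)
        (hlow 0 hg)).trans (ENNReal.ofReal_le_ofReal ?_)
      have hR00 : R 0 = 1 := by simp [hRdef]
      rw [hR00, Real.one_rpow, one_mul, hK]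
      have h1 : t ^ (r - 1 / 2 + δ / 2) ≤ t ^ e :=
        Real.rpow_le_rpow_of_exponent_le ht (by linarith)
      have h2 : C₁ ≤ C₁ + C₂ := by linarith
      push_cast
      rw [mul_zero, zero_add, one_mul]
      gcongr
    | succ j ih =>
      intro hj
      have hj' : j < n + 1 := hj
      have hlf := (hlow j hf).mono (hRmono j)
      have hlg := hlow (j + 1) hg
      rw [hatI_low_eq g (hRmono j)] at hlg
      rw [hatI_low_eq f (hRmono j), hatI_low_eq g (hRmono j)]
      refine (h.eLpNorm_duhamelSol_add_add_le hq1 t (hlow j hf).measL2 (hband j hf).measL2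
        (hlow j hg).measL2 (hband j hg).measL2).trans ?_
      have b1 := (hloc t (R (j + 1)) _ _ _ _ _ _ (hR1 _) (hRt _ hj) hlf (hband j hg)).trans
        (ENNReal.ofReal_le_ofReal ((le_of_eq (by ring)).trans (hdyadic j hj')))
      have b2 := (hloc t (R (j + 1)) _ _ _ _ _ _ (hR1 _) (hRt _ hj) (hband j hf) hlg).trans
        (ENNReal.ofReal_le_ofReal ((le_of_eq (by ring)).trans (hdyadic j hj')))
      refine (add_le_add (add_le_add (ih hj'.le) b1) b2).trans_eq ?_
      rw [← ENNReal.ofReal_add (by positivity) hK0, ← ENNReal.ofReal_add (by positivity) hK0]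
      congr 1; push_cast; ring
  -- The last radius is exactly `t`. Beyond it localisation gains nothing, and the bound for general
  -- data with the decay t^{-s} takes over.
  have hRn : R (n + 1) = t := by
    simp only [hRdef]
    rw [show ((n + 1 : ℕ) : ℝ) / J = 1 by push_cast; exact div_self hJ0.ne', Real.rpow_one]
  have hfin := hind (n + 1) le_rfl
  have hlowt : ∀ {f : L2}, MemLp (weighted s f) 2 → MeasL2 (hatI (low f t)) ∧
      nrm (hatI (low f t)) ≤ nrm (weighted s f) := fun hf => by
    have := hlow (n + 1) hf
    rw [hRn] at this
    exact ⟨this.measL2, this.nrm_le⟩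
  rw [hRn] at hfin
  have hD : ∀ {f : L2}, MemLp (weighted s f) 2 → MeasL2 (fun ξ => hat f ξ - hatI (low f t) ξ) ∧
      nrm (fun ξ => hat f ξ - hatI (low f t) ξ) ≤ t ^ (-s) * nrm (weighted s f) := fun hf => by
    refine ⟨⟨(measurable_hat _).sub (hlowt hf).1.meas, (memLp_hat _).sub (hlowt hf).1.memLp⟩, ?_⟩
    rw [nrm_hat_sub_hatI_low]
    exact nrm_indicator_le_rpow hs hf ht0 fun x hx => hx
  have hsum : ∀ f : L2, hat f = fun ξ => hatI (low f t) ξ + (hat f ξ - hatI (low f t) ξ) :=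
    fun f => by funext ξ; ring
  obtain ⟨hF, hFn⟩ := hlowt hf
  obtain ⟨hDf, hDfn⟩ := hD hf
  obtain ⟨hG, -⟩ := hlowt hg
  obtain ⟨hDg, hDgn⟩ := hD hg
  have b1 : eLpNorm (duhamelSol a b c m t (hatI (low f t)) fun ξ => hat g ξ - hatI (low g t) ξ) q
      volume ≤ ENNReal.ofReal K := by
    refine (hgen t _ _ ht0 hF hDg).trans (ENNReal.ofReal_le_ofReal (le_trans ?_ htail))
    refine mul_le_mul_of_nonneg_left ?_ (by positivity)
    calc _ ≤ X * (t ^ (-s) * Y) := mul_le_mul hFn hDgn (nrm_nonneg _) hX0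
      _ = t ^ (-s) * (X * Y) := by ring
  have b2 : eLpNorm (duhamelSol a b c m t (fun ξ => hat f ξ - hatI (low f t) ξ) (hat g)) q
      volume ≤ ENNReal.ofReal K := by
    refine (hgen t _ _ ht0 hDf (measL2_hat g)).trans (ENNReal.ofReal_le_ofReal (le_trans ?_ htail))
    refine mul_le_mul_of_nonneg_left ?_ (by positivity)
    calc _ ≤ (t ^ (-s) * X) * Y :=
          mul_le_mul hDfn (nrm_hat_le hs hg) (nrm_nonneg _) (by positivity)
      _ = _ := by ring
  have key := h.eLpNorm_duhamelSol_add_add_le hq1 t hF hDf hG hDg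
  rw [← hsum f, ← hsum g] at key
  refine (key.trans (add_le_add (add_le_add hfin b1) b2)).trans_eq ?_
  rw [← ENNReal.ofReal_add (by positivity) hK0, ← ENNReal.ofReal_add (by positivity) hK0]
  congr 1; rw [hK]; push_cast; ring

theorem IsSystemSolution.eLpNorm_eq (h : Setting a b c m) {f g : L2} {u v w : ℝ → L2}
    (hs : IsSystemSolution a b c m f g u v w) {t : ℝ} (ht : 0 ≤ t) (q : ℝ≥0∞) :
    eLpNorm (u t) q volume = eLpNorm (duhamelSol a b c m t (hat f) (hat g)) q volume :=
  eLpNorm_congr_ae (ae_eq_invHat (h.integrable_flow_duhamel t (measL2_hat f) (measL2_hat g)).1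
    (hs.hat_eq_duhamel h ht))

theorem Setting.decayEstimate (h : Setting a b c m) {q : ℝ≥0∞} (hq : 2 ≤ q)
    {s δ e : ℝ} (hs : 0 ≤ s) (hδ : 0 < δ) (he₁ : (q⁻¹).toReal - 1 / 2 + δ ≤ e)
    (he₂ : 1 / 2 - s + δ ≤ e) (he : δ ≤ 1 / 4 → e ≤ 1) :
    DecayEstimate a b c m q s e (admissibleTimes δ) := by
  obtain ⟨C₁, hC₁, hlarge⟩ := h.exists_eLpNorm_duhamelSol_le_weighted hq hs hδ he₁ he₂
  obtain ⟨C₂, hC₂, hsmall⟩ := h.exists_eLpNorm_duhamelSol_le_small hq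
  refine ⟨C₁ + C₂, by positivity, fun f g u v w hf hg hsol t ht => ?_⟩
  have hX := nrm_nonneg (weighted s f)
  have hY := nrm_nonneg (weighted s g)
  have ht0 : 0 < t := by
    rcases ht with ht | ht
    · exact one_pos.trans_le ht
    · exact ht.1
  rw [hsol.eLpNorm_eq h ht0.le, ← ofReal_nrm hf, ← ofReal_nrm hg, ← ENNReal.ofReal_mul (by positivity),
    ← ENNReal.ofReal_mul (by positivity), mul_assoc _ (nrm (weighted s f))]
  rcases le_or_gt 1 t with h1 | h1
  · refine (hlarge t f g h1 hf hg).trans (ENNReal.ofReal_le_ofReal ?_)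
    gcongr
    linarith
  · have hδ' : δ ≤ 1 / 4 := by
      rcases ht with ht | ht
      · exact absurd h1 (not_lt.2 ht)
      · exact ht.2
    refine (hsmall t _ _ ht0 (measL2_hat f) (measL2_hat g)).trans (ENNReal.ofReal_le_ofReal ?_)
    have h2 : t ≤ t ^ e := by
      simpa using Real.rpow_le_rpow_of_exponent_ge ht0 h1.le (he hδ')
    have h3 := nrm_hat_le hs hf
    have h4 := nrm_hat_le hs hg
    have h5 := mul_nonneg (nrm_nonneg (hat f)) (nrm_nonneg (hat g))
    have h7 := nrm_nonneg (hat g)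
    have h6 : C₂ ≤ C₁ + C₂ := by linarith
    gcongr

/-- In (∂_ξ - ∂_η)φ the two terms with a' cancel, so a space resonance is a point where b'(ξ) =
c'(η). -/
theorem Setting.of_disjoint (ha : ContDiff ℝ (⊤ : ℕ∞) a) (hb : ContDiff ℝ (⊤ : ℕ∞) b)
    (hc : ContDiff ℝ (⊤ : ℕ∞) c) (hm : ContDiff ℝ (⊤ : ℕ∞) m) (hmc : HasCompactSupport m)
    (hHa : SecondDerivBoundedAway a) (hd : Disjoint (spaceResonances a b c) (tsupport m)) :
    Setting a b c m where
  smooth_a := ha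
  smooth_b := hb
  smooth_c := hc
  smooth_m := hm
  compact_m := hmc
  curved := hHa
  transversal := fun x hx h0 => by
    refine Set.disjoint_left.1 hd ?_ hx
    have hda : ∀ y, HasDerivAt a (deriv a y) y := fun y =>
      (ha.differentiable (by simp) y).hasDerivAt
    have h1 : HasDerivAt (fun ξ => phase a b c ξ x.2) (-deriv a (x.1 + x.2) + deriv b x.1) x.1 :=
      (((hda (x.1 + x.2)).comp_add_const x.1 x.2).fun_neg.fun_add
        (hb.differentiable (by simp) x.1).hasDerivAt).add_const _
    have h2 : HasDerivAt (fun η => phase a b c x.1 η) (-deriv a (x.1 + x.2) + deriv c x.2) x.2 :=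
      (((hda (x.1 + x.2)).comp_const_add x.1 x.2).fun_neg.add_const _).fun_add
        (hc.differentiable (by simp) x.2).hasDerivAt
    show deriv (fun ξ => phase a b c ξ x.2) x.1 - deriv (fun η => phase a b c x.1 η) x.2 = 0
    rw [h1.deriv, h2.deriv]
    linarith

end

end BilinearDispersive
end

/-! ### The three ranges of `s` -/

theorem theorem4p3 (a b c : ℝ → ℝ) (m : ℝ × ℝ → ℂ)
    (ha : ContDiff ℝ (⊤ : ℕ∞) a) (hb : ContDiff ℝ (⊤ : ℕ∞) b) (hc : ContDiff ℝ (⊤ : ℕ∞) c)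
    (hm : ContDiff ℝ (⊤ : ℕ∞) m) (hmc : HasCompactSupport m)
    (hHa : BilinearDispersive.SecondDerivBoundedAway a)
    (hHb : BilinearDispersive.SecondDerivBoundedAway b)
    (hHc : BilinearDispersive.SecondDerivBoundedAway c)
    (hΔ : Disjoint (BilinearDispersive.spaceResonances a b c) (tsupport m))
    (q : ENNReal) (hq : 2 ≤ q) (s δ : ℝ) (hδ : 0 < δ) :
    (0 ≤ s → s < (q⁻¹).toReal →
      BilinearDispersive.DecayEstimate a b c m q s
        ((q⁻¹).toReal / 2 + 1 / 2 - 3 / 2 * s + δ)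
        (BilinearDispersive.admissibleTimes δ)) ∧
    ((q⁻¹).toReal < s → s < 1 - (q⁻¹).toReal →
      BilinearDispersive.DecayEstimate a b c m q s (1 / 2 - s + δ)
        (BilinearDispersive.admissibleTimes δ)) ∧
    (1 - (q⁻¹).toReal < s →
      BilinearDispersive.DecayEstimate a b c m q s ((q⁻¹).toReal - 1 / 2 + δ)
        (BilinearDispersive.admissibleTimes δ)) := by
  have h := BilinearDispersive.Setting.of_disjoint ha hb hc hm hmc hHa hΔ
  have hr := BilinearDispersive.inv_toReal_le_half hq
  have hr0 : 0 ≤ (q⁻¹).toReal := ENNReal.toReal_nonneg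
  refine ⟨fun hs hsr => ?_, fun hrs hs => ?_, fun hs => ?_⟩
  -- With r = 1/q, the exponent here exceeds 1/2 - s + δ by (r - s)/2. It is at most r/2 + 1/2 + δ,
  -- hence at most 1 when δ ≤ 1/4, with equality at q = 2, s = 0, δ = 1/4. In the other two cases
  -- the exponent is itself one of the two lower bounds, and these cross at s = 1 - r.
  · exact h.decayEstimate hq hs hδ (by linarith) (by linarith) fun _ => by linarith
  · exact h.decayEstimate hq (hr0.trans hrs.le) hδ (by linarith) le_rfl fun _ => by linarith
  · exact h.decayEstimate hq (by linarith) hδ le_rfl (by linarith) fun _ => by linarith
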